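/- **Setting.** Let $\mathcal S'_+(\mathbb R)$ be the space of (complex) tempered distributions on $\mathbb R$ supported on $[0,\infty)$. For $T\in\mathcal S'_+(\mathbb R)$ and $\operatorname{Re}s>0$ put $\mathcal L\{T\}(s)=\langle T,\chi(t)e^{-st}\rangle$, where $\chi$ is any smooth cut-off equal to $1$ near $[0,\infty)$ and to $0$ near $-\infty$. For $n\ge 1$, a pair $(k,\kappa)\in\mathcal S'_+(\mathbb R)\times\mathcal S'_+(\mathbb R)$ is a *Sonine pair of order $n$ with symbol $\Phi$* if $$k*\kappa=\frac{t_+^{n-1}}{(n-1)!}\qquad\text{and}\qquad \mathcal L\{\kappa\}(s)=\Phi(s)\quad(\operatorname{Re}s>0).$$ A *Stieltjes function* is $F(s)=\frac as+b+\int_{(0,\infty)}\frac{\sigma(dt)}{s+t}$ and a *complete Bernstein function* is $F(s)=a+bs+\int_{(0,\infty)}\frac{s}{s+t}\,\sigma(dt)$, with $a,b\ge 0$ and a measure $\sigma$ with $\int_{(0,\infty)}\frac{\sigma(dt)}{1+t}<\infty$. A distribution *has a completely monotone density* if it is a measure $b\,\delta_0+g(t)\mathbf 1_{t>0}\,dt$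 with $b\ge0$ and $g$ completely monotone on $(0,\infty)$ and integrable on $(0,1]$. It is *regular at the origin* if it coincides near $0$ with a bounded measurable function. Let $\psi,\omega\in C^\infty(\mathbb R)$ be real-valued with $\psi'>0$, $\psi(\mathbb R)=\mathbb R$ and $\omega>0$, and let $\mathcal S_{\psi,\omega}=\{u=(v\circ\psi)/\omega: v\in\mathcal S(\mathbb R)\}$. For such $u$ put $$\mathfrak I^{(k)}_{\psi,\omega}u=\frac{(k*v)\circ\psi}{\omega},\qquad \mathfrak D^{(\kappa)}_{\psi,\omega}u=\frac{(\kappa*v)^{(n)}\circ\psi}{\omega}.$$ **Proposition.** Let $n\ge1$ and let $\Phi$ be analytic in the right half-plane $\operatorname{Re}s>0$. **(A)** A pair $(k,\kappa)$ of tempered distributions is a Sonine pair of order $n$ with symbol $\Phi$ if and only if $k,\kappa\in\mathcal S'_+(\mathbb R)$, $\Phi$ has no zero in $\operatorname{Re}s>0$, and $$\mathcal L\{k\}(s)=\frac1{s^n\Phi(s)},\qquad \mathcal L\{\kappa\}(s)=\Phi(s)\qquad(\operatorname{Re}s>0).$$ There is a unique such pair if and only if these two inverse Laplace transforms exist in $\mathcal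 S'_+(\mathbb R)$. **(B)** Let $(k,\kappa)$ be a Sonine pair of order $n$ with symbol $\Phi$. If $\Phi(x)/F(x)\to1$ as $x\to+\infty$ for some Stieltjes function $F$ with $xF(x)\to\infty$, or if $\Phi(x)/x^{\alpha-n}\to c$ as $x\to+\infty$ for some $n-1<\alpha<n$ and $c\ne0$, then $\kappa$ is not regular at the origin. **(C)** Suppose that $\Psi(s)=s^n\Phi(s)$ is a complete Bernstein function, not identically zero. Then there is a unique Sonine pair $(k,\kappa)$ of order $n$ with symbol $\Phi$; the function $\mathcal L\{k\}=1/\Psi$ is a Stieltjes function and $k$ has a completely monotone density. If $\Phi$ is a Stieltjes function, then $\kappa$ has a completely monotone density too. If $n=1$, then $\Phi$ is always a Stieltjes function, and moreover $k*\kappa'=\delta$. For all $\psi,\omega$ as above, $\mathfrak I^{(k)}_{\psi,\omega}$ maps non-negative functions of $\mathcal S_{\psi,\omega}$ to non-negative functions, and so does $\mathfrak I^{(\kappa)}_{\psi,\omega}$ if $\Phi$ is a Stieltjes function. Finally, $\mathfrak D^{(\kappa)}_{\psi,\omega}$ maps $\mathcal S_{\psi,\omega}$ into $L^2(\mathbb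 R,\omega^2\psi'\,dt)$, and the closure of $-\mathfrak D^{(\kappa)}_{\psi,\omega}$ (with domain $\mathcal S_{\psi,\omega}$) generates on this space a strongly continuous contraction semigroup that preserves positivity. -/

import Mathlib

open MeasureTheory Filter Set
open scoped Topology ContDiff SchwartzMap ComplexOrder

noncomputable section

namespace WeylSonine

/-! ### Laplace transform and convolution of tempered distributions supported on `[0, ∞)` -/

/-- The space `𝓢'₊(ℝ)`: tempered distributions supported on `[0, ∞)`, i.e. vanishing on
every Schwartz function whose (closed) support lies in `(-∞, 0)`. -/
def IsCausal (T : 𝓢'(ℝ, ℂ)) : Prop :=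
  Distribution.IsVanishingOn T (Iio (0 : ℝ))

/-- The function `t ↦ χ(t) e^{-st}`, where `χ` is a fixed smooth cut-off with `χ = 1` on
`[-1, ∞)` and `χ = 0` on `(-∞, -2]`. -/
def cutExp (s : ℂ) (t : ℝ) : ℂ :=
  (Real.smoothTransition (t + 2) : ℂ) * Complex.exp (-(s * t))

theorem contDiff_cutExp (s : ℂ) : ContDiff ℝ ∞ (cutExp s) := by
  unfold cutExp
  apply ContDiff.mul
  · exact Complex.ofRealCLM.contDiff.comp
      (Real.smoothTransition.contDiff.comp (contDiff_id.add contDiff_const))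
  · exact Complex.contDiff_exp.comp
      ((contDiff_const.mul Complex.ofRealCLM.contDiff).neg)

theorem cutExp_of_ge (s : ℂ) {t : ℝ} (ht : -1 ≤ t) : cutExp s t = Complex.exp (-(s * t)) := by
  simp [cutExp, Real.smoothTransition.one_of_one_le (show (1 : ℝ) ≤ t + 2 by linarith)]

theorem cutExp_of_le (s : ℂ) {t : ℝ} (ht : t ≤ -2) : cutExp s t = 0 := by
  simp [cutExp, Real.smoothTransition.zero_of_nonpos (show t + 2 ≤ 0 by linarith)]

theorem iteratedDeriv_exp_neg_mul (s : ℂ) (m : ℕ) :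
    iteratedDeriv m (fun t : ℝ => Complex.exp (-(s * t))) =
      fun t : ℝ => (-s) ^ m * Complex.exp (-(s * t)) := by
  induction m with
  | zero => simp
  | succ m ih =>
    rw [iteratedDeriv_succ, ih]
    funext t
    have h1 : HasDerivAt (fun t : ℝ => -(s * (t : ℂ))) (-(s * 1)) t :=
      ((Complex.ofRealCLM.hasDerivAt (x := t)).const_mul s).neg
    have h2 := (h1.cexp.const_mul ((-s) ^ m)).deriv
    rw [h2]
    ring

theorem decay_cutExp (s : ℂ) (hs : 0 < s.re) (j m : ℕ) :
    ∃ C, ∀ t : ℝ, ‖t‖ ^ j * ‖iteratedFDeriv ℝ m (cutExp s) t‖ ≤ C := by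
  have hcont : Continuous fun t : ℝ => ‖t‖ ^ j * ‖iteratedFDeriv ℝ m (cutExp s) t‖ :=
    (continuous_norm.pow j).mul
      ((contDiff_cutExp s).continuous_iteratedFDeriv (by exact_mod_cast le_top)).norm
  obtain ⟨C, hC⟩ := (isCompact_Icc (a := (-3 : ℝ)) (b := 0)).exists_bound_of_continuousOn
    hcont.continuousOn
  have hC0 : 0 ≤ C := (norm_nonneg _).trans (hC 0 (by norm_num))
  have hD0 : 0 ≤ ‖s‖ ^ m * (j.factorial / s.re ^ j) := by positivity
  refine ⟨C + ‖s‖ ^ m * (j.factorial / s.re ^ j), fun t => ?_⟩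
  rcases lt_or_ge t (-3) with h | h
  · have : cutExp s =ᶠ[𝓝 t] fun _ => 0 := by
      filter_upwards [Iio_mem_nhds (show t < -2 by linarith)] with x hx
      exact cutExp_of_le s (le_of_lt hx)
    have h0 : iteratedFDeriv ℝ m (cutExp s) t = 0 := by
      rw [(this.iteratedFDeriv ℝ m).eq_of_nhds]
      simp
    rw [h0]
    simp only [norm_zero, mul_zero]
    positivity
  · rcases le_or_gt t 0 with h' | h'
    · have := hC t ⟨h, h'⟩
      rw [Real.norm_of_nonneg (by positivity)] at this
      linarith
    · have : cutExp s =ᶠ[𝓝 t] fun t : ℝ => Complex.exp (-(s * t)) := by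
        filter_upwards [Ioi_mem_nhds (show (-1 : ℝ) < t by linarith)] with x hx
        exact cutExp_of_ge s (le_of_lt hx)
      rw [(this.iteratedFDeriv ℝ m).eq_of_nhds, norm_iteratedFDeriv_eq_norm_iteratedDeriv,
        iteratedDeriv_exp_neg_mul, norm_mul, norm_pow, norm_neg, Complex.norm_exp]
      have hre : (-(s * (t : ℂ))).re = -(s.re * t) := by simp
      rw [hre, Real.norm_of_nonneg h'.le]
      have hb := Real.pow_div_factorial_le_exp (s.re * t) (by positivity) j
      have key : t ^ j * Real.exp (-(s.re * t)) ≤ j.factorial / s.re ^ j := by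
        rw [Real.exp_neg, ← div_eq_mul_inv, div_le_div_iff₀ (Real.exp_pos _) (by positivity)]
        rw [div_le_iff₀ (by positivity), mul_pow] at hb
        linarith
      calc t ^ j * (‖s‖ ^ m * Real.exp (-(s.re * t)))
          = ‖s‖ ^ m * (t ^ j * Real.exp (-(s.re * t))) := by ring
        _ ≤ ‖s‖ ^ m * (j.factorial / s.re ^ j) := by gcongr
        _ ≤ _ := by linarith

/-- `χ(t) e^{-st}` as a Schwartz function, for `Re s > 0`. -/
def cutExpSchwartz (s : ℂ) (hs : 0 < s.re) : 𝓢(ℝ, ℂ) where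
  toFun := cutExp s
  smooth' := contDiff_cutExp s
  decay' := decay_cutExp s hs

/-- The Laplace transform `𝓛{T}(s) = ⟨T, χ(t) e^{-st}⟩`, `Re s > 0`, of `T ∈ 𝓢'₊(ℝ)`; for such
`T` the value does not depend on the cut-off `χ`, which is `1` near `[0, ∞)`. -/
def laplace (T : 𝓢'(ℝ, ℂ)) (s : ℂ) (hs : 0 < s.re) : ℂ :=
  T (cutExpSchwartz s hs)

/-- `𝓛{T}(s) = F(s)` for all `s` in the open right half-plane. -/
def HasLaplaceTransform (T : 𝓢'(ℝ, ℂ)) (F : ℂ → ℂ) : Prop :=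
  ∀ (s : ℂ) (hs : 0 < s.re), laplace T s hs = F s

/-- `S * T = R` for `S, T ∈ 𝓢'₊(ℝ)`: `⟨R, φ⟩ = ⟨S_x, ⟨T_y, φ(x + y)⟩⟩` for all `φ ∈ 𝓢(ℝ)`.
The function `x ↦ ⟨T_y, φ(x + y)⟩` is smooth, and rapidly decreasing only towards `+∞`, so `S` is
evaluated, as usual, at a Schwartz function `g` that agrees with it on a neighbourhood
of `[0, ∞)`; the value does not depend on the choice of `g`. -/
def IsConvolution (S T : 𝓢'(ℝ, ℂ)) (R : 𝓢(ℝ, ℂ) → ℂ) : Prop :=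
  ∀ φ : 𝓢(ℝ, ℂ), ∃ g : 𝓢(ℝ, ℂ),
    (∃ ε > 0, ∀ x : ℝ, -ε < x → g x = T (SchwartzMap.compSubConstCLM ℂ (-x) φ)) ∧
      R φ = S g

/-- The distribution `t₊^{n-1} / (n-1)!`, for `n ≥ 1`. -/
def truncatedPower (n : ℕ) (φ : 𝓢(ℝ, ℂ)) : ℂ :=
  ∫ t in Ioi (0 : ℝ), ((t ^ (n - 1) / (n - 1).factorial : ℝ) : ℂ) * φ t

/-- The generalized Sonine relation of order `n`: `k, κ ∈ 𝓢'₊(ℝ)` and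
`k * κ = t₊^{n-1} / (n-1)!`. -/
def IsSoninePair (n : ℕ) (k κ : 𝓢'(ℝ, ℂ)) : Prop :=
  IsCausal k ∧ IsCausal κ ∧ IsConvolution k κ (truncatedPower n)

/-- `(k, κ)` is a Sonine pair of order `n` whose spectral symbol `𝓛{κ}` is `Φ`. -/
def IsSoninePairWithSymbol (n : ℕ) (Φ : ℂ → ℂ) (k κ : 𝓢'(ℝ, ℂ)) : Prop :=
  IsSoninePair n k κ ∧ HasLaplaceTransform κ Φ

/-- `k, κ ∈ 𝓢'₊(ℝ)` are the inverse Laplace transforms of `1 / (sⁿ Φ(s))` and `Φ(s)`. The first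
of these functions has to be defined on the half-plane, so `Φ` has no zero there. -/
def IsInverseLaplacePair (n : ℕ) (Φ : ℂ → ℂ) (k κ : 𝓢'(ℝ, ℂ)) : Prop :=
  IsCausal k ∧ IsCausal κ ∧ (∀ s : ℂ, 0 < s.re → Φ s ≠ 0) ∧
    HasLaplaceTransform k (fun s => 1 / (s ^ n * Φ s)) ∧ HasLaplaceTransform κ Φ

/-- `T` is regular at the origin: near `0` it is given by a bounded function. -/
def IsRegularAtOrigin (T : 𝓢'(ℝ, ℂ)) : Prop :=
  ∃ ε > 0, ∃ f : ℝ → ℂ, Measurable f ∧ (∃ C : ℝ, ∀ t, ‖f t‖ ≤ C) ∧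
    ∀ φ : 𝓢(ℝ, ℂ), tsupport φ ⊆ Ioo (-ε) ε → T φ = ∫ t, f t * φ t

/-! ### Stieltjes, complete Bernstein and completely monotone functions -/

/-- Stieltjes functions: `F(s) = a/s + b + ∫_{(0,∞)} σ(dt) / (s + t)` with `a, b ≥ 0` and
`∫_{(0,∞)} σ(dt) / (1 + t) < ∞`. -/
def IsStieltjes (F : ℂ → ℂ) : Prop :=
  ∃ (a b : ℝ) (σ : Measure ℝ), 0 ≤ a ∧ 0 ≤ b ∧
    ∫⁻ t in Ioi (0 : ℝ), ENNReal.ofReal (1 / (1 + t)) ∂σ < ⊤ ∧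
    ∀ s : ℂ, 0 < s.re → F s = a / s + b + ∫ t in Ioi (0 : ℝ), 1 / (s + t) ∂σ

/-- Complete Bernstein functions: `F(s) = a + b s + ∫_{(0,∞)} s / (s + t) σ(dt)` with `a, b ≥ 0`
and `∫_{(0,∞)} σ(dt) / (1 + t) < ∞`. -/
def IsCompleteBernstein (F : ℂ → ℂ) : Prop :=
  ∃ (a b : ℝ) (σ : Measure ℝ), 0 ≤ a ∧ 0 ≤ b ∧
    ∫⁻ t in Ioi (0 : ℝ), ENNReal.ofReal (1 / (1 + t)) ∂σ < ⊤ ∧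
    ∀ s : ℂ, 0 < s.re → F s = a + b * s + ∫ t in Ioi (0 : ℝ), s / (s + t) ∂σ

/-- Complete monotonicity on `(0, ∞)`. -/
def IsCompletelyMonotone (g : ℝ → ℝ) : Prop :=
  ContDiffOn ℝ ∞ g (Ioi 0) ∧ ∀ (m : ℕ) (t : ℝ), 0 < t → 0 ≤ (-1) ^ m * iteratedDeriv m g t

/-- `T` is the measure `b δ₀ + g(t) dt` on `[0, ∞)`, with `b ≥ 0` and a density `g` that is
completely monotone on `(0, ∞)` and integrable at `0`. -/
def HasCompletelyMonotoneDensity (T : 𝓢'(ℝ, ℂ)) : Prop :=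
  ∃ (b : ℝ) (g : ℝ → ℝ), 0 ≤ b ∧ IsCompletelyMonotone g ∧ IntegrableOn g (Ioc 0 1) ∧
    ∀ φ : 𝓢(ℝ, ℂ), T φ = b * φ 0 + ∫ t in Ioi (0 : ℝ), (g t : ℂ) * φ t

/-! ### Weighted Weyl-Sonine operators -/

/-- Admissible structure pairs: a smooth time scale `ψ` with `ψ' > 0` and `ψ(ℝ) = ℝ`, and a smooth
positive weight `w`. -/
structure IsAdmissible (ψ w : ℝ → ℝ) : Prop where
  smooth_scale : ContDiff ℝ ∞ ψ
  deriv_pos : ∀ t, 0 < deriv ψ t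
  surjective : Function.Surjective ψ
  smooth_weight : ContDiff ℝ ∞ w
  weight_pos : ∀ t, 0 < w t

/-- The weighted Schwartz space `𝓢_{ψ,w}`: functions `u(t) = f(ψ(t)) / w(t)`, `f ∈ 𝓢(ℝ)`. -/
def WeightedSchwartz (ψ w : ℝ → ℝ) : Type :=
  {u : ℝ → ℂ // ∃ f : 𝓢(ℝ, ℂ), ∀ t, u t = f (ψ t) / w t}

/-- The rectified function `v = Q_ψ⁻¹ M_w u ∈ 𝓢(ℝ)` of `u ∈ 𝓢_{ψ,w}`. -/
def WeightedSchwartz.rectify {ψ w : ℝ → ℝ} (u : WeightedSchwartz ψ w) : 𝓢(ℝ, ℂ) :=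
  u.2.choose

/-- For an admissible pair this determines `rectify u`, because `ψ` is surjective. -/
theorem WeightedSchwartz.rectify_apply {ψ w : ℝ → ℝ} (h : IsAdmissible ψ w)
    (u : WeightedSchwartz ψ w) (t : ℝ) : u.rectify (ψ t) = w t * u.1 t := by
  have h1 : (w t : ℂ) ≠ 0 := by exact_mod_cast (h.weight_pos t).ne'
  have h2 : u.1 t = u.rectify (ψ t) / w t := u.2.choose_spec t
  rw [h2]
  field_simp

/-- The convolution `(T * v)(y) = ⟨T_z, v(y - z)⟩` of a tempered distribution and a Schwartz
function. -/
def convSchwartz (T : 𝓢'(ℝ, ℂ)) (v : 𝓢(ℝ, ℂ)) (y : ℝ) : ℂ :=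
  T (SchwartzMap.compSubConstCLM ℂ y
    (SchwartzMap.compCLMOfContinuousLinearEquiv ℂ (ContinuousLinearEquiv.neg ℝ) v))

/-- The weighted Weyl-Sonine integral `M_w⁻¹ Q_ψ (k *) Q_ψ⁻¹ M_w u`. -/
def weylSonineIntegral {ψ w : ℝ → ℝ} (k : 𝓢'(ℝ, ℂ)) (u : WeightedSchwartz ψ w) (t : ℝ) : ℂ :=
  convSchwartz k u.rectify (ψ t) / w t

/-- The weighted Weyl-Sonine derivative `M_w⁻¹ Q_ψ (dⁿ/dyⁿ ∘ (κ *)) Q_ψ⁻¹ M_w u` of order `n`. -/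
def weylSonineDeriv {ψ w : ℝ → ℝ} (n : ℕ) (κ : 𝓢'(ℝ, ℂ)) (u : WeightedSchwartz ψ w)
    (t : ℝ) : ℂ :=
  iteratedDeriv n (convSchwartz κ u.rectify) (ψ t) / w t

/-- The measure `w(t)² ψ'(t) dt`, for which `u ↦ (w u) ∘ ψ⁻¹` is an isometry of
`L²(w² ψ' dt)` onto `L²(ℝ)`. -/
def weightedMeasure (ψ w : ℝ → ℝ) : Measure ℝ :=
  volume.withDensity fun t => ENNReal.ofReal (w t ^ 2 * deriv ψ t)

/-- The weighted Hilbert space `L²(w² ψ' dt)`. -/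
abbrev WeightedL2 (ψ w : ℝ → ℝ) : Type :=
  Lp ℂ 2 (weightedMeasure ψ w)

/-- Strongly continuous one-parameter semigroups of bounded operators (only `τ ≥ 0` matters). -/
structure IsC0Semigroup {X : Type*} [NormedAddCommGroup X] [NormedSpace ℂ X]
    (S : ℝ → X →L[ℂ] X) : Prop where
  map_zero : S 0 = ContinuousLinearMap.id ℂ X
  map_add : ∀ τ τ' : ℝ, 0 ≤ τ → 0 ≤ τ' → S (τ + τ') = (S τ).comp (S τ')
  tendsto_zero : ∀ f : X, Tendsto (fun τ => S τ f) (𝓝[>] 0) (𝓝 f)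

/-- The graph of the infinitesimal generator of `S`. -/
def generatorGraph {X : Type*} [NormedAddCommGroup X] [NormedSpace ℂ X]
    (S : ℝ → X →L[ℂ] X) : Set (X × X) :=
  {p | Tendsto (fun τ : ℝ => ((τ⁻¹ : ℝ) : ℂ) • (S τ p.1 - p.1)) (𝓝[>] 0) (𝓝 p.2)}

/-- The graph of `-𝔇_{ψ,w}^{(κ)}` with domain `𝓢_{ψ,w}`, as an operator in `L²(w² ψ' dt)`. -/
def negDerivGraph (ψ w : ℝ → ℝ) (n : ℕ) (κ : 𝓢'(ℝ, ℂ)) :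
    Set (WeightedL2 ψ w × WeightedL2 ψ w) :=
  {p | ∃ u : WeightedSchwartz ψ w, p.1 =ᵐ[weightedMeasure ψ w] u.1 ∧
    p.2 =ᵐ[weightedMeasure ψ w] fun t => -weylSonineDeriv n κ u t}

/-- `𝔇_{ψ,w}^{(κ)}` maps `𝓢_{ψ,w}` into `L²(w² ψ' dt)`, and the closure of its negative generates a
strongly continuous contraction semigroup that preserves positivity. -/
def GeneratesPositiveSemigroup (ψ w : ℝ → ℝ) (n : ℕ) (κ : 𝓢'(ℝ, ℂ)) : Prop :=
  (∀ u : WeightedSchwartz ψ w, MemLp u.1 2 (weightedMeasure ψ w) ∧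
    MemLp (weylSonineDeriv n κ u) 2 (weightedMeasure ψ w)) ∧
  ∃ S : ℝ → WeightedL2 ψ w →L[ℂ] WeightedL2 ψ w,
    IsC0Semigroup S ∧ (∀ τ : ℝ, 0 ≤ τ → ‖S τ‖ ≤ 1) ∧
    generatorGraph S = closure (negDerivGraph ψ w n κ) ∧
    ∀ (τ : ℝ) (f : WeightedL2 ψ w), 0 ≤ τ →
      (∀ᵐ t ∂weightedMeasure ψ w, 0 ≤ f t) → ∀ᵐ t ∂weightedMeasure ψ w, 0 ≤ S τ f t

/-- The weighted Weyl-Sonine integral with kernel `k` preserves non-negativity on `𝓢_{ψ,w}`. -/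
def IntegralPreservesPositivity (ψ w : ℝ → ℝ) (k : 𝓢'(ℝ, ℂ)) : Prop :=
  ∀ u : WeightedSchwartz ψ w, (∀ t, 0 ≤ u.1 t) → ∀ t, 0 ≤ weylSonineIntegral k u t

end WeylSonine

end

open WeylSonine

noncomputable section

namespace WeylSonine

/-! ### Seminorm estimates for tempered distributions -/

/-! Two transforms carry the proof. The Laplace transform is multiplicative on convolutions of
causal distributions (`laplace_conv`) and injective on them (`eq_of_laplace_eq`): under u = e^{-t} a
test function that vanishes far to the right becomes smooth on a compact interval, polynomials in u
approximate it together with its derivatives, and these polynomials are combinations of e^{-t},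
e^{-2t}, ... . The Sonine relation therefore says exactly 𝓛k · Φ = s^{-n}, which is (A); see
`isSoninePairWithSymbol_iff`.

For (B), a causal distribution that is bounded near 0 has a Laplace transform of size O(1/x) on the
real axis (`exists_bound_laplace_of_isRegularAtOrigin`), whereas both asymptotic hypotheses force x
Φ(x) to be unbounded.

For (C), write Ψ(s) = s (a/s + b + ∫ σ(dt)/(s+t)). The bracket is the Laplace transform of the
measure κ₁ = b δ₀ + (a + ∫ e^{-rt} σ(dt)) dr, and κ is the (n-1)-fold primitive of κ₁. The kernel k
exists once 1/Ψ is known to be a Stieltjes function (`isStieltjes_one_div`). With x = 1 - z, the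
quotient Ψ(x)/Ψ(1) takes the form 1 - z ∫ dρ/(1 - zU). Its reciprocal is ⟨e, (1 - zA)⁻¹ e⟩ for a
positive contraction A = B*B on ℂ ⊕ L²(ρ), so the spectral theorem turns it into ∫ μ(du)/(1 - zu)
with μ on [0,1]. The substitution t = (1-u)/u makes this a Stieltjes function on the positive axis,
and the identity theorem extends the equality to the half-plane. Stieltjes functions are iterated
Laplace transforms, whence the completely monotone densities; convolution with a positive measure
preserves positivity.

For the semigroup, (κ * v)^{(n)} = κ₁ * v' is the Fourier multiplier with symbol m(ξ) = Ψ(2πiξ),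
where Ψ on the imaginary axis is given by the Bernstein formula. Since Re m ≥ 0, multiplication by
e^{-τm} is a contraction semigroup generated by multiplication by -m. Linear growth of m keeps m v
in L² for Schwartz v, and (1+m)𝓢 is dense, so the Schwartz functions form a core
(`closure_schwartzGraph`). For finite σ the multiplier e^{-τm} is a constant times a translation
times the exponential of a positive mixture of translations, hence positive; truncating σ gives the
general case (`isPosMult_exp_neg_bernstein`). The unitary map f ↦ (f ∘ ψ)/w respects positivity and
transports everything to the weighted space. -/

theorem contDiff_of_schwartz (φ : 𝓢(ℝ, ℂ)) : ContDiff ℝ ∞ φ := φ.smooth ⊤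

/-- A tempered distribution is bounded by finitely many weighted derivatives. -/
theorem exists_bound (T : 𝓢'(ℝ, ℂ)) : ∃ (N : ℕ) (C : ℝ), 0 ≤ C ∧ ∀ (φ : 𝓢(ℝ, ℂ)) (M : ℝ),
    (∀ m ≤ N, ∀ t : ℝ, (1 + |t|) ^ N * ‖iteratedDeriv m φ t‖ ≤ M) → ‖T φ‖ ≤ C * M := by
  obtain ⟨s, C, -, hC⟩ := Seminorm.bound_of_continuous (schwartz_withSeminorms ℂ ℝ ℂ)
    ((normSeminorm ℂ ℂ).comp (T : 𝓢(ℝ, ℂ) →ₗ[ℂ] ℂ)) (by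
      change Continuous fun φ => ‖T φ‖
      exact T.continuous.norm)
  -- A single N dominates every weight exponent and every derivative order in the finite family of
  -- seminorms.
  refine ⟨s.sup fun p => max p.1 p.2, C, C.2, fun φ M h => ?_⟩
  have h1 : ‖T φ‖ ≤ C * s.sup (schwartzSeminormFamily ℂ ℝ ℂ) φ := hC φ
  refine h1.trans (mul_le_mul_of_nonneg_left ?_ C.2)
  have hM : 0 ≤ M := le_trans (by positivity) (h 0 (Nat.zero_le _) 0)
  refine Seminorm.finset_sup_apply_le hM fun p hp => ?_
  have hp' : max p.1 p.2 ≤ s.sup fun p => max p.1 p.2 := Finset.le_sup (f := fun p => max p.1 p.2) hp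
  refine SchwartzMap.seminorm_le_bound' ℂ p.1 p.2 φ hM fun t => ?_
  refine le_trans ?_ (h p.2 ((le_max_right _ _).trans hp') t)
  gcongr
  calc |t| ^ p.1 ≤ (1 + |t|) ^ p.1 := by gcongr; linarith
    _ ≤ _ := pow_le_pow_right₀ (by linarith [abs_nonneg t]) ((le_max_left _ _).trans hp')

theorem norm_iteratedDeriv_mul_le {f g : ℝ → ℂ} (hf : ContDiff ℝ ∞ f) (hg : ContDiff ℝ ∞ g)
    {m : ℕ} {t K B : ℝ} (hK : ∀ i ≤ m, ‖iteratedDeriv i f t‖ ≤ K)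
    (hB : ∀ i ≤ m, ‖iteratedDeriv i g t‖ ≤ B) :
    ‖iteratedDeriv m (fun t => f t * g t) t‖ ≤ 2 ^ m * (K * B) := by
  have h0 : 0 ≤ K := (norm_nonneg _).trans (hK 0 (Nat.zero_le _))
  have := iteratedDeriv_mul (n := m) (x := t) (f := f) (g := g)
    (hf.of_le (by exact_mod_cast le_top)).contDiffAt (hg.of_le (by exact_mod_cast le_top)).contDiffAt
  change ‖iteratedDeriv m (f * g) t‖ ≤ _
  rw [this]
  calc _ ≤ ∑ i ∈ Finset.range (m + 1), (m.choose i : ℝ) * (K * B) := by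
        refine (norm_sum_le _ _).trans (Finset.sum_le_sum fun i hi => ?_)
        rw [norm_mul, norm_mul, Complex.norm_natCast, mul_assoc]
        gcongr
        · exact hK i (by simpa [Nat.lt_succ_iff] using hi)
        · exact hB _ (Nat.sub_le _ _)
    _ = _ := by
        rw [← Finset.sum_mul]
        congr 1
        exact_mod_cast Nat.sum_range_choose m

/-! ### Smooth steps -/

/-- A smooth step: `0` on `(-∞, a]` and `1` on `[b, ∞)`. -/
def step (a b : ℝ) (t : ℝ) : ℂ := (Real.smoothTransition ((t - a) / (b - a)) : ℂ)

theorem contDiff_step (a b : ℝ) : ContDiff ℝ ∞ (step a b) :=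
  Complex.ofRealCLM.contDiff.comp (Real.smoothTransition.contDiff.comp
    ((contDiff_id.sub contDiff_const).div_const _))

theorem step_of_le {a b t : ℝ} (hab : a < b) (ht : t ≤ a) : step a b t = 0 := by
  rw [step, Real.smoothTransition.zero_of_nonpos, Complex.ofReal_zero]
  exact div_nonpos_of_nonpos_of_nonneg (by linarith) (by linarith)

theorem step_of_ge {a b t : ℝ} (hab : a < b) (ht : b ≤ t) : step a b t = 1 := by
  rw [step, Real.smoothTransition.one_of_one_le, Complex.ofReal_one]
  rw [le_div_iff₀ (by linarith)]
  linarith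

theorem norm_iteratedDeriv_const_le (c : ℂ) (m : ℕ) (t : ℝ) :
    ‖iteratedDeriv m (fun _ : ℝ => c) t‖ ≤ ‖c‖ := by
  rcases Nat.eq_zero_or_pos m with rfl | hm
  · simp
  · simp [iteratedDeriv_const, hm.ne']

theorem exists_bound_iteratedDeriv_step {a b : ℝ} (hab : a < b) (N : ℕ) :
    ∃ K : ℝ, 0 ≤ K ∧ ∀ m ≤ N, ∀ t, ‖iteratedDeriv m (step a b) t‖ ≤ K := by
  have key : ∀ m, ∃ K : ℝ, 0 ≤ K ∧ ∀ t, ‖iteratedDeriv m (step a b) t‖ ≤ K := by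
    intro m
    obtain ⟨C, hC⟩ := (isCompact_Icc (a := a - 1) (b := b + 1)).exists_bound_of_continuousOn
      ((contDiff_step a b).continuous_iteratedDeriv m (by exact_mod_cast le_top)).continuousOn
    refine ⟨max C 1, by positivity, fun t => ?_⟩
    rcases lt_or_ge t a with h | h
    · have : step a b =ᶠ[𝓝 t] fun _ => 0 := by
        filter_upwards [Iio_mem_nhds h] with x hx using step_of_le hab (le_of_lt hx)
      rw [this.iteratedDeriv_eq]
      exact (norm_iteratedDeriv_const_le _ _ _).trans (by simp)
    rcases lt_or_ge b t with h' | h'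
    · have : step a b =ᶠ[𝓝 t] fun _ => 1 := by
        filter_upwards [Ioi_mem_nhds h'] with x hx using step_of_ge hab (le_of_lt hx)
      rw [this.iteratedDeriv_eq]
      exact (norm_iteratedDeriv_const_le _ _ _).trans (by simp)
    · exact (hC t ⟨by linarith, by linarith⟩).trans (le_max_left _ _)
  choose K hK0 hK using key
  refine ⟨∑ m ∈ Finset.range (N + 1), K m, Finset.sum_nonneg fun m _ => hK0 m,
    fun m hm t => (hK m t).trans ?_⟩
  exact Finset.single_le_sum (f := K) (fun i _ => hK0 i) (Finset.mem_range.2 (by omega))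

theorem hasTemperateGrowth_step {a b : ℝ} (hab : a < b) : (step a b).HasTemperateGrowth := by
  refine ⟨contDiff_step a b, fun m => ?_⟩
  obtain ⟨K, -, hK⟩ := exists_bound_iteratedDeriv_step hab m
  refine ⟨0, K, fun t => ?_⟩
  rw [norm_iteratedFDeriv_eq_norm_iteratedDeriv]
  simpa using hK m le_rfl t

theorem step_smul_apply {a b : ℝ} (hab : a < b) (φ : 𝓢(ℝ, ℂ)) (t : ℝ) :
    SchwartzMap.smulLeftCLM ℂ (step a b) φ t = step a b t * φ t := by
  rw [SchwartzMap.smulLeftCLM_apply_apply (hasTemperateGrowth_step hab), smul_eq_mul]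

theorem coe_step_smul {a b : ℝ} (hab : a < b) (φ : 𝓢(ℝ, ℂ)) :
    (SchwartzMap.smulLeftCLM ℂ (step a b) φ : ℝ → ℂ) = fun t => step a b t * φ t :=
  funext (step_smul_apply hab φ)

theorem tsupport_subset_Iic {f : ℝ → ℂ} {a : ℝ} (h : ∀ t, a < t → f t = 0) :
    tsupport f ⊆ Iic a :=
  closure_minimal (fun t ht => not_lt.1 fun h' => ht (h t h')) isClosed_Iic

theorem tsupport_subset_Ici {f : ℝ → ℂ} {a : ℝ} (h : ∀ t, t < a → f t = 0) :
    tsupport f ⊆ Ici a :=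
  closure_minimal (fun t ht => not_lt.1 fun h' => ht (h t h')) isClosed_Ici

/-- A distribution vanishing on `(-∞, a)` only depends on a test function near `[a, ∞)`. -/
theorem apply_eq_of_eqOn_Ioi {T : 𝓢'(ℝ, ℂ)} {a b : ℝ} (hT : Distribution.IsVanishingOn T (Iio a))
    (hb : b < a) {φ₁ φ₂ : 𝓢(ℝ, ℂ)} (h : ∀ t, b < t → φ₁ t = φ₂ t) : T φ₁ = T φ₂ := by
  rw [← sub_eq_zero, ← map_sub]
  refine hT _ ((tsupport_subset_Iic (a := b) fun t ht => ?_).trans fun t ht => ?_)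
  · simp [h t ht]
  · exact lt_of_le_of_lt ht hb

/-- Multiplying by a smooth step that rises strictly between b and a does not change the pairing,
and discards all values of the test function to the left of b. The one-sided bound makes
exponentials, which blow up at -∞, usable in estimates. -/
theorem exists_bound_Ioi {T : 𝓢'(ℝ, ℂ)} {a b : ℝ} (hT : Distribution.IsVanishingOn T (Iio a))
    (hb : b < a) : ∃ (N : ℕ) (C : ℝ), 0 ≤ C ∧ ∀ (φ : 𝓢(ℝ, ℂ)) (M : ℝ), 
    (∀ m ≤ N, ∀ t : ℝ, b < t → (1 + |t|) ^ N * ‖iteratedDeriv m φ t‖ ≤ M) → ‖T φ‖ ≤ C * M := by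
  obtain ⟨N, C, hC0, hC⟩ := exists_bound T
  have hab : (b + a) / 2 < (b + 3 * a) / 4 := by linarith
  obtain ⟨K, hK0, hK⟩ := exists_bound_iteratedDeriv_step hab N
  refine ⟨N, C * (2 ^ N * K), by positivity, fun φ M h => ?_⟩
  have hM : 0 ≤ M := le_trans (by positivity) (h 0 (Nat.zero_le _) (b + 1) (by linarith))
  have h1 : T φ = T (SchwartzMap.smulLeftCLM ℂ (step ((b + a) / 2) ((b + 3 * a) / 4)) φ) := by
    refine apply_eq_of_eqOn_Ioi hT (b := (b + 3 * a) / 4) (by linarith) fun t ht => ?_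
    rw [step_smul_apply hab, step_of_ge hab ht.le, one_mul]
  rw [h1, mul_assoc]
  refine hC _ _ fun m hm t => ?_
  rw [coe_step_smul hab]
  rcases le_or_gt t b with ht | ht
  · have : (fun t => step ((b + a) / 2) ((b + 3 * a) / 4) t * φ t) =ᶠ[𝓝 t] fun _ => 0 := by
      filter_upwards [Iio_mem_nhds (show t < (b + a) / 2 by linarith)] with x hx
      rw [step_of_le hab (le_of_lt hx), zero_mul]
    rw [this.iteratedDeriv_eq]
    simp only [iteratedDeriv_const, ite_self, norm_zero, mul_zero]
    positivity
  · have hw : 0 < (1 + |t|) ^ N := by positivity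
    have := norm_iteratedDeriv_mul_le (contDiff_step ((b + a) / 2) ((b + 3 * a) / 4))
      (contDiff_of_schwartz φ) (m := m) (t := t) (K := K) (B := M / (1 + |t|) ^ N)
      (fun i hi => hK i (hi.trans hm) t) (fun i hi => by
        rw [le_div_iff₀' hw]; exact h i (hi.trans hm) t ht)
    calc _ ≤ (1 + |t|) ^ N * (2 ^ m * (K * (M / (1 + |t|) ^ N))) := by gcongr
      _ = 2 ^ m * K * M := by field_simp
      _ ≤ 2 ^ N * K * M := by
        gcongr
        · norm_num

/-! ### Translations -/

/-- The translate `t ↦ φ(t + x)`. -/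
abbrev shift (x : ℝ) (φ : 𝓢(ℝ, ℂ)) : 𝓢(ℝ, ℂ) := SchwartzMap.compSubConstCLM ℂ (-x) φ

theorem shift_apply (x : ℝ) (φ : 𝓢(ℝ, ℂ)) (t : ℝ) : shift x φ t = φ (t + x) := by
  simp [shift]

theorem coe_shift (x : ℝ) (φ : 𝓢(ℝ, ℂ)) : (shift x φ : ℝ → ℂ) = fun t => φ (t + x) :=
  funext (shift_apply x φ)

theorem iteratedDeriv_shift (x : ℝ) (φ : 𝓢(ℝ, ℂ)) (m : ℕ) (t : ℝ) :
    iteratedDeriv m (shift x φ) t = iteratedDeriv m φ (t + x) := by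
  rw [coe_shift, iteratedDeriv_comp_add_const]

/-- The derivative of a Schwartz function. -/
abbrev der (φ : 𝓢(ℝ, ℂ)) : 𝓢(ℝ, ℂ) := SchwartzMap.derivCLM ℂ ℂ φ

theorem coe_der (φ : 𝓢(ℝ, ℂ)) : (der φ : ℝ → ℂ) = deriv φ := rfl

theorem iteratedDeriv_der (φ : 𝓢(ℝ, ℂ)) (m : ℕ) :
    iteratedDeriv m (der φ) = iteratedDeriv (m + 1) φ := by
  rw [coe_der, iteratedDeriv_succ']

theorem hasDerivAt_iteratedDeriv (φ : 𝓢(ℝ, ℂ)) (m : ℕ) (t : ℝ) :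
    HasDerivAt (iteratedDeriv m φ) (iteratedDeriv (m + 1) φ t) t := by
  rw [iteratedDeriv_succ]
  exact (((contDiff_of_schwartz φ).differentiable_iteratedDeriv m
    (by exact_mod_cast WithTop.coe_lt_top _)) t).hasDerivAt

theorem exists_decay (φ : 𝓢(ℝ, ℂ)) (N : ℕ) (m : ℕ) :
    ∃ D : ℝ, 0 ≤ D ∧ ∀ t : ℝ, (1 + |t|) ^ N * ‖iteratedDeriv m φ t‖ ≤ D := by
  refine ⟨2 ^ N * (Finset.Iic (N, m)).sup (fun p => SchwartzMap.seminorm ℂ p.1 p.2) φ,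
    by positivity, fun t => ?_⟩
  have := SchwartzMap.one_add_le_sup_seminorm_apply (𝕜 := ℂ) (m := (N, m)) le_rfl le_rfl φ t
  rwa [norm_iteratedFDeriv_eq_norm_iteratedDeriv] at this

theorem one_add_abs_le (s t : ℝ) : 1 + |s| ≤ (1 + |s - t|) * (1 + |t|) := by
  have h1 : |s| ≤ |s - t| + |t| := by simpa using abs_add_le (s - t) t
  nlinarith [abs_nonneg (s - t), abs_nonneg t]

/-- The mean value inequality, applied first to the derivative and then to the function minus its
linear part. The constant 1 in place of 1/2 is enough. -/
theorem norm_taylor_le (φ : 𝓢(ℝ, ℂ)) (m : ℕ) {y h B : ℝ}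
    (hB : ∀ θ, |θ| ≤ |h| → ‖iteratedDeriv (m + 2) φ (y + θ)‖ ≤ B) :
    ‖iteratedDeriv m φ (y + h) - iteratedDeriv m φ y - h * iteratedDeriv (m + 1) φ y‖
      ≤ B * |h| ^ 2 := by
  have hd (k : ℕ) (θ : ℝ) : HasDerivAt (fun θ : ℝ => iteratedDeriv k φ (y + θ))
      (iteratedDeriv (k + 1) φ (y + θ)) θ :=
    (hasDerivAt_iteratedDeriv φ k (y + θ)).comp_const_add y θ
  have hconv : Convex ℝ (Metric.closedBall (0 : ℝ) |h|) := convex_closedBall _ _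
  have h0 : (0 : ℝ) ∈ Metric.closedBall (0 : ℝ) |h| := by simp
  have hh : h ∈ Metric.closedBall (0 : ℝ) |h| := by simp
  have h1 : ∀ θ ∈ Metric.closedBall (0 : ℝ) |h|,
      ‖iteratedDeriv (m + 1) φ (y + θ) - iteratedDeriv (m + 1) φ y‖ ≤ B * |h| := by
    intro θ hθ
    have hθ' : |θ| ≤ |h| := by simpa using hθ
    have := hconv.norm_image_sub_le_of_norm_hasDerivWithin_le
      (f := fun θ : ℝ => iteratedDeriv (m + 1) φ (y + θ)) (C := B)
      (fun θ _ => (hd (m + 1) θ).hasDerivWithinAt) (fun θ hθ => hB θ (by simpa using hθ)) h0 hθ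
    simp only [add_zero, sub_zero, Real.norm_eq_abs] at this
    have hB0 : 0 ≤ B := (norm_nonneg _).trans (hB 0 (by simp))
    exact this.trans (by gcongr)
  have h2 (θ : ℝ) : HasDerivAt
      (fun θ : ℝ => iteratedDeriv m φ (y + θ) - θ * iteratedDeriv (m + 1) φ y)
      (iteratedDeriv (m + 1) φ (y + θ) - iteratedDeriv (m + 1) φ y) θ := by
    have := (hd m θ).sub ((Complex.ofRealCLM.hasDerivAt (x := θ)).mul_const
      (iteratedDeriv (m + 1) φ y))
    simp only [Complex.ofRealCLM_apply, Complex.ofReal_one, one_mul] at this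
    exact this
  have := hconv.norm_image_sub_le_of_norm_hasDerivWithin_le
    (fun θ _ => (h2 θ).hasDerivWithinAt) h1 h0 hh
  simp only [add_zero, sub_zero, Real.norm_eq_abs, Complex.ofReal_zero, zero_mul] at this
  calc _ = ‖iteratedDeriv m φ (y + h) - h * iteratedDeriv (m + 1) φ y - iteratedDeriv m φ y‖ := by
        congr 1; ring
    _ ≤ _ := this
    _ = _ := by ring

/-- The Taylor remainder of a translate is O(h²) in each of the finitely many seminorms that control
T, so differentiation passes through T. -/
theorem hasDerivAt_apply_shift (T : 𝓢'(ℝ, ℂ)) (φ : 𝓢(ℝ, ℂ)) (x : ℝ) :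
    HasDerivAt (fun x => T (shift x φ)) (T (shift x (der φ))) x := by
  obtain ⟨N, C, hC0, hC⟩ := exists_bound T
  choose D hD0 hD using fun m => exists_decay φ N (m + 2)
  have hDle (m : ℕ) (hm : m ≤ N) : D m ≤ ∑ i ∈ Finset.range (N + 1), D i :=
    Finset.single_le_sum (f := D) (fun i _ => hD0 i) (Finset.mem_range.2 (by omega))
  have hS : 0 ≤ ∑ i ∈ Finset.range (N + 1), D i := Finset.sum_nonneg fun i _ => hD0 i
  rw [hasDerivAt_iff_isLittleO_nhds_zero]
  have hO : (fun h : ℝ => T (shift (x + h) φ) - T (shift x φ) - h • T (shift x (der φ)))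
      =O[𝓝 0] fun h : ℝ => |h| ^ 2 := by
    refine Asymptotics.IsBigO.of_bound
      (C * ((2 + |x|) ^ N * ∑ i ∈ Finset.range (N + 1), D i)) ?_
    filter_upwards [Metric.ball_mem_nhds (0 : ℝ) one_pos] with h hh
    have hh1 : |h| < 1 := by simpa using hh
    have h1 : T (shift (x + h) φ) - T (shift x φ) - h • T (shift x (der φ))
        = T (shift (x + h) φ - shift x φ - (h : ℂ) • shift x (der φ)) := by
      rw [map_sub, map_sub, map_smul, Complex.real_smul, smul_eq_mul]
    rw [h1, mul_assoc, norm_pow, Real.norm_eq_abs, abs_abs]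
    refine hC _ _ fun m hm t => ?_
    have h2 : iteratedDeriv m (shift (x + h) φ - shift x φ - (h : ℂ) • shift x (der φ) : 𝓢(ℝ, ℂ)) t
        = iteratedDeriv m φ ((t + x) + h) - iteratedDeriv m φ (t + x)
          - h * iteratedDeriv (m + 1) φ (t + x) := by
      have hc (ψ : 𝓢(ℝ, ℂ)) : ContDiffAt ℝ m ψ t :=
        ((contDiff_of_schwartz ψ).of_le (by exact_mod_cast le_top)).contDiffAt
      have e1 : ((shift (x + h) φ - shift x φ - (h : ℂ) • shift x (der φ) : 𝓢(ℝ, ℂ)) : ℝ → ℂ)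
        = (shift (x + h) φ : ℝ → ℂ) - (shift x φ : ℝ → ℂ)
          - (((h : ℂ) • shift x (der φ) : 𝓢(ℝ, ℂ)) : ℝ → ℂ) := by ext; simp
      have e2 : (((h : ℂ) • shift x (der φ) : 𝓢(ℝ, ℂ)) : ℝ → ℂ)
        = fun t => (h : ℂ) * shift x (der φ) t := by ext; simp
      have hs : ContDiffAt ℝ m ((shift (x + h) φ : ℝ → ℂ) - (shift x φ : ℝ → ℂ)) t :=
        (hc _).sub (hc _)
      rw [e1, iteratedDeriv_sub hs (hc _), iteratedDeriv_sub (hc _) (hc _), e2,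
        iteratedDeriv_const_mul_field, iteratedDeriv_shift, iteratedDeriv_shift,
        iteratedDeriv_shift, iteratedDeriv_der, add_assoc]
    rw [h2]
    have hw : 0 < (1 + |t|) ^ N := by positivity
    have hB : ∀ θ, |θ| ≤ |h| → ‖iteratedDeriv (m + 2) φ (t + x + θ)‖
        ≤ (2 + |x|) ^ N * (∑ i ∈ Finset.range (N + 1), D i) / (1 + |t|) ^ N := by
      intro θ hθ
      rw [le_div_iff₀' hw]
      -- Peetre's inequality: the weight at t is controlled by the weight at the translated point,
      -- uniformly for |h| < 1.
      have e : 1 + |t| ≤ (2 + |x|) * (1 + |t + x + θ|) := by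
        have := one_add_abs_le t (t + x + θ)
        have e3 : |t - (t + x + θ)| ≤ |x| + 1 := by
          rw [show t - (t + x + θ) = -(x + θ) by ring, abs_neg]
          exact (abs_add_le _ _).trans (by linarith)
        refine this.trans (mul_le_mul_of_nonneg_right (by linarith) (by positivity))
      calc (1 + |t|) ^ N * ‖iteratedDeriv (m + 2) φ (t + x + θ)‖
          ≤ ((2 + |x|) * (1 + |t + x + θ|)) ^ N * ‖iteratedDeriv (m + 2) φ (t + x + θ)‖ := by
            gcongr
        _ = (2 + |x|) ^ N * ((1 + |t + x + θ|) ^ N * ‖iteratedDeriv (m + 2) φ (t + x + θ)‖) := by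
            rw [mul_pow]; ring
        _ ≤ _ := by
            gcongr
            exact (hD m _).trans (hDle m hm)
    calc _ ≤ (1 + |t|) ^ N * ((2 + |x|) ^ N * (∑ i ∈ Finset.range (N + 1), D i) / (1 + |t|) ^ N
          * |h| ^ 2) := by
          gcongr
          exact norm_taylor_le φ m hB
      _ = _ := by field_simp
  refine hO.trans_isLittleO ?_
  simp only [sq_abs]
  exact Asymptotics.isLittleO_pow_id one_lt_two

theorem iteratedDeriv_apply_shift (T : 𝓢'(ℝ, ℂ)) (φ : 𝓢(ℝ, ℂ)) (m : ℕ) :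
    iteratedDeriv m (fun x => T (shift x φ)) = fun x => T (shift x (der^[m] φ)) := by
  induction m generalizing φ with
  | zero => simp
  | succ m ih =>
    rw [iteratedDeriv_succ', Function.iterate_succ_apply, ← ih (der φ)]
    congr 1
    exact funext fun x => (hasDerivAt_apply_shift T φ x).deriv

theorem contDiff_apply_shift (T : 𝓢'(ℝ, ℂ)) (φ : 𝓢(ℝ, ℂ)) :
    ContDiff ℝ ∞ (fun x => T (shift x φ)) := by
  refine contDiff_of_differentiable_iteratedDeriv fun m _ => ?_
  rw [iteratedDeriv_apply_shift]
  exact fun x => (hasDerivAt_apply_shift T _ x).differentiableAt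

theorem iteratedDeriv_iterate_der (φ : 𝓢(ℝ, ℂ)) (i m : ℕ) :
    iteratedDeriv m (der^[i] φ) = iteratedDeriv (m + i) φ := by
  induction i generalizing m with
  | zero => rfl
  | succ i ih => rw [Function.iterate_succ_apply', iteratedDeriv_der, ih]; congr 1; omega

/-! ### Convolution of causal distributions -/

/-- Causality restricts the argument t of the test function to t > -1. Together with x ≥ -2 this
makes |t + x| large as soon as |t| or |x| is, so decay of φ at t + x pays for the weight in x as
well as for the one in t. The bound by a seminorm of φ gives continuity of `convMap`. -/
theorem IsCausal.exists_bound_apply_shift {T : 𝓢'(ℝ, ℂ)} (hT : IsCausal T) (j i : ℕ) :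
    ∃ (K L : ℕ) (C : ℝ), 0 ≤ C ∧ ∀ (φ : 𝓢(ℝ, ℂ)) (x : ℝ), -2 ≤ x →
      (1 + |x|) ^ j * ‖T (shift x (der^[i] φ))‖
        ≤ C * (Finset.Iic (K, L)).sup (schwartzSeminormFamily ℂ ℝ ℂ) φ := by
  obtain ⟨N, C, hC0, hC⟩ := exists_bound_Ioi hT (show (-1 : ℝ) < 0 by norm_num)
  refine ⟨j + N, N + i, C * (3 ^ (j + N) * 2 ^ (j + N)), by positivity, fun φ x hx => ?_⟩
  set S := (Finset.Iic (j + N, N + i)).sup (schwartzSeminormFamily ℂ ℝ ℂ) φ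
  have hS : 0 ≤ S := apply_nonneg _ _
  have hw : 0 < (1 + |x|) ^ j := by positivity
  have key : ‖T (shift x (der^[i] φ))‖ ≤ C * (3 ^ (j + N) * (2 ^ (j + N) * S) / (1 + |x|) ^ j) := by
    refine hC _ _ fun m hm t ht => ?_
    rw [iteratedDeriv_shift, iteratedDeriv_iterate_der, le_div_iff₀ hw]
    have h1 : 1 + |x| ≤ 3 * (1 + |t + x|) ∧ 1 + |t| ≤ 3 * (1 + |t + x|) := by
      constructor <;>
      rcases abs_cases x with ⟨h1, _⟩ | ⟨h1, _⟩ <;> rcases abs_cases t with ⟨h2, _⟩ | ⟨h2, _⟩ <;>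
      rcases abs_cases (t + x) with ⟨h3, _⟩ | ⟨h3, _⟩ <;> rw [h3] <;>
      first | rw [h1] ; linarith | rw [h2] ; linarith
    have h2 := SchwartzMap.one_add_le_sup_seminorm_apply (𝕜 := ℂ) (m := (j + N, N + i))
      (k := j + N) (n := m + i) le_rfl (by dsimp only; omega) φ (t + x)
    rw [norm_iteratedFDeriv_eq_norm_iteratedDeriv, Real.norm_eq_abs] at h2
    calc (1 + |t|) ^ N * ‖iteratedDeriv (m + i) φ (t + x)‖ * (1 + |x|) ^ j
        ≤ (3 * (1 + |t + x|)) ^ N * ‖iteratedDeriv (m + i) φ (t + x)‖ * (3 * (1 + |t + x|)) ^ j := by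
          gcongr
          · exact h1.2
          · exact h1.1
      _ = 3 ^ (j + N) * ((1 + |t + x|) ^ (j + N) * ‖iteratedDeriv (m + i) φ (t + x)‖) := by
          simp only [mul_pow, pow_add]; ring
      _ ≤ _ := mul_le_mul_of_nonneg_left h2 (by positivity)
  calc _ ≤ (1 + |x|) ^ j * (C * (3 ^ (j + N) * (2 ^ (j + N) * S) / (1 + |x|) ^ j)) := by gcongr
    _ = _ := by field_simp

/-- The continuous operator `φ ↦ χ(x) ⟨T_y, φ(x + y)⟩` on Schwartz functions, for causal `T`. -/
def convMap (T : 𝓢'(ℝ, ℂ)) (hT : IsCausal T) : 𝓢(ℝ, ℂ) →L[ℂ] 𝓢(ℝ, ℂ) :=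
  SchwartzMap.mkCLM (fun φ x => step (-2) (-1) x * T (shift x φ))
    (fun φ ψ x => by simp [mul_add])
    (fun c φ x => by simp; ring)
    (fun φ => (contDiff_step _ _).mul (contDiff_apply_shift T φ)) (by
      have h21 : (-2 : ℝ) < -1 := by norm_num
      rintro ⟨j, m⟩
      choose K L C hC0 hC using fun i => hT.exists_bound_apply_shift j i
      obtain ⟨B, hB0, hB⟩ := exists_bound_iteratedDeriv_step h21 m
      have hCs : 0 ≤ ∑ i ∈ Finset.range (m + 1), C i := Finset.sum_nonneg fun i _ => hC0 i
      refine ⟨(Finset.range (m + 1)).biUnion fun i => Finset.Iic (K i, L i),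
        2 ^ m * (B * ∑ i ∈ Finset.range (m + 1), C i), by positivity, fun φ x => ?_⟩
      dsimp only
      set S := ((Finset.range (m + 1)).biUnion fun i => Finset.Iic (K i, L i)).sup
        (schwartzSeminormFamily ℂ ℝ ℂ) φ
      have hS : 0 ≤ S := apply_nonneg _ _
      rw [norm_iteratedFDeriv_eq_norm_iteratedDeriv, Real.norm_eq_abs]
      rcases lt_or_ge x (-2) with hx | hx
      · have : (fun x => step (-2) (-1) x * T (shift x φ)) =ᶠ[𝓝 x] fun _ => 0 := by
          filter_upwards [Iio_mem_nhds hx] with y hy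
          rw [step_of_le h21 (le_of_lt hy), zero_mul]
        rw [this.iteratedDeriv_eq]
        simp only [iteratedDeriv_const, ite_self, norm_zero, mul_zero]
        positivity
      · have hw : 0 < (1 + |x|) ^ j := by positivity
        have := norm_iteratedDeriv_mul_le (contDiff_step (-2) (-1)) (contDiff_apply_shift T φ)
          (m := m) (t := x) (K := B)
          (B := (∑ i ∈ Finset.range (m + 1), C i) * S / (1 + |x|) ^ j)
          (fun i hi => hB i hi x) (fun i hi => by
            rw [iteratedDeriv_apply_shift, le_div_iff₀' hw]
            refine (hC i φ x hx).trans ?_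
            have him : i ∈ Finset.range (m + 1) := Finset.mem_range.2 (by omega)
            have h1 : (Finset.Iic (K i, L i)).sup (schwartzSeminormFamily ℂ ℝ ℂ) φ ≤ S :=
              Finset.sup_mono (f := schwartzSeminormFamily ℂ ℝ ℂ)
                (Finset.subset_biUnion_of_mem (fun i => Finset.Iic (K i, L i)) him) φ
            have h2 : C i ≤ ∑ i ∈ Finset.range (m + 1), C i :=
              Finset.single_le_sum (f := C) (fun i _ => hC0 i) him
            gcongr)
        calc _ ≤ (1 + |x|) ^ j * (2 ^ m *
              (B * ((∑ i ∈ Finset.range (m + 1), C i) * S / (1 + |x|) ^ j))) := by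
              gcongr
              linarith
          _ = _ := by field_simp)

theorem convMap_apply (T : 𝓢'(ℝ, ℂ)) (hT : IsCausal T) (φ : 𝓢(ℝ, ℂ)) (x : ℝ) :
    convMap T hT φ x = step (-2) (-1) x * T (shift x φ) := rfl

theorem convMap_apply_of_gt (T : 𝓢'(ℝ, ℂ)) (hT : IsCausal T) (φ : 𝓢(ℝ, ℂ)) {x : ℝ} (hx : -1 < x) :
    convMap T hT φ x = T (shift x φ) := by
  rw [convMap_apply, step_of_ge (by norm_num) hx.le, one_mul]

/-- The convolution of a tempered distribution and a causal one. -/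
def conv (S T : 𝓢'(ℝ, ℂ)) (hT : IsCausal T) : 𝓢'(ℝ, ℂ) :=
  PointwiseConvergenceCLM.precomp ℂ (convMap T hT) S

theorem conv_apply (S T : 𝓢'(ℝ, ℂ)) (hT : IsCausal T) (φ : 𝓢(ℝ, ℂ)) :
    conv S T hT φ = S (convMap T hT φ) := rfl

/-- Any admissible g agrees with `convMap T hT φ` on a neighbourhood of [0, ∞), so a causal S cannot
distinguish them; the existential in the definition becomes an equality of distributions. -/
theorem isConvolution_iff {S T : 𝓢'(ℝ, ℂ)} (hS : IsCausal S) (hT : IsCausal T)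
    {R : 𝓢(ℝ, ℂ) → ℂ} : IsConvolution S T R ↔ ∀ φ, R φ = conv S T hT φ := by
  constructor
  · intro h φ
    obtain ⟨g, ⟨ε, hε, hg⟩, hR⟩ := h φ
    rw [hR, conv_apply]
    refine apply_eq_of_eqOn_Ioi hS (b := max (-ε) (-1)) (by simp [hε]) fun t ht => ?_
    rw [hg t ((le_max_left _ _).trans_lt ht), convMap_apply_of_gt _ _ _ ((le_max_right _ _).trans_lt ht)]
  · intro h φ
    exact ⟨convMap T hT φ, ⟨1, one_pos, fun x hx => convMap_apply_of_gt _ _ _ hx⟩, h φ⟩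

theorem exists_eq_zero_of_tsupport_subset {f : ℝ → ℂ} (h : tsupport f ⊆ Iio 0) :
    ∃ ε > 0, ∀ t, -ε < t → f t = 0 := by
  have h0 : (0 : ℝ) ∈ (tsupport f)ᶜ := fun h' => lt_irrefl (0 : ℝ) (mem_Iio.1 (h h'))
  obtain ⟨ε, hε, hb⟩ := Metric.isOpen_iff.1 (isClosed_tsupport f).isOpen_compl 0 h0
  refine ⟨ε, hε, fun t ht => ?_⟩
  by_contra h'
  have h1 : t ∈ tsupport f := subset_tsupport f h'
  have h2 : t < 0 := h h1
  exact hb (by simp [abs_of_neg h2]; linarith) h1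

theorem IsCausal.conv {S T : 𝓢'(ℝ, ℂ)} (hS : IsCausal S) (hT : IsCausal T) :
    IsCausal (conv S T hT) := by
  intro φ hφ
  obtain ⟨ε, hε, h⟩ := exists_eq_zero_of_tsupport_subset hφ
  rw [conv_apply, ← map_zero S]
  refine apply_eq_of_eqOn_Ioi hS (b := -(ε / 2)) (by linarith) fun x hx => ?_
  rw [convMap_apply]
  have : T (shift x φ) = T 0 := by
    refine apply_eq_of_eqOn_Ioi hT (b := -(ε / 2)) (by linarith) fun y hy => ?_
    rw [shift_apply]
    simp [h (y + x) (by linarith)]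
  rw [this]
  simp

/-! ### Laplace transforms of convolutions and derivatives. -/

theorem cutExpSchwartz_apply (s : ℂ) (hs : 0 < s.re) (t : ℝ) :
    cutExpSchwartz s hs t = cutExp s t := rfl

/-- The Laplace transform of a causal distribution does not depend on the cut-off. -/
theorem apply_eq_laplace {T : 𝓢'(ℝ, ℂ)} (hT : IsCausal T) {s : ℂ} (hs : 0 < s.re) {c : ℂ} {ε : ℝ}
    (hε : 0 < ε) {g : 𝓢(ℝ, ℂ)} (hg : ∀ t : ℝ, -ε < t → g t = c * Complex.exp (-(s * t))) :
    T g = c * laplace T s hs := by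
  rw [laplace, ← smul_eq_mul, ← map_smul]
  refine apply_eq_of_eqOn_Ioi hT (b := max (-ε) (-1)) (by simp [hε]) fun t ht => ?_
  rw [hg t ((le_max_left _ _).trans_lt ht), _root_.smul_apply, cutExpSchwartz_apply,
    cutExp_of_ge s ((le_max_right _ _).trans ht.le), smul_eq_mul]

/-- The exponential is a character: near the half-line the inner pairing with e^{-s(x+y)} is e^{-sx}
times the Laplace transform of T. -/
theorem laplace_conv {S T : 𝓢'(ℝ, ℂ)} (hS : IsCausal S) (hT : IsCausal T) {s : ℂ} (hs : 0 < s.re) :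
    laplace (conv S T hT) s hs = laplace S s hs * laplace T s hs := by
  rw [laplace, conv_apply, mul_comm]
  -- With x and y both above -1/2, the sum stays above -1, where the cut-off equals 1.
  refine apply_eq_laplace hS hs one_half_pos fun x hx => ?_
  rw [convMap_apply_of_gt _ _ _ (by linarith), mul_comm (laplace T s hs)]
  refine apply_eq_laplace hT hs one_half_pos fun y hy => ?_
  rw [shift_apply, cutExpSchwartz_apply, cutExp_of_ge s (by linarith), ← Complex.exp_add]
  congr 1
  push_cast
  ring

theorem IsCausal.deriv {T : 𝓢'(ℝ, ℂ)} (hT : IsCausal T) :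
    IsCausal (TemperedDistribution.derivCLM ℂ T) := by
  intro φ hφ
  rw [TemperedDistribution.derivCLM_apply_apply, map_neg, hT, neg_zero]
  exact (SchwartzMap.tsupport_derivCLM_subset ℂ φ).trans hφ

theorem laplace_deriv {T : 𝓢'(ℝ, ℂ)} (hT : IsCausal T) {s : ℂ} (hs : 0 < s.re) :
    laplace (TemperedDistribution.derivCLM ℂ T) s hs = s * laplace T s hs := by
  rw [laplace, TemperedDistribution.derivCLM_apply_apply]
  refine apply_eq_laplace hT hs one_pos fun t ht => ?_
  have h1 : (cutExpSchwartz s hs : ℝ → ℂ) =ᶠ[𝓝 t] fun t : ℝ => Complex.exp (-(s * t)) := by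
    filter_upwards [Ioi_mem_nhds ht] with x hx using cutExp_of_ge s (le_of_lt hx)
  rw [_root_.neg_apply, SchwartzMap.derivCLM_apply, h1.deriv_eq]
  have := congrFun (iteratedDeriv_exp_neg_mul s 1) t
  rw [iteratedDeriv_one] at this
  rw [this]
  ring

/-! ### Injectivity of the Laplace transform -/

theorem exists_derivative_eq (Q : Polynomial ℂ) : ∃ P : Polynomial ℂ, P.derivative = Q := by
  induction Q using Polynomial.induction_on' with
  | add p q hp hq =>
    obtain ⟨P, rfl⟩ := hp
    obtain ⟨R, rfl⟩ := hq
    exact ⟨P + R, by simp⟩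
  | monomial k a =>
    refine ⟨Polynomial.monomial (k + 1) (a / (k + 1)), ?_⟩
    rw [Polynomial.derivative_monomial]
    congr 1
    push_cast
    field_simp

theorem hasDerivAt_eval_ofReal (Q : Polynomial ℂ) (u : ℝ) :
    HasDerivAt (fun u : ℝ => Q.eval (u : ℂ)) (Q.derivative.eval (u : ℂ)) u :=
  (Q.hasDerivAt (u : ℂ)).comp_ofReal

theorem contDiff_eval_ofReal (Q : Polynomial ℂ) : ContDiff ℝ ∞ fun u : ℝ => Q.eval (u : ℂ) := by
  have h : ContDiff ℂ ∞ fun z : ℂ => Q.eval z := by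
    simpa using Q.contDiff_aeval (𝕜 := ℂ) ∞
  exact (h.restrict_scalars ℝ).comp Complex.ofRealCLM.contDiff

/-- Simultaneous polynomial approximation of a smooth function and its derivatives. -/
theorem exists_polynomial_near (N : ℕ) {b : ℝ} (hb : 0 ≤ b) {G : ℝ → ℂ} (hG : ContDiff ℝ ∞ G)
    {ε : ℝ} (hε : 0 < ε) : ∃ Q : Polynomial ℂ, ∀ i ≤ N, ∀ u ∈ Icc 0 b,
      ‖iteratedDeriv i (fun u : ℝ => G u - Q.eval (u : ℂ)) u‖ ≤ ε := by
  induction N generalizing G ε with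
  | zero =>
    obtain ⟨p, hp⟩ := exists_polynomial_near_of_continuousOn 0 b (fun u => (G u).re)
      (Complex.continuous_re.comp hG.continuous).continuousOn (ε / 2) (by positivity)
    obtain ⟨q, hq⟩ := exists_polynomial_near_of_continuousOn 0 b (fun u => (G u).im)
      (Complex.continuous_im.comp hG.continuous).continuousOn (ε / 2) (by positivity)
    refine ⟨p.map Complex.ofRealHom + Polynomial.C Complex.I * q.map Complex.ofRealHom,
      fun i hi u hu => ?_⟩
    obtain rfl : i = 0 := by omega
    have e (r : Polynomial ℝ) : (r.map Complex.ofRealHom).eval (u : ℂ) = (r.eval u : ℝ) := by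
      have := Polynomial.eval_map_apply (p := r) Complex.ofRealHom u
      simpa using this
    rw [iteratedDeriv_zero]
    simp only [Polynomial.eval_add, Polynomial.eval_mul, Polynomial.eval_C, e]
    refine (Complex.norm_le_abs_re_add_abs_im _).trans ?_
    have h1 := hp u hu
    have h2 := hq u hu
    rw [abs_sub_comm] at h1 h2
    simp
    linarith
  | succ N ih =>
    have hG' : ContDiff ℝ ∞ (deriv G) := (contDiff_infty_iff_deriv.1 hG).2
    obtain ⟨Q, hQ⟩ := ih hG' (ε := ε / (b + 1)) (by positivity)
    obtain ⟨P, hP⟩ := exists_derivative_eq Q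
    -- The constant of integration is chosen so that the error vanishes at 0; the mean value
    -- inequality then bounds the error by b times that of the derivative, which is why ε was
    -- divided by b + 1.
    set P' := P + Polynomial.C (G 0 - P.eval 0)
    have hP' : P'.derivative = Q := by simp [P', hP]
    have hd (u : ℝ) : HasDerivAt (fun u : ℝ => G u - P'.eval (u : ℂ))
        (deriv G u - Q.eval (u : ℂ)) u := by
      have h1 := hasDerivAt_eval_ofReal P' u
      rw [hP'] at h1
      exact ((hG.differentiable (by simp)) u).hasDerivAt.sub h1
    refine ⟨P', fun i hi u hu => ?_⟩
    rcases i with _ | i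
    · have h0 : G 0 - P'.eval ((0 : ℝ) : ℂ) = 0 := by simp [P']
      have h1 := (convex_Icc (0 : ℝ) b).norm_image_sub_le_of_norm_hasDerivWithin_le
        (fun u _ => (hd u).hasDerivWithinAt)
        (fun u hu => by simpa using hQ 0 (Nat.zero_le _) u hu) (left_mem_Icc.2 hb) hu
      rw [h0, sub_zero, sub_zero, Real.norm_of_nonneg hu.1] at h1
      rw [iteratedDeriv_zero]
      refine h1.trans ?_
      rw [div_mul_eq_mul_div, div_le_iff₀ (by positivity)]
      nlinarith [hu.2]
    · rw [iteratedDeriv_succ']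
      have : deriv (fun u : ℝ => G u - P'.eval (u : ℂ)) = fun u : ℝ => deriv G u - Q.eval (u : ℂ) :=
        funext fun u => (hd u).deriv
      rw [this]
      refine (hQ i (by omega) u hu).trans ?_
      exact div_le_self hε.le (by linarith)

/-- Closeness of derivatives survives the substitution u = e^{-t}: differentiating e^{-(k+1)t}
H(e^{-t}) gives terms of the same shape with k or k + 1, so the induction runs over all k. One
factor e^{-t} always remains and will beat the polynomial weights. -/
theorem exists_bound_iteratedDeriv_comp_exp (m k : ℕ) : ∃ C : ℝ, 0 ≤ C ∧
    ∀ (H : ℝ → ℂ) (ε : ℝ), ContDiff ℝ ∞ H →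
      (∀ i ≤ m, ∀ u ∈ Icc 0 (Real.exp 1), ‖iteratedDeriv i H u‖ ≤ ε) → ∀ t : ℝ, -1 ≤ t →
      ‖iteratedDeriv m (fun t : ℝ => (Real.exp (-t) : ℂ) ^ (k + 1) * H (Real.exp (-t))) t‖
        ≤ C * ε * Real.exp (-t) := by
  induction m generalizing k with
  | zero =>
    refine ⟨Real.exp 1 ^ k, by positivity, fun H ε _ hH t ht => ?_⟩
    have hle : Real.exp (-t) ≤ Real.exp 1 := Real.exp_le_exp.2 (by linarith)
    have h1 := hH 0 le_rfl (Real.exp (-t)) ⟨(Real.exp_pos _).le, hle⟩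
    rw [iteratedDeriv_zero] at h1
    rw [iteratedDeriv_zero, norm_mul, norm_pow, Complex.norm_real,
      Real.norm_of_nonneg (Real.exp_pos _).le, pow_succ]
    calc Real.exp (-t) ^ k * Real.exp (-t) * ‖H (Real.exp (-t))‖
        ≤ Real.exp 1 ^ k * Real.exp (-t) * ε := by gcongr
      _ = _ := by ring
  | succ m ih =>
    obtain ⟨C₁, hC₁, h₁⟩ := ih k
    obtain ⟨C₂, hC₂, h₂⟩ := ih (k + 1)
    refine ⟨(k + 1) * C₁ + C₂, by positivity, fun H ε hs hH t ht => ?_⟩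
    have hs' : ContDiff ℝ ∞ (deriv H) := (contDiff_infty_iff_deriv.1 hs).2
    have hexp (t : ℝ) : HasDerivAt (fun t : ℝ => Real.exp (-t)) (-Real.exp (-t)) t := by
      simpa using (hasDerivAt_neg t).exp
    have hd : deriv (fun t : ℝ => (Real.exp (-t) : ℂ) ^ (k + 1) * H (Real.exp (-t))) =
        (fun t : ℝ => -((k : ℂ) + 1) * ((Real.exp (-t) : ℂ) ^ (k + 1) * H (Real.exp (-t)))) -
          fun t : ℝ => (Real.exp (-t) : ℂ) ^ (k + 1 + 1) * deriv H (Real.exp (-t)) := by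
      funext t
      have e1 : HasDerivAt (fun t : ℝ => (Real.exp (-t) : ℂ)) (-(Real.exp (-t)) : ℂ) t := by
        exact_mod_cast (hexp t).ofReal_comp
      have e2 : HasDerivAt (fun t : ℝ => H (Real.exp (-t)))
          ((-Real.exp (-t)) • deriv H (Real.exp (-t))) t :=
        ((hs.differentiable (by simp)) _).hasDerivAt.scomp t (hexp t)
      have e3 := (e1.pow (k + 1)).mul e2
      refine e3.deriv.trans ?_
      simp only [Pi.sub_apply, Complex.real_smul, Nat.add_sub_cancel, Complex.ofReal_neg]
      push_cast
      simp only [Pi.pow_apply]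
      ring
    have hsm (j : ℕ) {F : ℝ → ℂ} (hF : ContDiff ℝ ∞ F) :
        ContDiff ℝ ∞ fun t : ℝ => (Real.exp (-t) : ℂ) ^ j * F (Real.exp (-t)) := by
      have e : ContDiff ℝ ∞ fun t : ℝ => Real.exp (-t) := Real.contDiff_exp.comp contDiff_neg
      exact ((Complex.ofRealCLM.contDiff.comp e).pow j).mul (hF.comp e)
    have hle (F : ℝ → ℂ) (hF : ContDiff ℝ ∞ F) : ContDiffAt ℝ m F t :=
      (hF.of_le (by exact_mod_cast le_top)).contDiffAt
    rw [iteratedDeriv_succ', hd, iteratedDeriv_sub (hle _ (contDiff_const.mul (hsm _ hs)))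
      (hle _ (hsm _ hs')), iteratedDeriv_const_mul_field]
    have b1 := h₁ H ε hs (fun i hi u hu => hH i (by omega) u hu) t ht
    have b2 := h₂ (deriv H) ε hs' (fun i hi u hu => by
      rw [← iteratedDeriv_succ']; exact hH (i + 1) (by omega) u hu) t ht
    refine (norm_sub_le _ _).trans ?_
    rw [norm_mul, norm_neg]
    have : ‖(k : ℂ) + 1‖ = k + 1 := by
      rw [← Nat.cast_succ, Complex.norm_natCast]; push_cast; rfl
    rw [this]
    calc _ ≤ ((k : ℝ) + 1) * (C₁ * ε * Real.exp (-t)) + C₂ * ε * Real.exp (-t) := by gcongr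
      _ = _ := by ring

/-- This is the function G with φ(t) = e^{-t} G(e^{-t}). It is identically 0 for u < e^{-R}, so it
is smooth across u = 0 and the division by u is harmless. -/
theorem contDiff_comp_neg_log_div {φ : ℝ → ℂ} (hφ : ContDiff ℝ ∞ φ) {R : ℝ}
    (hR : ∀ t, R ≤ t → φ t = 0) :
    ContDiff ℝ ∞ fun u : ℝ => if 0 < u then φ (-Real.log u) / u else 0 := by
  rw [contDiff_iff_contDiffAt]
  intro u
  rcases lt_or_ge u (Real.exp (-R)) with hu | hu
  · have : (fun u : ℝ => if 0 < u then φ (-Real.log u) / u else 0) =ᶠ[𝓝 u] fun _ => 0 := by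
      filter_upwards [Iio_mem_nhds hu] with x hx
      split_ifs with h
      · rw [hR, zero_div]
        have := (Real.log_le_log h (le_of_lt hx))
        rw [Real.log_exp] at this
        linarith
      · rfl
    exact contDiffAt_const.congr_of_eventuallyEq this
  · have hu0 : 0 < u := (Real.exp_pos _).trans_le hu
    have : (fun u : ℝ => if 0 < u then φ (-Real.log u) / u else 0) =ᶠ[𝓝 u]
        fun u : ℝ => φ (-Real.log u) * ((u⁻¹ : ℝ) : ℂ) := by
      filter_upwards [Ioi_mem_nhds hu0] with x hx
      rw [if_pos (mem_Ioi.1 hx), div_eq_mul_inv, Complex.ofReal_inv]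
    refine ContDiffAt.congr_of_eventuallyEq ?_ this
    exact (hφ.contDiffAt.comp u (Real.contDiffAt_log.2 hu0.ne').neg).mul
      (Complex.ofRealCLM.contDiff.contDiffAt.comp u (contDiffAt_inv ℝ hu0.ne'))

theorem one_add_abs_pow_mul_exp_neg_le (N : ℕ) {t : ℝ} (ht : -1 ≤ t) :
    (1 + |t|) ^ N * Real.exp (-t) ≤ N.factorial * Real.exp 3 := by
  have h1 : 1 + |t| ≤ t + 3 := by rcases abs_cases t with ⟨h, _⟩ | ⟨h, _⟩ <;> linarith
  have h2 := Real.pow_div_factorial_le_exp (t + 3) (by linarith) N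
  rw [div_le_iff₀ (by positivity)] at h2
  calc (1 + |t|) ^ N * Real.exp (-t) ≤ (t + 3) ^ N * Real.exp (-t) := by gcongr
    _ ≤ Real.exp (t + 3) * N.factorial * Real.exp (-t) := by gcongr
    _ = N.factorial * (Real.exp (t + 3) * Real.exp (-t)) := by ring
    _ = _ := by rw [← Real.exp_add]; ring_nf

theorem natCast_succ_re_pos (k : ℕ) : 0 < ((k : ℂ) + 1).re := by
  simp; positivity

/-- The linear combination of exponentials `e^{-t} Q(e^{-t})`, cut off to the left of `-1`. -/
def expPolynomial (Q : Polynomial ℂ) : 𝓢(ℝ, ℂ) :=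
  ∑ k ∈ Q.support, Q.coeff k • cutExpSchwartz (k + 1) (natCast_succ_re_pos k)

theorem expPolynomial_apply (Q : Polynomial ℂ) {t : ℝ} (ht : -1 ≤ t) :
    expPolynomial Q t = (Real.exp (-t) : ℂ) ^ (0 + 1) * Q.eval ((Real.exp (-t) : ℝ) : ℂ) := by
  have : expPolynomial Q t = ∑ k ∈ Q.support, Q.coeff k *
      cutExpSchwartz (k + 1) (natCast_succ_re_pos k) t := by
    simp [expPolynomial]
  rw [this, Polynomial.eval_eq_sum, Polynomial.sum, Finset.mul_sum]
  refine Finset.sum_congr rfl fun k _ => ?_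
  rw [cutExpSchwartz_apply, cutExp_of_ge _ ht]
  have : Complex.exp (-((k + 1) * t)) = ((Real.exp (-t) : ℝ) : ℂ) ^ (k + 1) := by
    rw [Complex.ofReal_exp, ← Complex.exp_nat_mul]
    congr 1
    push_cast
    ring
  rw [this]
  ring

/-- The values of the transform at 1, 2, 3, ... already determine T on such test functions. T
annihilates every e^{-t} Q(e^{-t}), and φ is approximated by these in the one-sided seminorms that
control T. -/
theorem apply_eq_zero_of_laplace_natCast {T : 𝓢'(ℝ, ℂ)} (hT : IsCausal T)
    (h : ∀ k : ℕ, laplace T (k + 1) (natCast_succ_re_pos k) = 0) (φ : 𝓢(ℝ, ℂ)) {R : ℝ}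
    (hR : ∀ t, R ≤ t → φ t = 0) : T φ = 0 := by
  obtain ⟨N, C, hC0, hC⟩ := exists_bound_Ioi hT (show (-1 : ℝ) < 0 by norm_num)
  choose D hD0 hD using fun m => exists_bound_iteratedDeriv_comp_exp m 0
  set D' := ∑ m ∈ Finset.range (N + 1), D m
  have hD'0 : 0 ≤ D' := Finset.sum_nonneg fun i _ => hD0 i
  set G : ℝ → ℂ := fun u : ℝ => if 0 < u then φ (-Real.log u) / u else 0
  have hG : ContDiff ℝ ∞ G := contDiff_comp_neg_log_div (contDiff_of_schwartz φ) hR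
  have key : ∀ ε > 0, ‖T φ‖ ≤ C * (D' * ε * (N.factorial * Real.exp 3)) := by
    intro ε hε
    obtain ⟨Q, hQ⟩ := exists_polynomial_near N (Real.exp_pos 1).le hG hε
    have hTQ : T (expPolynomial Q) = 0 := by
      rw [expPolynomial, map_sum]
      refine Finset.sum_eq_zero fun k _ => ?_
      rw [map_smul]
      exact (congrArg _ (h k)).trans (smul_zero _)
    have hH : ContDiff ℝ ∞ fun u : ℝ => G u - Q.eval (u : ℂ) := hG.sub (contDiff_eval_ofReal Q)
    rw [← sub_zero (T φ), ← hTQ, ← map_sub]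
    refine hC _ _ fun m hm t ht => ?_
    have heq : ((φ - expPolynomial Q : 𝓢(ℝ, ℂ)) : ℝ → ℂ) =ᶠ[𝓝 t] fun t : ℝ =>
        (Real.exp (-t) : ℂ) ^ (0 + 1) * (fun u : ℝ => G u - Q.eval (u : ℂ)) (Real.exp (-t)) := by
      filter_upwards [Ioi_mem_nhds ht] with x hx
      rw [_root_.sub_apply, expPolynomial_apply Q (le_of_lt hx)]
      simp only [G, Real.exp_pos, if_true, Real.log_exp, neg_neg]
      have : (Real.exp (-x) : ℂ) ≠ 0 := by exact_mod_cast (Real.exp_pos _).ne'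
      field_simp
      ring
    rw [heq.iteratedDeriv_eq]
    have h1 := hD m _ ε hH (fun i hi u hu => hQ i (hi.trans hm) u hu) t ht.le
    have h2 : D m ≤ D' :=
      Finset.single_le_sum (f := D) (fun i _ => hD0 i) (Finset.mem_range.2 (by omega))
    calc _ ≤ (1 + |t|) ^ N * (D m * ε * Real.exp (-t)) := by gcongr
      _ = D m * ε * ((1 + |t|) ^ N * Real.exp (-t)) := by ring
      _ ≤ D' * ε * (N.factorial * Real.exp 3) :=
        mul_le_mul (by gcongr) (one_add_abs_pow_mul_exp_neg_le N ht.le) (by positivity)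
          (by positivity)
  have hlim : Tendsto (fun ε : ℝ => C * (D' * ε * (N.factorial * Real.exp 3))) (𝓝[>] 0) (𝓝 0) := by
    have : Tendsto (fun ε : ℝ => C * (D' * ε * (N.factorial * Real.exp 3))) (𝓝 0)
        (𝓝 (C * (D' * 0 * (N.factorial * Real.exp 3)))) := Continuous.tendsto (by fun_prop) _
    simp only [mul_zero, zero_mul] at this
    exact this.mono_left nhdsWithin_le_nhds
  have := ge_of_tendsto hlim (eventually_nhdsWithin_of_forall fun ε hε => key ε hε)
  simpa using this

theorem iteratedDeriv_step_shift (R : ℝ) (m : ℕ) (t : ℝ) :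
    iteratedDeriv m (step R (R + 1)) t = iteratedDeriv m (step 0 1) (t - R) := by
  have : step R (R + 1) = fun t => step 0 1 (t + -R) := by
    funext t
    simp [step, sub_eq_add_neg]
  rw [this, iteratedDeriv_comp_add_const, sub_eq_add_neg]

/-- The tail of a Schwartz function is negligible: one spare power of the weight gives a bound of
order 1/R, while the derivatives of the translated steps stay bounded uniformly in R. -/
theorem tendsto_apply_step_smul (T : 𝓢'(ℝ, ℂ)) (φ : 𝓢(ℝ, ℂ)) :
    Tendsto (fun R : ℝ => T (SchwartzMap.smulLeftCLM ℂ (step R (R + 1)) φ)) atTop (𝓝 0) := by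
  obtain ⟨N, C, hC0, hC⟩ := exists_bound T
  choose D hD0 hD using fun m => exists_decay φ (N + 1) m
  set D' := ∑ m ∈ Finset.range (N + 1), D m
  have hD'0 : 0 ≤ D' := Finset.sum_nonneg fun i _ => hD0 i
  obtain ⟨K, hK0, hK⟩ := exists_bound_iteratedDeriv_step (zero_lt_one (α := ℝ)) N
  have hbound : ∀ R : ℝ, 0 < R → ‖T (SchwartzMap.smulLeftCLM ℂ (step R (R + 1)) φ)‖
      ≤ C * (2 ^ N * K * D' / R) := by
    intro R hR
    have hR1 : R < R + 1 := by linarith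
    refine hC _ _ fun m hm t => ?_
    rw [coe_step_smul hR1]
    rcases lt_or_ge t R with ht | ht
    · have : (fun t => step R (R + 1) t * φ t) =ᶠ[𝓝 t] fun _ => 0 := by
        filter_upwards [Iio_mem_nhds ht] with x hx
        rw [step_of_le hR1 (le_of_lt hx), zero_mul]
      rw [this.iteratedDeriv_eq]
      simp only [iteratedDeriv_const, ite_self, norm_zero, mul_zero]
      positivity
    · have hw : 0 < (1 + |t|) ^ (N + 1) := by positivity
      have h1 := norm_iteratedDeriv_mul_le (contDiff_step R (R + 1)) (contDiff_of_schwartz φ)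
        (m := m) (t := t) (K := K) (B := D' / (1 + |t|) ^ (N + 1))
        (fun i hi => by rw [iteratedDeriv_step_shift]; exact hK i (hi.trans hm) _)
        (fun i hi => by
          rw [le_div_iff₀' hw]
          refine (hD i t).trans (Finset.single_le_sum (f := D) (fun i _ => hD0 i)
            (Finset.mem_range.2 (by omega))))
      have h2 : R ≤ 1 + |t| := by linarith [le_abs_self t]
      calc _ ≤ (1 + |t|) ^ N * (2 ^ m * (K * (D' / (1 + |t|) ^ (N + 1)))) := by gcongr
        _ = 2 ^ m * K * D' / (1 + |t|) := by field_simp; ring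
        _ ≤ 2 ^ N * K * D' / R := by
          gcongr
          · norm_num
  have hlim : Tendsto (fun R : ℝ => C * (2 ^ N * K * D' / R)) atTop (𝓝 0) := by
    simpa using (tendsto_const_nhds.div_atTop tendsto_id).const_mul C
  refine squeeze_zero_norm' ?_ hlim
  filter_upwards [eventually_gt_atTop 0] with R hR using hbound R hR

/-- The Laplace transform is injective on causal tempered distributions. -/
theorem eq_of_laplace_eq {S T : 𝓢'(ℝ, ℂ)} (hS : IsCausal S) (hT : IsCausal T)
    (h : ∀ (s : ℂ) (hs : 0 < s.re), laplace S s hs = laplace T s hs) : S = T := by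
  have hU : IsCausal (S - T) := fun φ hφ => by
    change S φ - T φ = 0
    rw [hS φ hφ, hT φ hφ, sub_zero]
  have hL : ∀ k : ℕ, laplace (S - T) (k + 1) (natCast_succ_re_pos k) = 0 := fun k => by
    change S _ - T _ = 0
    exact sub_eq_zero.2 (h _ _)
  ext φ
  rw [← sub_eq_zero]
  change (S - T) φ = 0
  -- After its tail is subtracted, φ vanishes on [R + 1, ∞) and is annihilated by S - T. Hence the
  -- value at φ equals the value at the tail, for every R.
  refine tendsto_nhds_unique (f := fun _ : ℝ => (S - T) φ) (l := atTop) tendsto_const_nhds ?_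
  refine (tendsto_apply_step_smul (S - T) φ).congr fun R => ?_
  have hR1 : R < R + 1 := by linarith
  rw [eq_comm, ← sub_eq_zero, ← map_sub]
  refine apply_eq_zero_of_laplace_natCast hU hL _ (R := R + 1) fun t ht => ?_
  rw [_root_.sub_apply, step_smul_apply hR1, step_of_ge hR1 ht, one_mul, sub_self]

/-! ### Densities as causal distributions -/

/-- The weighted integrability says that g dt is a positive measure of temperate growth, so it
defines a tempered distribution; causality is immediate since it lives on (0, ∞). -/
theorem exists_density_distribution {g : ℝ → ℝ} (hm : AEMeasurable g (volume.restrict (Ioi 0)))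
    (h0 : ∀ t, 0 < t → 0 ≤ g t) (k : ℕ)
    (hk : IntegrableOn (fun t => (1 + ‖t‖) ^ (-(k : ℝ)) * g t) (Ioi 0)) :
    ∃ T : 𝓢'(ℝ, ℂ), IsCausal T ∧ ∀ φ : 𝓢(ℝ, ℂ), T φ = ∫ t in Ioi (0 : ℝ), (g t : ℂ) * φ t := by
  have hm' : AEMeasurable (fun t => (g t).toNNReal) (volume.restrict (Ioi 0)) := hm.real_toNNReal
  have hg : ∀ᵐ t ∂volume.restrict (Ioi (0 : ℝ)), ((g t).toNNReal : ℝ) = g t := by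
    filter_upwards [ae_restrict_mem measurableSet_Ioi] with t ht
    rw [Real.coe_toNNReal _ (h0 t ht)]
  set μ := (volume.restrict (Ioi (0 : ℝ))).withDensity (fun t => ((g t).toNNReal : ENNReal))
  have hμ : μ.HasTemperateGrowth := by
    refine ⟨⟨k, (integrable_withDensity_iff_integrable_smul₀ hm').2 (hk.congr ?_)⟩⟩
    filter_upwards [hg] with t ht
    rw [NNReal.smul_def, ht, smul_eq_mul, mul_comm]
  have hT (φ : 𝓢(ℝ, ℂ)) : μ.toTemperedDistribution φ = ∫ t in Ioi (0 : ℝ), (g t : ℂ) * φ t := by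
    rw [Measure.toTemperedDistribution_apply μ, integral_withDensity_eq_integral_smul₀ hm']
    refine integral_congr_ae ?_
    filter_upwards [hg] with t ht
    rw [NNReal.smul_def, ht, Complex.real_smul]
  refine ⟨μ.toTemperedDistribution, fun φ hφ => ?_, hT⟩
  rw [hT]
  refine setIntegral_eq_zero_of_forall_eq_zero fun t ht => ?_
  rw [image_eq_zero_of_notMem_tsupport fun h => lt_asymm ht (mem_Iio.1 (hφ h)), mul_zero]

theorem integrableOn_one_add_norm_rpow_mul {g : ℝ → ℝ} (hm : AEMeasurable g (volume.restrict (Ioi 0)))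
    {C : ℝ} {j : ℕ} (hg : ∀ t, 0 < t → |g t| ≤ C * (1 + t) ^ j) :
    IntegrableOn (fun t => (1 + ‖t‖) ^ (-((j + 2 : ℕ) : ℝ)) * g t) (Ioi 0) := by
  have h1 : Integrable (fun t : ℝ => C * (1 + ‖t‖) ^ (-(2 : ℝ))) :=
    (integrable_one_add_norm (by simp)).const_mul C
  refine h1.integrableOn.mono' ?_ ?_
  · refine AEStronglyMeasurable.mul ?_ hm.aestronglyMeasurable
    exact Measurable.aestronglyMeasurable (by fun_prop)
  · filter_upwards [ae_restrict_mem measurableSet_Ioi] with t ht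
    have ht0 : 0 < t := ht
    have h2 : 0 < 1 + ‖t‖ := by positivity
    rw [norm_mul, Real.norm_of_nonneg (by positivity), Real.norm_eq_abs (g t)]
    calc _ ≤ (1 + ‖t‖) ^ (-((j + 2 : ℕ) : ℝ)) * (C * (1 + t) ^ j) := by
          gcongr; exact hg t ht0
      _ = _ := by
          rw [Real.norm_of_nonneg ht0.le, Real.rpow_neg (by positivity), Real.rpow_natCast,
            Real.rpow_neg (by positivity), Real.rpow_two]
          field_simp
          ring

theorem exists_truncatedPower_distribution (n : ℕ) :
    ∃ T : 𝓢'(ℝ, ℂ), IsCausal T ∧ ∀ φ, T φ = truncatedPower n φ := by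
  have hm : AEMeasurable (fun t : ℝ => t ^ (n - 1) / (n - 1).factorial) (volume.restrict (Ioi 0)) :=
    Measurable.aemeasurable (by fun_prop)
  refine exists_density_distribution hm (fun t ht => by positivity) _
    (integrableOn_one_add_norm_rpow_mul (C := 1) (j := n - 1) hm fun t ht => ?_)
  rw [abs_of_nonneg (by positivity), one_mul]
  have h1 : (1 : ℝ) ≤ (n - 1).factorial := by exact_mod_cast Nat.one_le_iff_ne_zero.2 (Nat.factorial_ne_zero _)
  calc t ^ (n - 1) / (n - 1).factorial ≤ t ^ (n - 1) := div_le_self (by positivity) h1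
    _ ≤ _ := by gcongr; linarith

theorem ne_zero_of_re_pos {s : ℂ} (hs : 0 < s.re) : s ≠ 0 := by
  rintro rfl
  simp at hs

theorem norm_exp_neg_mul (s : ℂ) (t : ℝ) :
    ‖Complex.exp (-(s * t))‖ = Real.exp (-(s.re * t)) := by
  rw [Complex.norm_exp]
  simp

theorem integrableOn_pow_mul_exp {s : ℂ} (hs : 0 < s.re) (m : ℕ) :
    IntegrableOn (fun t : ℝ => (t : ℂ) ^ m * Complex.exp (-(s * t))) (Ioi 0) := by
  have h := (SchwartzMap.integrable_pow_mul volume (cutExpSchwartz s hs) m).integrableOn (s := Ioi 0)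
  refine h.mono' (Continuous.aestronglyMeasurable (by fun_prop)) ?_
  filter_upwards [ae_restrict_mem measurableSet_Ioi] with t ht
  have ht0 : (0 : ℝ) < t := ht
  rw [norm_mul, norm_pow, Complex.norm_real, cutExpSchwartz_apply, cutExp_of_ge s (by linarith)]

theorem tendsto_pow_mul_exp {s : ℂ} (hs : 0 < s.re) (m : ℕ) :
    Tendsto (fun t : ℝ => (t : ℂ) ^ m * Complex.exp (-(s * t))) atTop (𝓝 0) := by
  rw [tendsto_zero_iff_norm_tendsto_zero]
  have h : Tendsto (fun t : ℝ => (s.re ^ m)⁻¹ * ((s.re * t) ^ m * Real.exp (-(s.re * t))))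
      atTop (𝓝 ((s.re ^ m)⁻¹ * 0)) :=
    ((Real.tendsto_pow_mul_exp_neg_atTop_nhds_zero m).comp
      (tendsto_id.const_mul_atTop hs)).const_mul _
  rw [mul_zero] at h
  refine h.congr' ?_
  filter_upwards [eventually_ge_atTop 0] with t ht
  rw [norm_mul, norm_pow, Complex.norm_real, norm_exp_neg_mul, Real.norm_of_nonneg ht, mul_pow]
  field_simp

theorem integral_pow_mul_exp {s : ℂ} (hs : 0 < s.re) (m : ℕ) :
    ∫ t in Ioi (0 : ℝ), (t : ℂ) ^ m * Complex.exp (-(s * t)) = m.factorial / s ^ (m + 1) := by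
  have hs0 := ne_zero_of_re_pos hs
  have hexp (t : ℝ) : HasDerivAt (fun t : ℝ => Complex.exp (-(s * t)))
      (-s * Complex.exp (-(s * t))) t := by
    have h1 : HasDerivAt (fun t : ℝ => -(s * (t : ℂ))) (-(s * 1)) t :=
      ((Complex.ofRealCLM.hasDerivAt (x := t)).const_mul s).neg
    convert h1.cexp using 1
    ring
  induction m with
  | zero =>
    have h1 := integral_Ioi_of_hasDerivAt_of_tendsto (a := 0)
      (Continuous.continuousWithinAt (by fun_prop)) (fun t _ => hexp t)
      (by simpa [IntegrableOn] using (integrableOn_pow_mul_exp hs 0).const_mul (-s))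
      (by simpa using tendsto_pow_mul_exp hs 0)
    rw [integral_const_mul] at h1
    simp only [Complex.ofReal_zero, mul_zero, neg_zero, Complex.exp_zero, zero_sub] at h1
    simp only [pow_zero, one_mul, Nat.factorial_zero, Nat.cast_one, zero_add, pow_one]
    rw [eq_div_iff hs0]
    linear_combination -h1
  | succ m ih =>
    have hd (t : ℝ) : HasDerivAt (fun t : ℝ => (t : ℂ) ^ (m + 1) * Complex.exp (-(s * t)))
        ((m + 1) * ((t : ℂ) ^ m * Complex.exp (-(s * t))) -
          s * ((t : ℂ) ^ (m + 1) * Complex.exp (-(s * t)))) t := by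
      have h2 : HasDerivAt (fun t : ℝ => (t : ℂ) ^ (m + 1)) (((m + 1 : ℕ) : ℂ) * (t : ℂ) ^ m) t := by
        simpa using (hasDerivAt_pow (m + 1) (t : ℂ)).comp_ofReal
      refine (h2.mul (hexp t)).congr_deriv ?_
      push_cast
      ring
    have h1 := integral_Ioi_of_hasDerivAt_of_tendsto (a := 0)
      (Continuous.continuousWithinAt (by fun_prop)) (fun t _ => hd t)
      (((integrableOn_pow_mul_exp hs m).const_mul _).sub
        ((integrableOn_pow_mul_exp hs (m + 1)).const_mul _))
      (tendsto_pow_mul_exp hs (m + 1))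
    rw [integral_sub ((integrableOn_pow_mul_exp hs m).const_mul _)
      ((integrableOn_pow_mul_exp hs (m + 1)).const_mul _), integral_const_mul,
      integral_const_mul, ih] at h1
    simp only [Complex.ofReal_zero, ne_eq, Nat.add_eq_zero_iff, one_ne_zero, and_false,
      not_false_eq_true, zero_pow, zero_mul, sub_zero] at h1
    rw [sub_eq_zero] at h1
    rw [Nat.factorial_succ, pow_succ s (m + 1), eq_div_iff (mul_ne_zero (pow_ne_zero _ hs0) hs0)]
    push_cast
    rw [← mul_assoc, mul_right_comm, mul_comm _ s, ← h1]
    field_simp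

theorem truncatedPower_cutExp {n : ℕ} (hn : 1 ≤ n) {s : ℂ} (hs : 0 < s.re) :
    truncatedPower n (cutExpSchwartz s hs) = 1 / s ^ n := by
  -- Since n ≥ 1, the natural subtraction n - 1 is the true exponent; Euler's integral with m = n -
  -- 1 then gives s^{-n}.
  obtain ⟨m, rfl⟩ : ∃ m, n = m + 1 := ⟨n - 1, by omega⟩
  have h1 : truncatedPower (m + 1) (cutExpSchwartz s hs) =
      ∫ t in Ioi (0 : ℝ), (m.factorial : ℂ)⁻¹ * ((t : ℂ) ^ m * Complex.exp (-(s * t))) := by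
    refine setIntegral_congr_fun measurableSet_Ioi fun t ht => ?_
    have ht0 : (0 : ℝ) < t := ht
    rw [cutExpSchwartz_apply, cutExp_of_ge s (by linarith)]
    simp only [Nat.add_sub_cancel]
    push_cast
    ring
  rw [h1, integral_const_mul, integral_pow_mul_exp hs]
  have h3 : ((m.factorial : ℕ) : ℂ) ≠ 0 := by exact_mod_cast Nat.factorial_ne_zero m
  field_simp

/-! ### Sonine pairs and Laplace transforms -/

/-- Taking transforms of the Sonine relation gives 𝓛k · Φ = s^{-n}. The right side has no zero, so
neither does Φ, and 𝓛k is determined. Conversely the product of the two transforms is s^{-n}, and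
injectivity recovers the relation. -/
theorem isSoninePairWithSymbol_iff {n : ℕ} (hn : 1 ≤ n) (Φ : ℂ → ℂ) (k κ : 𝓢'(ℝ, ℂ)) :
    IsSoninePairWithSymbol n Φ k κ ↔ IsInverseLaplacePair n Φ k κ := by
  obtain ⟨P, hP, hPn⟩ := exists_truncatedPower_distribution n
  have hLP (s : ℂ) (hs : 0 < s.re) : laplace P s hs = 1 / s ^ n :=
    (hPn _).trans (truncatedPower_cutExp hn hs)
  constructor
  · rintro ⟨⟨hk, hκ, hc⟩, hΦ⟩
    have hprod (s : ℂ) (hs : 0 < s.re) : laplace k s hs * Φ s = 1 / s ^ n := by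
      rw [← hΦ s hs, ← laplace_conv hk hκ, laplace, ← (isConvolution_iff hk hκ).1 hc,
        truncatedPower_cutExp hn hs]
    have hne (s : ℂ) (hs : 0 < s.re) : Φ s ≠ 0 := by
      intro h0
      have := hprod s hs
      rw [h0, mul_zero, eq_comm, one_div, inv_eq_zero] at this
      exact pow_ne_zero n (ne_zero_of_re_pos hs) this
    refine ⟨hk, hκ, hne, fun s hs => ?_, hΦ⟩
    rw [eq_div_iff (mul_ne_zero (pow_ne_zero n (ne_zero_of_re_pos hs)) (hne s hs)), mul_comm (s ^ n),
      ← mul_assoc, hprod s hs, one_div, inv_mul_cancel₀ (pow_ne_zero n (ne_zero_of_re_pos hs))]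
  · rintro ⟨hk, hκ, hne, hLk, hLκ⟩
    refine ⟨⟨hk, hκ, (isConvolution_iff hk hκ).2 fun φ => ?_⟩, hLκ⟩
    have : P = conv k κ hκ := by
      refine eq_of_laplace_eq hP (hk.conv hκ) fun s hs => ?_
      rw [hLP, laplace_conv hk hκ, hLk s hs, hLκ s hs]
      have h1 := hne s hs
      have h2 := ne_zero_of_re_pos hs
      field_simp
    rw [← this, hPn]

theorem IsInverseLaplacePair.unique {n : ℕ} {Φ : ℂ → ℂ} {k κ k' κ' : 𝓢'(ℝ, ℂ)}
    (h : IsInverseLaplacePair n Φ k κ) (h' : IsInverseLaplacePair n Φ k' κ') :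
    k = k' ∧ κ = κ' :=
  ⟨eq_of_laplace_eq h.1 h'.1 fun s hs => (h.2.2.2.1 s hs).trans (h'.2.2.2.1 s hs).symm,
    eq_of_laplace_eq h.2.1 h'.2.1 fun s hs => (h.2.2.2.2 s hs).trans (h'.2.2.2.2 s hs).symm⟩

theorem existsUnique_soninePair_iff {n : ℕ} (hn : 1 ≤ n) (Φ : ℂ → ℂ) :
    (∃! p : 𝓢'(ℝ, ℂ) × 𝓢'(ℝ, ℂ), IsSoninePairWithSymbol n Φ p.1 p.2) ↔
      ∃ k κ : 𝓢'(ℝ, ℂ), IsInverseLaplacePair n Φ k κ := by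
  simp only [isSoninePairWithSymbol_iff hn]
  constructor
  · rintro ⟨p, hp, -⟩
    exact ⟨p.1, p.2, hp⟩
  · rintro ⟨k, κ, h⟩
    refine ⟨(k, κ), h, fun q hq => ?_⟩
    obtain ⟨h1, h2⟩ := hq.unique h
    exact Prod.ext h1 h2

/-! ### Behaviour of the symbol of a kernel that is regular at the origin -/

/-- Test functions supported in (-ε, 0) are killed by causality and are integrated against f by
regularity; the fundamental lemma of the calculus of variations applies. -/
theorem ae_eq_zero_of_isCausal {T : 𝓢'(ℝ, ℂ)} (hT : IsCausal T) {ε : ℝ} {f : ℝ → ℂ}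
    (hf : Measurable f) {C : ℝ} (hC : ∀ t, ‖f t‖ ≤ C)
    (h : ∀ φ : 𝓢(ℝ, ℂ), tsupport φ ⊆ Ioo (-ε) ε → T φ = ∫ t, f t * φ t) :
    ∀ᵐ t, t ∈ Ioo (-ε) 0 → f t = 0 := by
  rcases le_or_gt ε 0 with hε | hε
  · rw [Ioo_eq_empty (by linarith)]
    simp
  refine isOpen_Ioo.ae_eq_zero_of_integral_contDiff_smul_eq_zero ?_ fun g hg hgc hgs => ?_
  · refine LocallyIntegrable.locallyIntegrableOn ?_ _
    refine (locallyIntegrable_const C).mono hf.aestronglyMeasurable (Eventually.of_forall fun t => ?_)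
    exact (hC t).trans (le_abs_self C)
  · have hc : HasCompactSupport (fun t => (g t : ℂ)) := hgc.comp_left Complex.ofReal_zero
    have hs : ContDiff ℝ ∞ (fun t => (g t : ℂ)) := Complex.ofRealCLM.contDiff.comp hg
    have hts : tsupport (fun t => (g t : ℂ)) ⊆ tsupport g :=
      closure_mono fun t ht h' => ht (by simp [h'])
    have h1 := h (hc.toSchwartzMap hs) ((hts.trans hgs).trans (Ioo_subset_Ioo_right hε.le))
    rw [hT (hc.toSchwartzMap hs) ((hts.trans hgs).trans Ioo_subset_Iio_self)] at h1
    rw [h1]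
    exact integral_congr_ae (Eventually.of_forall fun t => by simp [mul_comm])

theorem one_add_pow_mul_exp_neg_half_le (N : ℕ) {t : ℝ} (ht : 0 ≤ t) :
    (1 + t) ^ N * Real.exp (-(t / 2)) ≤ 2 ^ N * N.factorial * Real.exp (1 / 2) := by
  have h2 := Real.pow_div_factorial_le_exp ((1 + t) / 2) (by linarith) N
  rw [div_le_iff₀ (by positivity), div_pow, div_le_iff₀ (by positivity)] at h2
  calc (1 + t) ^ N * Real.exp (-(t / 2))
      ≤ Real.exp ((1 + t) / 2) * N.factorial * 2 ^ N * Real.exp (-(t / 2)) := by gcongr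
    _ = 2 ^ N * N.factorial * (Real.exp ((1 + t) / 2) * Real.exp (-(t / 2))) := by ring
    _ = _ := by rw [← Real.exp_add]; ring_nf

/-- A gap between 0 and the support makes the transform exponentially small, up to powers of x
coming from derivatives; only order 1/x is kept. -/
theorem exists_bound_laplace_of_vanishing {T : 𝓢'(ℝ, ℂ)} {a : ℝ} (ha : 0 < a)
    (hT : Distribution.IsVanishingOn T (Iio a)) :
    ∃ C : ℝ, ∀ (x : ℝ) (hx : 1 ≤ x),
      x * ‖laplace T x (by rw [Complex.ofReal_re]; linarith)‖ ≤ C := by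
  obtain ⟨N, C, hC0, hC⟩ := exists_bound_Ioi hT (show a / 2 < a by linarith)
  set A : ℝ := 2 ^ N * N.factorial * Real.exp (1 / 2)
  set B : ℝ := (N + 1).factorial / (a / 4) ^ (N + 1)
  have hA0 : 0 ≤ A := by positivity
  have hB0 : 0 ≤ B := by positivity
  refine ⟨C * (A * B), fun x hx => ?_⟩
  have hx0 : 0 < x := by linarith
  have key : ‖laplace T x (by rw [Complex.ofReal_re]; linarith)‖ ≤ C * (A * B / x) := by
    refine hC _ _ fun m hm t ht => ?_
    have ht0 : 0 < t := by linarith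
    have heq : (cutExpSchwartz x (by rw [Complex.ofReal_re]; linarith) : ℝ → ℂ) =ᶠ[𝓝 t]
        fun t : ℝ => Complex.exp (-((x : ℂ) * t)) := by
      filter_upwards [Ioi_mem_nhds (show (-1 : ℝ) < t by linarith)] with y hy
        using cutExp_of_ge _ (le_of_lt hy)
    rw [heq.iteratedDeriv_eq, iteratedDeriv_exp_neg_mul, norm_mul, norm_pow, norm_neg,
      Complex.norm_real, Complex.norm_exp, Real.norm_of_nonneg hx0.le, abs_of_pos ht0]
    have hre : (-((x : ℂ) * (t : ℂ))).re = -(x * t) := by simp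
    rw [hre, le_div_iff₀ hx0]
    have h1 := Real.pow_div_factorial_le_exp (a / 4 * x) (by positivity) (N + 1)
    rw [div_le_iff₀ (by positivity), mul_pow] at h1
    have h2 : x ^ (N + 1) * Real.exp (-(a / 4 * x)) ≤ B := by
      rw [Real.exp_neg, ← div_eq_mul_inv, div_le_div_iff₀ (Real.exp_pos _) (by positivity)]
      linarith
    -- Half of the exponent, with x ≥ 1, is spent on the weight in t, and the other half, with t >
    -- a/2, on the powers of x.
    have h3 : Real.exp (-(x * t)) ≤ Real.exp (-(t / 2)) * Real.exp (-(a / 4 * x)) := by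
      rw [← Real.exp_add]
      refine Real.exp_le_exp.2 ?_
      nlinarith
    have h4 : x ^ m * x ≤ x ^ (N + 1) := by
      rw [← pow_succ]
      exact pow_le_pow_right₀ hx (by omega)
    calc (1 + t) ^ N * (x ^ m * Real.exp (-(x * t))) * x
        = (1 + t) ^ N * ((x ^ m * x) * Real.exp (-(x * t))) := by ring
      _ ≤ (1 + t) ^ N * (x ^ (N + 1) * (Real.exp (-(t / 2)) * Real.exp (-(a / 4 * x)))) := by gcongr
      _ = ((1 + t) ^ N * Real.exp (-(t / 2))) * (x ^ (N + 1) * Real.exp (-(a / 4 * x))) := by ring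
      _ ≤ A * B := mul_le_mul (one_add_pow_mul_exp_neg_half_le N ht0.le) h2 (by positivity) hA0
  calc _ ≤ x * (C * (A * B / x)) := by gcongr
    _ = _ := by field_simp

theorem norm_step_le (a b t : ℝ) : ‖step a b t‖ ≤ 1 := by
  rw [step, Complex.norm_real, Real.norm_of_nonneg (Real.smoothTransition.nonneg _)]
  exact Real.smoothTransition.le_one _

/-- Abelian estimate. A partition by smooth steps splits T into a piece supported away from 0, which
is O(1/x) by the previous estimate, and a piece near 0 given by a bounded function on the positive
side, whose transform is at most a constant times ∫ e^{-xt} dt = 1/x. -/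
theorem exists_bound_laplace_of_isRegularAtOrigin {T : 𝓢'(ℝ, ℂ)} (hT : IsCausal T)
    (hr : IsRegularAtOrigin T) :
    ∃ C : ℝ, ∀ (x : ℝ) (hx : 1 ≤ x),
      x * ‖laplace T x (by rw [Complex.ofReal_re]; linarith)‖ ≤ C := by
  obtain ⟨ε, hε, f, hf, ⟨C, hC⟩, h⟩ := hr
  have hC0 : 0 ≤ C := (norm_nonneg _).trans (hC 0)
  have hη : ε / 4 < ε / 2 := by linarith
  have hl : -(ε / 2) < -(ε / 4) := by linarith
  have hf0 := ae_eq_zero_of_isCausal hT hf hC h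
  set T' : 𝓢'(ℝ, ℂ) := TemperedDistribution.smulLeftCLM ℂ (step (ε / 4) (ε / 2)) T
  have hT' : Distribution.IsVanishingOn T' (Iio (ε / 4)) := by
    intro φ hφ
    rw [TemperedDistribution.smulLeftCLM_apply_apply, ← map_zero T]
    congr 1
    ext t
    rw [step_smul_apply hη]
    rcases lt_or_ge t (ε / 4) with ht | ht
    · rw [step_of_le hη ht.le]; simp
    · rw [image_eq_zero_of_notMem_tsupport fun h' => not_lt.2 ht (mem_Iio.1 (hφ h'))]; simp
  obtain ⟨B, hB⟩ := exists_bound_laplace_of_vanishing (by positivity) hT'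
  refine ⟨2 * C + B, fun x hx => ?_⟩
  have hx0 : 0 < x := by linarith
  have hxre : 0 < ((x : ℝ) : ℂ).re := by rwa [Complex.ofReal_re]
  set φ := cutExpSchwartz x hxre
  set ψ : 𝓢(ℝ, ℂ) := SchwartzMap.smulLeftCLM ℂ (step (-(ε / 2)) (-(ε / 4))) φ -
    SchwartzMap.smulLeftCLM ℂ (step (ε / 4) (ε / 2)) φ
  have hψ (t : ℝ) : ψ t = (step (-(ε / 2)) (-(ε / 4)) t - step (ε / 4) (ε / 2) t) * φ t := by
    rw [_root_.sub_apply, step_smul_apply hl, step_smul_apply hη, sub_mul]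
  have hsplit : laplace T x hxre = T ψ + laplace T' x hxre := by
    change T φ = T ψ + T (SchwartzMap.smulLeftCLM ℂ (step (ε / 4) (ε / 2)) φ)
    rw [← map_add]
    refine apply_eq_of_eqOn_Ioi hT (b := -(ε / 4)) (by linarith) fun t ht => ?_
    rw [_root_.add_apply, hψ, step_smul_apply hη, step_of_ge hl ht.le]
    ring
  have hsupp : tsupport ψ ⊆ Ioo (-ε) ε := by
    have h1 : tsupport ψ ⊆ Ici (-(ε / 2)) := tsupport_subset_Ici fun t ht => by
      rw [hψ, step_of_le hl ht.le, step_of_le hη (by linarith)]; simp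
    have h2 : tsupport ψ ⊆ Iic (ε / 2) := tsupport_subset_Iic fun t ht => by
      rw [hψ, step_of_ge hl (by linarith), step_of_ge hη ht.le]; simp
    intro t ht
    have h3 : -(ε / 2) ≤ t := h1 ht
    have h4 : t ≤ ε / 2 := h2 ht
    exact ⟨by linarith, by linarith⟩
  have hbound : ‖T ψ‖ ≤ 2 * C / x := by
    rw [h ψ hsupp]
    have hi : IntegrableOn (fun t => 2 * C * Real.exp (-x * t)) (Ioi 0) :=
      (integrableOn_exp_mul_Ioi (by linarith) 0).const_mul _
    have hint : ∫ t in Ioi (0 : ℝ), 2 * C * Real.exp (-x * t) = 2 * C / x := by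
      rw [integral_const_mul, integral_exp_mul_Ioi (by linarith)]
      simp
      field_simp
    rw [← hint, ← integral_indicator measurableSet_Ioi]
    refine norm_integral_le_of_norm_le (hi.integrable_indicator measurableSet_Ioi) ?_
    have hne : ∀ᵐ t : ℝ, t ≠ 0 := by
      simp [ae_iff]
    filter_upwards [hf0, hne] with t ht ht0
    by_cases hts : t ∈ tsupport ψ
    · rcases lt_or_gt_of_ne ht0 with h0 | h0
      · rw [ht ⟨(hsupp hts).1, h0⟩, zero_mul, norm_zero]
        exact indicator_nonneg (fun t _ => by positivity) _
      · rw [indicator_of_mem (show t ∈ Ioi 0 from h0), hψ, norm_mul, norm_mul]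
        have e1 : ‖φ t‖ = Real.exp (-x * t) := by
          change ‖cutExp x t‖ = _
          rw [cutExp_of_ge _ (by linarith), Complex.norm_exp]
          simp
        have e2 : ‖step (-(ε / 2)) (-(ε / 4)) t - step (ε / 4) (ε / 2) t‖ ≤ 2 := by
          have b1 := norm_step_le (-(ε / 2)) (-(ε / 4)) t
          have b2 := norm_step_le (ε / 4) (ε / 2) t
          exact (norm_sub_le _ _).trans (by linarith)
        rw [e1]
        calc _ ≤ C * (2 * Real.exp (-x * t)) := by gcongr; exact hC t
          _ = _ := by ring
    · rw [image_eq_zero_of_notMem_tsupport hts, mul_zero, norm_zero]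
      exact indicator_nonneg (fun t _ => by positivity) _
  rw [hsplit]
  calc x * ‖T ψ + laplace T' x hxre‖ ≤ x * (‖T ψ‖ + ‖laplace T' x hxre‖) := by
        gcongr; exact norm_add_le _ _
    _ = x * ‖T ψ‖ + x * ‖laplace T' x hxre‖ := by ring
    _ ≤ x * (2 * C / x) + B := add_le_add (by gcongr) (hB x hx)
    _ = _ := by field_simp

/-- Common source of both singularity criteria: x Φ(x) = (Φ/G)(x) · x G(x) is unbounded, against the
bound O(1/x) for a regular kernel. -/
theorem not_isRegularAtOrigin_of_tendsto {T : 𝓢'(ℝ, ℂ)} (hT : IsCausal T) {Φ : ℂ → ℂ}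
    (hΦ : HasLaplaceTransform T Φ) {G : ℝ → ℂ} {c : ℂ} (hc : c ≠ 0)
    (hG : Tendsto (fun x : ℝ => ‖(x : ℂ) * G x‖) atTop atTop)
    (h : Tendsto (fun x : ℝ => Φ x / G x) atTop (𝓝 c)) : ¬ IsRegularAtOrigin T := by
  intro hr
  obtain ⟨C, hC⟩ := exists_bound_laplace_of_isRegularAtOrigin hT hr
  have h1 : Tendsto (fun x : ℝ => ‖Φ x / G x‖ * ‖(x : ℂ) * G x‖) atTop atTop :=
    h.norm.pos_mul_atTop (norm_pos_iff.2 hc) hG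
  obtain ⟨x, hx, hx1, hx2⟩ := ((h1.eventually_gt_atTop C).and
    ((eventually_ge_atTop 1).and (hG.eventually_gt_atTop 0))).exists
  have hGx : G x ≠ 0 := by
    rintro h0
    simp [h0] at hx2
  have h2 := hC x hx1
  rw [hΦ] at h2
  refine absurd hx (not_lt.2 (le_trans (le_of_eq ?_) h2))
  rw [← norm_mul, show Φ x / G x * ((x : ℂ) * G x) = x * Φ x by field_simp, norm_mul,
    Complex.norm_real, Real.norm_of_nonneg (by linarith)]

theorem tendsto_norm_mul_rpow {n : ℕ} {α : ℝ} (hα : (n : ℝ) - 1 < α) :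
    Tendsto (fun x : ℝ => ‖(x : ℂ) * ((x ^ (α - n) : ℝ) : ℂ)‖) atTop atTop := by
  refine (tendsto_rpow_atTop (show 0 < α - n + 1 by linarith)).congr' ?_
  filter_upwards [eventually_gt_atTop 0] with x hx
  rw [← Complex.ofReal_mul, Complex.norm_real, Real.norm_of_nonneg (by positivity),
    Real.rpow_add_one hx.ne', mul_comm]

/-! ### Laplace integrals of Stieltjes measures -/

/-- The measures on `(0, ∞)` that represent Stieltjes and complete Bernstein functions. -/
structure IsStieltjesMeasure (σ : Measure ℝ) : Prop where
  ae_pos : ∀ᵐ t ∂σ, 0 < t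
  integrable : Integrable (fun t : ℝ => 1 / (1 + t)) σ

theorem isStieltjesMeasure_restrict {σ : Measure ℝ}
    (h : ∫⁻ t in Ioi (0 : ℝ), ENNReal.ofReal (1 / (1 + t)) ∂σ < ⊤) :
    IsStieltjesMeasure (σ.restrict (Ioi 0)) := by
  have h1 : ∀ᵐ t ∂σ.restrict (Ioi (0 : ℝ)), 0 < t := ae_restrict_mem measurableSet_Ioi
  refine ⟨h1, Measurable.aestronglyMeasurable (by fun_prop), ?_⟩
  rw [hasFiniteIntegral_iff_ofReal]
  · exact h
  · filter_upwards [h1] with t ht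
    change (0 : ℝ) ≤ 1 / (1 + t)
    positivity

namespace IsStieltjesMeasure

variable {σ : Measure ℝ}

/-- The measure (1 + t)⁻¹ σ is finite, and σ is recovered from it by the reciprocal density, which
is almost everywhere finite. Needed for every use of Fubini below. -/
theorem sigmaFinite (hσ : IsStieltjesMeasure σ) : SigmaFinite σ := by
  have h0 : ∀ᵐ t ∂σ, ENNReal.ofReal (1 / (1 + t)) ≠ 0 := by
    filter_upwards [hσ.ae_pos] with t ht
    simp only [ne_eq, ENNReal.ofReal_eq_zero, not_le]
    positivity
  have hfin : IsFiniteMeasure (σ.withDensity fun t => ENNReal.ofReal (1 / (1 + t))) := by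
    refine isFiniteMeasure_withDensity_ofReal ?_
    exact hσ.integrable.2
  have h1 := withDensity_inv_same (μ := σ) (f := fun t : ℝ => ENNReal.ofReal (1 / (1 + t)))
    (by fun_prop) h0 (by simp)
  rw [← h1]
  refine SigmaFinite.withDensity_of_ne_top ?_
  have h2 : ∀ᵐ t ∂(σ.withDensity fun t => ENNReal.ofReal (1 / (1 + t))),
      ENNReal.ofReal (1 / (1 + t)) ≠ 0 := withDensity_absolutelyContinuous _ _ h0
  filter_upwards [h2] with t ht
  simpa using ht

/-- A function that decays like `1 / (1 + t)` is integrable. -/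
theorem integrable_of_norm_le (hσ : IsStieltjesMeasure σ) {E : Type*} [NormedAddCommGroup E]
    {f : ℝ → E} (hf : AEStronglyMeasurable f σ) {C : ℝ}
    (h : ∀ t, 0 < t → ‖f t‖ ≤ C * (1 / (1 + t))) : Integrable f σ :=
  (hσ.integrable.const_mul C).mono' hf (by filter_upwards [hσ.ae_pos] with t ht using h t ht)

end IsStieltjesMeasure

/-- One half of the exponent absorbs t^m, the other half produces the factor 1/(1 + t) against which
σ is integrable. -/
theorem pow_mul_exp_neg_le {r t : ℝ} (hr : 0 < r) (ht : 0 < t) (m : ℕ) :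
    t ^ m * Real.exp (-(r * t)) ≤ m.factorial / (r / 2) ^ m * (1 + 2 / r) * (1 / (1 + t)) := by
  have h1 := Real.pow_div_factorial_le_exp (r / 2 * t) (by positivity) m
  rw [div_le_iff₀ (by positivity), mul_pow] at h1
  have h2 : t ^ m * Real.exp (-(r / 2 * t)) ≤ m.factorial / (r / 2) ^ m := by
    rw [Real.exp_neg, ← div_eq_mul_inv, div_le_div_iff₀ (Real.exp_pos _) (by positivity)]
    linarith
  have h3 : Real.exp (-(r / 2 * t)) ≤ (1 + 2 / r) * (1 / (1 + t)) := by
    have h4 := Real.add_one_le_exp (r / 2 * t)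
    have h5 : 1 + t ≤ (1 + 2 / r) * Real.exp (r / 2 * t) := by
      have : (1 + 2 / r) * (r / 2 * t + 1) ≤ (1 + 2 / r) * Real.exp (r / 2 * t) := by gcongr
      refine le_trans ?_ this
      have e : (1 + 2 / r) * (r / 2 * t + 1) = 1 + t + (r / 2 * t + 2 / r) := by field_simp; ring
      rw [e]
      have : 0 ≤ r / 2 * t + 2 / r := by positivity
      linarith
    rw [Real.exp_neg, mul_one_div, le_div_iff₀ (by positivity), inv_mul_le_iff₀ (Real.exp_pos _),
      mul_comm (Real.exp _)]
    exact h5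
  calc t ^ m * Real.exp (-(r * t))
      = (t ^ m * Real.exp (-(r / 2 * t))) * Real.exp (-(r / 2 * t)) := by
        rw [mul_assoc, ← Real.exp_add]; ring_nf
    _ ≤ m.factorial / (r / 2) ^ m * ((1 + 2 / r) * (1 / (1 + t))) :=
        mul_le_mul h2 h3 (Real.exp_pos _).le (by positivity)
    _ = _ := by ring

/-- The derivatives `∫ (-t)^m e^{-rt} σ(dt)` of the Laplace transform of `σ`. -/
def laplaceMoment (σ : Measure ℝ) (m : ℕ) (r : ℝ) : ℝ := ∫ t, (-t) ^ m * Real.exp (-(r * t)) ∂σ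

theorem norm_neg_pow_mul_exp (m : ℕ) (r : ℝ) {t : ℝ} (ht : 0 < t) :
    ‖(-t) ^ m * Real.exp (-(r * t))‖ = t ^ m * Real.exp (-(r * t)) := by
  rw [norm_mul, norm_pow, norm_neg, Real.norm_of_nonneg ht.le, Real.norm_of_nonneg (Real.exp_pos _).le]

namespace IsStieltjesMeasure

variable {σ : Measure ℝ}

theorem integrable_pow_mul_exp (hσ : IsStieltjesMeasure σ) (m : ℕ) {r : ℝ} (hr : 0 < r) :
    Integrable (fun t => (-t) ^ m * Real.exp (-(r * t))) σ :=
  hσ.integrable_of_norm_le (Continuous.aestronglyMeasurable (by fun_prop)) fun t ht => by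
    rw [norm_neg_pow_mul_exp m r ht]
    exact pow_mul_exp_neg_le hr ht m

theorem hasDerivAt_laplaceMoment (hσ : IsStieltjesMeasure σ) (m : ℕ) {r : ℝ} (hr : 0 < r) :
    HasDerivAt (laplaceMoment σ m) (laplaceMoment σ (m + 1) r) r := by
  have hr2 : 0 < r / 2 := by positivity
  refine (hasDerivAt_integral_of_dominated_loc_of_deriv_le (s := Ioi (r / 2))
    (F := fun r t => (-t) ^ m * Real.exp (-(r * t)))
    (F' := fun r t => (-t) ^ (m + 1) * Real.exp (-(r * t)))
    (bound := fun t => ‖(-t) ^ (m + 1) * Real.exp (-(r / 2 * t))‖)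
    (Ioi_mem_nhds (by linarith)) ?_ (hσ.integrable_pow_mul_exp m hr) ?_ ?_
    (hσ.integrable_pow_mul_exp (m + 1) hr2).norm ?_).2
  · exact Eventually.of_forall fun x => Continuous.aestronglyMeasurable (by fun_prop)
  · exact Continuous.aestronglyMeasurable (by fun_prop)
  · filter_upwards [hσ.ae_pos] with t ht x hx
    have hx' : r / 2 < x := hx
    rw [norm_neg_pow_mul_exp _ _ ht, norm_neg_pow_mul_exp _ _ ht]
    gcongr
  · refine Eventually.of_forall fun t x _ => ?_
    have h1 : HasDerivAt (fun x : ℝ => -(x * t)) (-(1 * t)) x := ((hasDerivAt_id x).mul_const t).neg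
    refine (h1.exp.const_mul ((-t) ^ m)).congr_deriv ?_
    ring

theorem contDiffOn_laplaceMoment (hσ : IsStieltjesMeasure σ) (m : ℕ) :
    ContDiffOn ℝ ∞ (laplaceMoment σ m) (Ioi 0) := by
  rw [contDiffOn_infty]
  intro n
  induction n generalizing m with
  | zero =>
    exact contDiffOn_zero.2 fun r hr =>
      (hσ.hasDerivAt_laplaceMoment m hr).continuousAt.continuousWithinAt
  | succ n ih =>
    rw [show ((n + 1 : ℕ) : ℕ∞ω) = (n : ℕ∞ω) + 1 by push_cast; rfl,
      contDiffOn_succ_iff_deriv_of_isOpen isOpen_Ioi]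
    refine ⟨fun r hr => (hσ.hasDerivAt_laplaceMoment m hr).differentiableAt.differentiableWithinAt,
      by simp, (ih (m + 1)).congr fun r hr => (hσ.hasDerivAt_laplaceMoment m hr).deriv⟩

theorem laplaceMoment_nonneg (hσ : IsStieltjesMeasure σ) (m : ℕ) (r : ℝ) :
    0 ≤ (-1) ^ m * laplaceMoment σ m r := by
  rw [laplaceMoment, ← integral_const_mul]
  refine integral_nonneg_of_ae ?_
  filter_upwards [hσ.ae_pos] with t ht
  change 0 ≤ (-1) ^ m * ((-t) ^ m * Real.exp (-(r * t)))
  rw [← mul_assoc, ← mul_pow]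
  simp only [neg_mul, one_mul, neg_neg]
  positivity

theorem iteratedDeriv_laplaceMoment (hσ : IsStieltjesMeasure σ) (m j : ℕ) {r : ℝ} (hr : 0 < r) :
    iteratedDeriv m (laplaceMoment σ j) r = laplaceMoment σ (j + m) r := by
  induction m generalizing j r with
  | zero => rfl
  | succ m ih =>
    rw [iteratedDeriv_succ']
    have : deriv (laplaceMoment σ j) =ᶠ[𝓝 r] laplaceMoment σ (j + 1) := by
      filter_upwards [Ioi_mem_nhds hr] with x hx using (hσ.hasDerivAt_laplaceMoment j hx).deriv
    rw [this.iteratedDeriv_eq, ih _ hr]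
    congr 1
    omega

end IsStieltjesMeasure

/-- The density `a + ∫ e^{-rt} σ(dt)`. -/
def stieltjesDensity (a : ℝ) (σ : Measure ℝ) (r : ℝ) : ℝ := a + laplaceMoment σ 0 r

theorem stieltjesDensity_apply (a : ℝ) (σ : Measure ℝ) (r : ℝ) :
    stieltjesDensity a σ r = a + ∫ t, Real.exp (-(r * t)) ∂σ := by
  simp [stieltjesDensity, laplaceMoment]

namespace IsStieltjesMeasure

variable {σ : Measure ℝ}

theorem isCompletelyMonotone (hσ : IsStieltjesMeasure σ) {a : ℝ} (ha : 0 ≤ a) :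
    IsCompletelyMonotone (stieltjesDensity a σ) := by
  refine ⟨contDiffOn_const.add (hσ.contDiffOn_laplaceMoment 0), fun m t ht => ?_⟩
  have h1 : iteratedDeriv m (stieltjesDensity a σ) t =
      iteratedDeriv m (fun _ => a) t + laplaceMoment σ m t := by
    have hc : ContDiffAt ℝ m (laplaceMoment σ 0) t :=
      ((hσ.contDiffOn_laplaceMoment 0).contDiffAt (Ioi_mem_nhds ht)).of_le
        (by exact_mod_cast le_top)
    rw [show stieltjesDensity a σ = (fun _ => a) + laplaceMoment σ 0 from rfl,
      iteratedDeriv_add contDiffAt_const hc, hσ.iteratedDeriv_laplaceMoment m 0 ht, zero_add]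
  rw [h1, mul_add]
  refine add_nonneg ?_ (hσ.laplaceMoment_nonneg m t)
  rw [iteratedDeriv_const]
  rcases Nat.eq_zero_or_pos m with rfl | hm
  · simpa using ha
  · simp [hm.ne']

/-- The weight (1 + r)^{-2} stands in for a Schwartz function. The integral in r is at most K
because e^{-rt} ≤ 1, and at most 1/t because the weight is at most 1; adding, it is at most (K +
1)/(1 + t), which σ integrates. -/
theorem integrable_prod_exp (hσ : IsStieltjesMeasure σ) :
    Integrable (fun p : ℝ × ℝ => Real.exp (-(p.1 * p.2)) * ((1 + p.1) ^ 2)⁻¹)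
      ((volume.restrict (Ioi 0)).prod σ) := by
  have := hσ.sigmaFinite
  have hm : Measurable (fun p : ℝ × ℝ => Real.exp (-(p.1 * p.2)) * ((1 + p.1) ^ 2)⁻¹) := by fun_prop
  have h2 : IntegrableOn (fun r : ℝ => ((1 + r) ^ 2)⁻¹) (Ioi 0) := by
    have h1 : IntegrableOn (fun r : ℝ => (1 + ‖r‖) ^ (-(2 : ℝ))) (Ioi 0) :=
      (integrable_one_add_norm (by simp)).integrableOn
    refine h1.congr_fun (fun r hr => ?_) measurableSet_Ioi
    have hr0 : (0 : ℝ) < r := hr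
    dsimp only
    rw [Real.norm_of_nonneg hr0.le, Real.rpow_neg (by positivity), Real.rpow_two]
  have hle (r : ℝ) (hr : 0 < r) (t : ℝ) (ht : 0 < t) :
      ‖Real.exp (-(r * t)) * ((1 + r) ^ 2)⁻¹‖ ≤ ((1 + r) ^ 2)⁻¹ ∧
      ‖Real.exp (-(r * t)) * ((1 + r) ^ 2)⁻¹‖ ≤ Real.exp (-t * r) := by
    rw [Real.norm_of_nonneg (by positivity)]
    constructor
    · refine mul_le_of_le_one_left (by positivity) ?_
      rw [Real.exp_le_one_iff]
      have := mul_pos hr ht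
      linarith
    · rw [show -(r * t) = -t * r by ring]
      refine mul_le_of_le_one_right (Real.exp_pos _).le (inv_le_one_of_one_le₀ ?_)
      nlinarith
  have hi (t : ℝ) (ht : 0 < t) : IntegrableOn
      (fun r => Real.exp (-(r * t)) * ((1 + r) ^ 2)⁻¹) (Ioi 0) := by
    refine h2.mono' (Measurable.aestronglyMeasurable (by fun_prop)) ?_
    filter_upwards [ae_restrict_mem measurableSet_Ioi] with r hr using (hle r hr t ht).1
  rw [integrable_prod_iff' hm.aestronglyMeasurable]
  refine ⟨by filter_upwards [hσ.ae_pos] with t ht using hi t ht, ?_⟩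
  set K := ∫ r in Ioi (0 : ℝ), ((1 + r) ^ 2)⁻¹
  have hK : 0 ≤ K := setIntegral_nonneg measurableSet_Ioi fun r _ => by positivity
  refine hσ.integrable_of_norm_le (C := K + 1) ?_ fun t ht => ?_
  · exact (hm.norm.stronglyMeasurable.integral_prod_left').aestronglyMeasurable
  · have b0 : 0 ≤ ∫ r in Ioi (0 : ℝ), ‖Real.exp (-(r * t)) * ((1 + r) ^ 2)⁻¹‖ :=
      integral_nonneg fun r => norm_nonneg _
    have b1 : ∫ r in Ioi (0 : ℝ), ‖Real.exp (-(r * t)) * ((1 + r) ^ 2)⁻¹‖ ≤ K :=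
      setIntegral_mono_on (hi t ht).norm h2 measurableSet_Ioi fun r hr => (hle r hr t ht).1
    have b2 : ∫ r in Ioi (0 : ℝ), ‖Real.exp (-(r * t)) * ((1 + r) ^ 2)⁻¹‖ ≤ 1 / t := by
      have e : ∫ r in Ioi (0 : ℝ), Real.exp (-t * r) = 1 / t := by
        rw [integral_exp_mul_Ioi (by linarith)]
        simp
      rw [← e]
      exact setIntegral_mono_on (hi t ht).norm (integrableOn_exp_mul_Ioi (by linarith) 0)
        measurableSet_Ioi fun r hr => (hle r hr t ht).2
    rw [Real.norm_of_nonneg b0, mul_one_div, le_div_iff₀ (by positivity)]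
    rw [le_div_iff₀ ht] at b2
    linarith

theorem integrable_prod_exp_mul (hσ : IsStieltjesMeasure σ) (φ : 𝓢(ℝ, ℂ)) :
    Integrable (fun p : ℝ × ℝ => (Real.exp (-(p.1 * p.2)) : ℂ) * φ p.1)
      ((volume.restrict (Ioi 0)).prod σ) := by
  have := hσ.sigmaFinite
  obtain ⟨D, hD0, hD⟩ := exists_decay φ 2 0
  have hm : Continuous (fun p : ℝ × ℝ => (Real.exp (-(p.1 * p.2)) : ℂ) * φ p.1) := by
    have := φ.continuous
    fun_prop
  refine (hσ.integrable_prod_exp.const_mul D).mono' hm.aestronglyMeasurable ?_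
  have hpos : ∀ᵐ p ∂((volume.restrict (Ioi (0 : ℝ))).prod σ), (0 : ℝ) < p.1 :=
    Measure.quasiMeasurePreserving_fst.ae (ae_restrict_mem measurableSet_Ioi)
  filter_upwards [hpos] with p hp
  have h1 := hD p.1
  rw [iteratedDeriv_zero, abs_of_pos hp] at h1
  rw [norm_mul, Complex.norm_real, Real.norm_of_nonneg (Real.exp_pos _).le]
  have h2 : ‖φ p.1‖ ≤ D * ((1 + p.1) ^ 2)⁻¹ := by
    rw [← div_eq_mul_inv, le_div_iff₀ (by positivity)]
    linarith
  calc _ ≤ Real.exp (-(p.1 * p.2)) * (D * ((1 + p.1) ^ 2)⁻¹) := by gcongr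
    _ = _ := by ring

theorem integrableOn_mul_stieltjesDensity (hσ : IsStieltjesMeasure σ) (a : ℝ) :
    IntegrableOn (fun r => ((1 + r) ^ 2)⁻¹ * stieltjesDensity a σ r) (Ioi 0) := by
  have := hσ.sigmaFinite
  have h1 := hσ.integrable_prod_exp.integral_prod_left
  have h2 : IntegrableOn (fun r : ℝ => ((1 + r) ^ 2)⁻¹ * a) (Ioi 0) := by
    have h1 : IntegrableOn (fun r : ℝ => (1 + ‖r‖) ^ (-(2 : ℝ)) * a) (Ioi 0) :=
      ((integrable_one_add_norm (by simp)).mul_const a).integrableOn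
    refine h1.congr_fun (fun r hr => ?_) measurableSet_Ioi
    have hr0 : (0 : ℝ) < r := hr
    dsimp only
    rw [Real.norm_of_nonneg hr0.le, Real.rpow_neg (by positivity), Real.rpow_two]
  refine (h2.add h1).congr (Eventually.of_forall fun r => ?_)
  simp only [Pi.add_apply, stieltjesDensity_apply]
  rw [integral_mul_const]
  ring

theorem aemeasurable_stieltjesDensity (hσ : IsStieltjesMeasure σ) (a : ℝ) :
    AEMeasurable (stieltjesDensity a σ) (volume.restrict (Ioi 0)) :=
  (ContinuousOn.aestronglyMeasurable (hσ.contDiffOn_laplaceMoment 0).continuousOn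
    measurableSet_Ioi).aemeasurable.const_add a

/-- The distribution `b δ₀ + (a + ∫ e^{-rt} σ(dt)) dr` on `[0, ∞)`. -/
theorem exists_distribution (hσ : IsStieltjesMeasure σ) {a : ℝ} (ha : 0 ≤ a) (b : ℝ) :
    ∃ T : 𝓢'(ℝ, ℂ), IsCausal T ∧ ∀ φ : 𝓢(ℝ, ℂ),
      T φ = b * φ 0 + ∫ r in Ioi (0 : ℝ), (stieltjesDensity a σ r : ℂ) * φ r := by
  obtain ⟨T, hT, hTφ⟩ := exists_density_distribution (hσ.aemeasurable_stieltjesDensity a)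
    (fun t ht => by
      have := (hσ.isCompletelyMonotone ha).2 0 t ht
      simpa using this) 2 (by
    refine (hσ.integrableOn_mul_stieltjesDensity a).congr_fun (fun r hr => ?_) measurableSet_Ioi
    have hr0 : (0 : ℝ) < r := hr
    dsimp only
    rw [Real.norm_of_nonneg hr0.le, Nat.cast_ofNat, Real.rpow_neg (by positivity), Real.rpow_two])
  refine ⟨(b : ℂ) • TemperedDistribution.delta (0 : ℝ) + T, fun φ hφ => ?_, fun φ => ?_⟩
  · change (b : ℂ) • φ 0 + T φ = 0
    rw [hT φ hφ, image_eq_zero_of_notMem_tsupport fun h => lt_irrefl (0 : ℝ) (mem_Iio.1 (hφ h)),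
      smul_zero, add_zero]
  · change (b : ℂ) • φ 0 + T φ = _
    rw [hTφ, smul_eq_mul]

theorem integrableOn_stieltjesDensity (hσ : IsStieltjesMeasure σ) (a : ℝ) :
    IntegrableOn (stieltjesDensity a σ) (Ioc 0 1) := by
  have h := (hσ.integrableOn_mul_stieltjesDensity a).mono_set
    (show Ioc (0 : ℝ) 1 ⊆ Ioi 0 from Ioc_subset_Ioi_self)
  refine (h.norm.const_mul 4).mono' ((hσ.aemeasurable_stieltjesDensity a).mono_measure
    (Measure.restrict_mono Ioc_subset_Ioi_self le_rfl)).aestronglyMeasurable ?_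
  filter_upwards [ae_restrict_mem measurableSet_Ioc] with r hr
  have h0 := hr.1
  rw [norm_mul, Real.norm_of_nonneg (show (0 : ℝ) ≤ ((1 + r) ^ 2)⁻¹ by positivity), ← mul_assoc]
  refine le_mul_of_one_le_left (norm_nonneg _) ?_
  rw [← div_eq_mul_inv, one_le_div (by positivity)]
  nlinarith [hr.2]

theorem integral_stieltjesDensity_mul (hσ : IsStieltjesMeasure σ) (a : ℝ) (φ : 𝓢(ℝ, ℂ)) :
    ∫ r in Ioi (0 : ℝ), (stieltjesDensity a σ r : ℂ) * φ r =
      a * (∫ r in Ioi (0 : ℝ), φ r) +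
        ∫ t, (∫ r in Ioi (0 : ℝ), (Real.exp (-(r * t)) : ℂ) * φ r) ∂σ := by
  have := hσ.sigmaFinite
  have hI := hσ.integrable_prod_exp_mul φ
  rw [← integral_integral_swap (f := fun r t => (Real.exp (-(r * t)) : ℂ) * φ r) hI,
    ← integral_const_mul, ← integral_add]
  · refine integral_congr_ae (Eventually.of_forall fun r => ?_)
    dsimp only
    rw [stieltjesDensity_apply, integral_mul_const, Complex.ofReal_add, ← integral_complex_ofReal,
      add_mul]
  · exact (φ.integrable.const_mul _).integrableOn
  · exact hI.integral_prod_left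

/-- By Fubini, the Laplace transform of r ↦ ∫ e^{-rt} σ(dt) is the Stieltjes transform of σ; the
constant a contributes a/s and the atom at 0 contributes b. -/
theorem laplace_eq (hσ : IsStieltjesMeasure σ) {a b : ℝ} {T : 𝓢'(ℝ, ℂ)}
    (hT : ∀ φ : 𝓢(ℝ, ℂ),
      T φ = b * φ 0 + ∫ r in Ioi (0 : ℝ), (stieltjesDensity a σ r : ℂ) * φ r)
    {s : ℂ} (hs : 0 < s.re) : laplace T s hs = a / s + b + ∫ t, 1 / (s + t) ∂σ := by
  rw [laplace, hT, hσ.integral_stieltjesDensity_mul]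
  have h0 : cutExpSchwartz s hs 0 = 1 := by
    rw [cutExpSchwartz_apply, cutExp_of_ge s (by norm_num)]
    simp
  have hval (t : ℝ) (ht : 0 ≤ t) :
      ∫ r in Ioi (0 : ℝ), (Real.exp (-(r * t)) : ℂ) * cutExpSchwartz s hs r = 1 / (s + t) := by
    have hst : 0 < (s + t).re := by
      simp only [Complex.add_re, Complex.ofReal_re]
      linarith
    have h1 := integral_pow_mul_exp hst 0
    simp only [pow_zero, one_mul, Nat.factorial_zero, Nat.cast_one, zero_add, pow_one] at h1
    rw [← h1]
    refine setIntegral_congr_fun measurableSet_Ioi fun r hr => ?_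
    have hr0 : (0 : ℝ) < r := hr
    rw [cutExpSchwartz_apply, cutExp_of_ge s (by linarith), Complex.ofReal_exp, ← Complex.exp_add]
    congr 1
    push_cast
    ring
  have h1 : ∫ r in Ioi (0 : ℝ), cutExpSchwartz s hs r = 1 / s := by simpa using hval 0 le_rfl
  have h2 : ∫ t, (∫ r in Ioi (0 : ℝ), (Real.exp (-(r * t)) : ℂ) * cutExpSchwartz s hs r) ∂σ =
      ∫ t, 1 / (s + t) ∂σ := by
    refine integral_congr_ae ?_
    filter_upwards [hσ.ae_pos] with t ht using hval t ht.le
  rw [h0, h1, h2]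
  ring

end IsStieltjesMeasure

/-- Stieltjes functions are iterated Laplace transforms. This is the source of every completely
monotone kernel in the proposition. -/
theorem IsStieltjes.exists_distribution {F : ℂ → ℂ} (hF : IsStieltjes F) :
    ∃ T : 𝓢'(ℝ, ℂ), IsCausal T ∧ HasLaplaceTransform T F ∧ HasCompletelyMonotoneDensity T := by
  obtain ⟨a, b, σ, ha, hb, hσ, hF⟩ := hF
  have hσ' := isStieltjesMeasure_restrict hσ
  obtain ⟨T, hT, hTφ⟩ := hσ'.exists_distribution ha b
  exact ⟨T, hT, fun s hs => (hσ'.laplace_eq hTφ hs).trans (hF s hs).symm, b, _, hb,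
    hσ'.isCompletelyMonotone ha, hσ'.integrableOn_stieltjesDensity a, hTφ⟩

theorem HasCompletelyMonotoneDensity.integralPreservesPositivity {T : 𝓢'(ℝ, ℂ)}
    (hT : HasCompletelyMonotoneDensity T) {ψ w : ℝ → ℝ} (h : IsAdmissible ψ w) :
    IntegralPreservesPositivity ψ w T := by
  obtain ⟨b, g, hb, hg, -, hTφ⟩ := hT
  intro u hu t
  have hv (y : ℝ) : 0 ≤ u.rectify y := by
    obtain ⟨t, rfl⟩ := h.surjective y
    rw [WeightedSchwartz.rectify_apply h]
    exact mul_nonneg (by exact_mod_cast (h.weight_pos t).le) (hu t)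
  have hw : (0 : ℂ) ≤ w t := by exact_mod_cast (h.weight_pos t).le
  rw [weylSonineIntegral, div_eq_mul_inv]
  have hwi : (0 : ℂ) ≤ (w t : ℂ)⁻¹ := by
    rw [← Complex.ofReal_inv]
    exact_mod_cast inv_nonneg.2 (h.weight_pos t).le
  refine mul_nonneg ?_ hwi
  rw [convSchwartz, hTφ]
  refine add_nonneg (mul_nonneg (by exact_mod_cast hb) (hv _)) ?_
  refine integral_nonneg_of_ae ?_
  filter_upwards [ae_restrict_mem measurableSet_Ioi] with r hr
  have := hg.2 0 r hr
  simp only [pow_zero, iteratedDeriv_zero, one_mul] at this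
  exact mul_nonneg (by exact_mod_cast this) (hv _)

/-! ### Spectral measures -/

section Spectral

variable {H : Type*} [NormedAddCommGroup H] [InnerProductSpace ℂ H] [CompleteSpace H]

theorem spectrum_subset_Icc {A : H →L[ℂ] H} (hA : A.IsPositive) (h1 : ‖A‖ ≤ 1) :
    spectrum ℝ A ⊆ Icc 0 1 := by
  intro x hx
  have hx0 : 0 ≤ x := spectrum_nonneg_of_nonneg ((A.nonneg_iff_isPositive).2 hA) hx
  refine ⟨hx0, ?_⟩
  have h2 := spectrum.norm_le_norm_mul_of_mem hx
  rw [Real.norm_of_nonneg hx0] at h2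
  have h3 : ‖(1 : H →L[ℂ] H)‖ ≤ 1 := ContinuousLinearMap.norm_id_le
  calc x ≤ ‖A‖ * ‖(1 : H →L[ℂ] H)‖ := h2
    _ ≤ 1 * 1 := by gcongr
    _ = 1 := one_mul 1

/-- The quadratic form of the functional calculus of a positive contraction. -/
def spectralFunctional (A : H →L[ℂ] H) (e : H) :
    CompactlySupportedContinuousMap (Icc (0 : ℝ) 1) ℝ →ₚ[ℝ] ℝ :=
  PositiveLinearMap.mk₀
    { toFun := fun f => (inner ℂ e (cfc (IccExtend zero_le_one f : ℝ → ℝ) A e)).re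
      map_add' := fun f g => by
        have e1 : (IccExtend zero_le_one (f + g : CompactlySupportedContinuousMap (Icc (0 : ℝ) 1) ℝ) : ℝ → ℝ) =
          fun x => (IccExtend zero_le_one f : ℝ → ℝ) x + (IccExtend zero_le_one g : ℝ → ℝ) x := rfl
        have h2 : Continuous (IccExtend zero_le_one f : ℝ → ℝ) := f.continuous.Icc_extend'
        have h3 : Continuous (IccExtend zero_le_one g : ℝ → ℝ) := g.continuous.Icc_extend'
        rw [e1, cfc_add _ _ _ h2.continuousOn h3.continuousOn]
        simp
      map_smul' := fun c f => by
        have e1 : (IccExtend zero_le_one (c • f : CompactlySupportedContinuousMap (Icc (0 : ℝ) 1) ℝ) : ℝ → ℝ) =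
          fun x => c • (IccExtend zero_le_one f : ℝ → ℝ) x := rfl
        have h2 : Continuous (IccExtend zero_le_one f : ℝ → ℝ) := f.continuous.Icc_extend'
        rw [e1, cfc_smul _ _ _ h2.continuousOn]
        simp [inner_smul_right_eq_smul] }
    (fun f hf => by
      have h2 : 0 ≤ cfc (IccExtend zero_le_one f : ℝ → ℝ) A :=
        cfc_nonneg fun x _ => hf (projIcc 0 1 zero_le_one x)
      exact ((ContinuousLinearMap.nonneg_iff_isPositive _).1 h2).re_inner_nonneg_right e)

/-- The scalar spectral measure of A at e: the Riesz–Markov theorem applied to f ↦ ⟨e, f(A)e⟩ on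
C([0,1]). Taking the real part makes the functional real-valued. -/
theorem exists_spectral_measure {A : H →L[ℂ] H} (hA : A.IsPositive) (h1 : ‖A‖ ≤ 1) (e : H) :
    ∃ μ : Measure ℝ, IsFiniteMeasure μ ∧ (∀ᵐ u ∂μ, u ∈ Icc (0 : ℝ) 1) ∧
      ∀ f : ℝ → ℝ, Continuous f → (inner ℂ e (cfc f A e)).re = ∫ u, f u ∂μ := by
  set ν := RealRMK.rieszMeasure (spectralFunctional A e)
  have hν : IsFiniteMeasure ν := inferInstance
  have hmeas : Measurable (Subtype.val : Icc (0 : ℝ) 1 → ℝ) := measurable_subtype_coe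
  refine ⟨ν.map Subtype.val, inferInstance, ?_, fun f hf => ?_⟩
  · refine (ae_map_iff hmeas.aemeasurable (p := fun u => u ∈ Icc (0 : ℝ) 1) measurableSet_Icc).2 ?_
    exact Eventually.of_forall fun x => x.2
  · rw [integral_map hmeas.aemeasurable hf.aestronglyMeasurable]
    let g : CompactlySupportedContinuousMap (Icc (0 : ℝ) 1) ℝ :=
      ⟨⟨fun x => f x, hf.comp continuous_subtype_val⟩, HasCompactSupport.of_compactSpace _⟩
    have h2 := RealRMK.integral_rieszMeasure (spectralFunctional A e) g
    have h3 : ∫ x, f x ∂ν = spectralFunctional A e g := h2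
    rw [h3]
    change _ = (inner ℂ e (cfc (IccExtend zero_le_one g : ℝ → ℝ) A e)).re
    have h4 : cfc f A = cfc (IccExtend zero_le_one g : ℝ → ℝ) A := by
      refine cfc_congr fun x hx => ?_
      rw [IccExtend_of_mem _ _ (spectrum_subset_Icc hA h1 hx)]
      rfl
    rw [h4]

theorem one_sub_mul_pos {z u : ℝ} (hz : z < 1) (hu : u ∈ Icc (0 : ℝ) 1) : 0 < 1 - z * u := by
  rcases le_or_gt z 0 with h | h
  · nlinarith [hu.1]
  · nlinarith [hu.2]

/-- The vector f is any solution of (1 - zA) f = e, so an explicit solution can be inserted without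
constructing the resolvent; the functional calculus shows that it equals (1 - zA)⁻¹ e. The measure
does not depend on z. -/
theorem exists_resolvent_measure {A : H →L[ℂ] H} (hA : A.IsPositive) (h1 : ‖A‖ ≤ 1) (e : H) :
    ∃ μ : Measure ℝ, IsFiniteMeasure μ ∧ (∀ᵐ u ∂μ, u ∈ Icc (0 : ℝ) 1) ∧
      ∀ (z : ℝ) (f : H), z < 1 → f - (z : ℂ) • A f = e →
        (inner ℂ e f).re = ∫ u, 1 / (1 - z * u) ∂μ := by
  obtain ⟨μ, hμ, hμ1, h⟩ := exists_spectral_measure hA h1 e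
  refine ⟨μ, hμ, hμ1, fun z f hz hf => ?_⟩
  -- Projecting onto [0,1] extends u ↦ 1/(1 - zu) continuously to the line, away from the pole.
  set r : ℝ → ℝ := fun u => 1 / (1 - z * (projIcc (0 : ℝ) 1 zero_le_one u : ℝ))
  have hr : Continuous r := by
    refine continuous_const.div ?_ fun u => (one_sub_mul_pos hz (Subtype.coe_prop _)).ne'
    exact continuous_const.sub (continuous_const.mul (continuous_subtype_val.comp continuous_projIcc))
  have hr1 (u : ℝ) (hu : u ∈ Icc (0 : ℝ) 1) : r u = 1 / (1 - z * u) := by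
    simp only [r, projIcc_of_mem _ hu]
  have hsa : IsSelfAdjoint A := hA.isSelfAdjoint
  have hlin : cfc (fun u : ℝ => 1 - z * u) A = 1 - (z : ℝ) • A := by
    rw [cfc_sub (fun _ : ℝ => (1 : ℝ)) (fun u => z * u) A, cfc_const_one ℝ A, cfc_const_mul_id z A]
  have hprod : cfc r A * (1 - (z : ℝ) • A) = 1 := by
    rw [← hlin, ← cfc_mul r (fun u : ℝ => 1 - z * u) A hr.continuousOn]
    rw [← cfc_const_one ℝ A]
    refine cfc_congr fun u hu => ?_
    have hu' := spectrum_subset_Icc hA h1 hu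
    rw [hr1 u hu', one_div, inv_mul_cancel₀ (one_sub_mul_pos hz hu').ne']
  have hf' : f = cfc r A e := by
    have h3 : (1 - (z : ℝ) • A) f = e := by
      rw [← hf]
      simp
    rw [← h3, ← mul_apply_eq_comp, hprod, one_apply_eq_self]
  rw [hf', h r hr]
  refine integral_congr_ae ?_
  filter_upwards [hμ1] with u hu using hr1 u hu

end Spectral

/-! ### Multiplication operators -/

section Mul

variable {Ω : Type*} [MeasurableSpace Ω] {μ : Measure Ω}

theorem memLp_mul_of_bounded {q : Ω → ℂ} (hq : Measurable q) {C : ℝ} (hC : ∀ x, ‖q x‖ ≤ C)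
    {f : Ω → ℂ} (hf : MemLp f 2 μ) : MemLp (fun x => q x * f x) 2 μ :=
  hf.of_le_mul (hq.aestronglyMeasurable.mul hf.1) (c := C)
    (Eventually.of_forall fun x => by rw [norm_mul]; gcongr; exact hC x)

/-- Multiplication by a bounded measurable function, as an operator on `L²`. -/
def mulOp (μ : Measure Ω) (q : Ω → ℂ) (hq : Measurable q) (C : ℝ) (hC : ∀ x, ‖q x‖ ≤ C) :
    Lp ℂ 2 μ →L[ℂ] Lp ℂ 2 μ :=
  LinearMap.mkContinuous
    { toFun := fun f => (memLp_mul_of_bounded hq hC (Lp.memLp f)).toLp _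
      map_add' := fun f g => by
        rw [← MemLp.toLp_add]
        refine MemLp.toLp_congr _ _ ?_
        filter_upwards [Lp.coeFn_add f g] with x hx
        rw [Pi.add_apply, hx, Pi.add_apply, mul_add]
      map_smul' := fun c f => by
        rw [RingHom.id_apply, ← MemLp.toLp_const_smul]
        refine MemLp.toLp_congr _ _ ?_
        filter_upwards [Lp.coeFn_smul c f] with x hx
        rw [hx, Pi.smul_apply, Pi.smul_apply, smul_eq_mul, smul_eq_mul, mul_left_comm] }
    C fun f => by
      refine Lp.norm_le_mul_norm_of_ae_le_mul ?_
      filter_upwards [(memLp_mul_of_bounded hq hC (Lp.memLp f)).coeFn_toLp] with x hx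
      change ‖((memLp_mul_of_bounded hq hC (Lp.memLp f)).toLp _ : Ω → ℂ) x‖ ≤ _
      rw [hx, norm_mul]
      gcongr
      exact hC x

theorem coeFn_mulOp {q : Ω → ℂ} (hq : Measurable q) {C : ℝ} (hC : ∀ x, ‖q x‖ ≤ C)
    (f : Lp ℂ 2 μ) : mulOp μ q hq C hC f =ᵐ[μ] fun x => q x * f x :=
  (memLp_mul_of_bounded hq hC (Lp.memLp f)).coeFn_toLp

theorem norm_mulOp_le {q : Ω → ℂ} (hq : Measurable q) {C : ℝ} (hC : ∀ x, ‖q x‖ ≤ C) (h0 : 0 ≤ C) :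
    ‖mulOp μ q hq C hC‖ ≤ C :=
  LinearMap.mkContinuous_norm_le _ h0 _

theorem integrable_conj_mul (f g : Lp ℂ 2 μ) :
    Integrable (fun x => (starRingEnd ℂ) (f x) * g x) μ := by
  refine (L2.integrable_inner (𝕜 := ℂ) f g).congr (Eventually.of_forall fun x => ?_)
  simp [mul_comm]

theorem inner_eq_integral (f g : Lp ℂ 2 μ) :
    inner ℂ f g = ∫ x, (starRingEnd ℂ) (f x) * g x ∂μ := by
  rw [L2.inner_def]
  refine integral_congr_ae (Eventually.of_forall fun x => ?_)
  simp [mul_comm]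

theorem norm_sq_eq_integral (f : Lp ℂ 2 μ) : ‖f‖ ^ 2 = ∫ x, ‖f x‖ ^ 2 ∂μ := by
  have h := inner_self_eq_norm_sq_to_K (𝕜 := ℂ) f
  rw [inner_eq_integral] at h
  have h2 : ∫ x, (starRingEnd ℂ) (f x) * f x ∂μ = ((∫ x, ‖f x‖ ^ 2 ∂μ : ℝ) : ℂ) := by
    rw [← integral_complex_ofReal]
    refine integral_congr_ae (Eventually.of_forall fun x => ?_)
    simp [Complex.conj_mul']
  rw [h2] at h
  have h3 : ((∫ x, ‖f x‖ ^ 2 ∂μ : ℝ) : ℂ) = ((‖f‖ ^ 2 : ℝ) : ℂ) := by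
    rw [h]; simp
  exact_mod_cast h3.symm

theorem integrable_norm_sq (f : Lp ℂ 2 μ) : Integrable (fun x => ‖f x‖ ^ 2) μ :=
  (memLp_two_iff_integrable_sq_norm (Lp.memLp f).1).1 (Lp.memLp f)

end Mul

/-! ### Reciprocals of complete Bernstein functions -/

section Renewal

variable {Ω : Type*} [MeasurableSpace Ω] (ρ : Measure Ω) [IsFiniteMeasure ρ]

/-- The constant function `1` as an element of `L²`. -/
def oneL2 : Lp ℂ 2 ρ := (memLp_const (1 : ℂ)).toLp _

theorem coeFn_oneL2 : oneL2 ρ =ᵐ[ρ] fun _ => (1 : ℂ) := MemLp.coeFn_toLp _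

/-- Cauchy–Schwarz with the weights (1 - u) + u = 1. Integrated against ρ, it is the contraction
estimate for `renewalOp`. -/
theorem renewal_pointwise {u : ℝ} (h0 : 0 ≤ u) (h1 : u < 1) (α φ : ℂ) :
    ‖α + (√u : ℂ) * φ‖ ^ 2 ≤ ‖α‖ ^ 2 * (1 / (1 - u)) + ‖φ‖ ^ 2 := by
  have h2 : ‖α + (√u : ℂ) * φ‖ ≤ ‖α‖ + √u * ‖φ‖ := by
    refine (norm_add_le _ _).trans_eq ?_
    rw [norm_mul, Complex.norm_real, Real.norm_of_nonneg (Real.sqrt_nonneg u)]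
  have h3 : 0 < 1 - u := sub_pos.2 h1
  have h4 := Real.sq_sqrt h0
  calc ‖α + (√u : ℂ) * φ‖ ^ 2 ≤ (‖α‖ + √u * ‖φ‖) ^ 2 := by gcongr
    _ ≤ _ := by
      rw [mul_one_div, ← sub_le_iff_le_add, le_div_iff₀ h3]
      generalize √u = r at h4
      subst h4
      linarith [sq_nonneg (r * ‖α‖ - (1 - r ^ 2) * ‖φ‖)]

theorem norm_sqrt_le_one {u : ℝ} (h1 : u < 1) : ‖(√u : ℂ)‖ ≤ 1 := by
  rw [Complex.norm_real, Real.norm_of_nonneg (Real.sqrt_nonneg u)]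
  exact Real.sqrt_le_one.2 h1.le

variable {U : Ω → ℝ} (hU : Measurable U) (h1 : ∀ x, U x < 1)

/-- The operator `(α, φ) ↦ α + √U φ` from `ℂ ⊕ L²` to `L²`. -/
def renewalOp : WithLp 2 (ℂ × Lp ℂ 2 ρ) →L[ℂ] Lp ℂ 2 ρ :=
  ((ContinuousLinearMap.toSpanSingleton ℂ (oneL2 ρ)).coprod
    (mulOp ρ (fun x => (√(U x) : ℂ)) (by fun_prop) 1 fun x => norm_sqrt_le_one (h1 x))).comp
    (WithLp.prodContinuousLinearEquiv 2 ℂ ℂ (Lp ℂ 2 ρ)).toContinuousLinearMap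

theorem renewalOp_apply (v : WithLp 2 (ℂ × Lp ℂ 2 ρ)) :
    renewalOp ρ hU h1 v = v.fst • oneL2 ρ +
      mulOp ρ (fun x => (√(U x) : ℂ)) (by fun_prop) 1 (fun x => norm_sqrt_le_one (h1 x)) v.snd :=
  rfl

theorem norm_renewalOp_le (h0 : ∀ x, 0 ≤ U x) (hint : Integrable (fun x => 1 / (1 - U x)) ρ)
    (hle : ∫ x, 1 / (1 - U x) ∂ρ ≤ 1) : ‖renewalOp ρ hU h1‖ ≤ 1 := by
  refine ContinuousLinearMap.opNorm_le_bound _ zero_le_one fun v => ?_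
  rw [one_mul]
  refine le_of_sq_le_sq ?_ (norm_nonneg _)
  rw [norm_sq_eq_integral, WithLp.prod_norm_sq_eq_of_L2, norm_sq_eq_integral]
  calc ∫ x, ‖renewalOp ρ hU h1 v x‖ ^ 2 ∂ρ
      ≤ ∫ x, (‖v.fst‖ ^ 2 * (1 / (1 - U x)) + ‖v.snd x‖ ^ 2) ∂ρ := by
        refine integral_mono_ae (integrable_norm_sq _)
          ((hint.const_mul _).add (integrable_norm_sq _)) ?_
        rw [renewalOp_apply]
        filter_upwards [Lp.coeFn_add (v.fst • oneL2 ρ) (mulOp ρ (fun x => (√(U x) : ℂ))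
            (by fun_prop) 1 (fun x => norm_sqrt_le_one (h1 x)) v.snd),
          Lp.coeFn_smul v.fst (oneL2 ρ), coeFn_oneL2 ρ,
          coeFn_mulOp (μ := ρ) (q := fun x => (√(U x) : ℂ)) (by fun_prop)
            (fun x => norm_sqrt_le_one (h1 x)) v.snd] with x e1 e2 e3 e4
        rw [e1, Pi.add_apply, e2, Pi.smul_apply, e3, e4, smul_eq_mul, mul_one]
        exact renewal_pointwise (h0 x) (h1 x) _ _
    _ = ‖v.fst‖ ^ 2 * ∫ x, 1 / (1 - U x) ∂ρ + ∫ x, ‖v.snd x‖ ^ 2 ∂ρ := by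
        rw [integral_add (hint.const_mul _) (integrable_norm_sq _), integral_const_mul]
    _ ≤ ‖v.fst‖ ^ 2 + ∫ x, ‖v.snd x‖ ^ 2 ∂ρ := by
        gcongr
        exact mul_le_of_le_one_right (by positivity) hle

/-- The reciprocal of `1 - z ∫ ρ(dx) / (1 - z U(x))` is again of the form
`∫ μ(du) / (1 - z u)`. -/
theorem exists_renewal_measure {U : Ω → ℝ} (hU : Measurable U) (h1 : ∀ x, U x < 1) (h0 : ∀ x, 0 ≤ U x)
    (hint : Integrable (fun x => 1 / (1 - U x)) ρ) (hle : ∫ x, 1 / (1 - U x) ∂ρ ≤ 1) :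
    ∃ μ : Measure ℝ, IsFiniteMeasure μ ∧ (∀ᵐ u ∂μ, u ∈ Icc (0 : ℝ) 1) ∧
      ∀ z : ℝ, z < 1 → 1 - z * ∫ x, 1 / (1 - z * U x) ∂ρ ≠ 0 →
        (1 - z * ∫ x, 1 / (1 - z * U x) ∂ρ)⁻¹ = ∫ u, 1 / (1 - z * u) ∂μ := by
  -- The operator A = B*B acts on ℂ ⊕ L²(ρ) as a 2 × 2 block whose lower corner is multiplication by
  -- U. The target reciprocal is the upper corner of (1 - zA)⁻¹, by the Schur complement.
  set B := renewalOp ρ hU h1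
  have hB : ‖B‖ ≤ 1 := norm_renewalOp_le ρ hU h1 h0 hint hle
  have hA : (B.adjoint.comp B).IsPositive := ContinuousLinearMap.isPositive_adjoint_comp_self B
  have hA1 : ‖B.adjoint.comp B‖ ≤ 1 := by
    rw [ContinuousLinearMap.norm_adjoint_comp_self]
    exact mul_le_one₀ hB (norm_nonneg _) hB
  obtain ⟨μ, hμ, hμ1, h⟩ := exists_resolvent_measure hA hA1 (WithLp.toLp 2 (1, 0))
  refine ⟨μ, hμ, hμ1, fun z hz hP => ?_⟩
  set P := ∫ x, 1 / (1 - z * U x) ∂ρ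
  set s := mulOp ρ (fun x => (√(U x) : ℂ)) (by fun_prop) 1 fun x => norm_sqrt_le_one (h1 x)
  have hmem (x : Ω) : U x ∈ Icc (0 : ℝ) 1 := ⟨h0 x, (h1 x).le⟩
  have hr (x : Ω) : ‖((1 / (1 - z * U x) : ℝ) : ℂ)‖ ≤ 1 + 1 / (1 - z) := by
    have h3 := one_sub_mul_pos hz (hmem x)
    have h4 : 0 < 1 - z := by linarith
    rw [Complex.norm_real, Real.norm_of_nonneg (by positivity)]
    rcases le_or_gt z 0 with h5 | h5
    · have h6 : 1 / (1 - z * U x) ≤ 1 := by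
        rw [div_le_one h3]
        nlinarith [h0 x]
      have : 0 ≤ 1 / (1 - z) := by positivity
      linarith
    · have h6 : 1 / (1 - z * U x) ≤ 1 / (1 - z) := by
        refine one_div_le_one_div_of_le h4 ?_
        nlinarith [h1 x]
      linarith
  set R := mulOp ρ (fun x => ((1 / (1 - z * U x) : ℝ) : ℂ)) (by fun_prop) _ hr (oneL2 ρ)
  have hRx : R =ᵐ[ρ] fun x => ((1 / (1 - z * U x) : ℝ) : ℂ) := by
    filter_upwards [coeFn_mulOp (μ := ρ) (q := fun x => ((1 / (1 - z * U x) : ℝ) : ℂ))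
      (by fun_prop) hr (oneL2 ρ), coeFn_oneL2 ρ] with x e1 e2
    rw [e1, e2, mul_one]
  have hs (g : Lp ℂ 2 ρ) : s g =ᵐ[ρ] fun x => (√(U x) : ℂ) * g x :=
    coeFn_mulOp (μ := ρ) (by fun_prop) _ g
  have hRes : oneL2 ρ + (z : ℂ) • s (s R) = R := by
    refine Lp.ext ?_
    filter_upwards [Lp.coeFn_add (oneL2 ρ) ((z : ℂ) • s (s R)), Lp.coeFn_smul (z : ℂ) (s (s R)),
      coeFn_oneL2 ρ, hs (s R), hs R, hRx] with x e1 e2 e3 e4 e5 e6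
    rw [e1, Pi.add_apply, e2, Pi.smul_apply, e3, e4, e5, e6, smul_eq_mul, ← mul_assoc (√(U x) : ℂ)]
    have h7 : (√(U x) : ℂ) * √(U x) = U x := by exact_mod_cast Real.mul_self_sqrt (h0 x)
    rw [h7]
    have h8 := (one_sub_mul_pos hz (hmem x)).ne'
    norm_cast
    field_simp
    ring
  have hsa (f g : Lp ℂ 2 ρ) : inner ℂ (s f) g = inner ℂ f (s g) := by
    rw [inner_eq_integral, inner_eq_integral]
    refine integral_congr_ae ?_
    filter_upwards [hs f, hs g] with x e1 e2
    rw [e1, e2, map_mul, Complex.conj_ofReal]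
    ring
  have hone : inner ℂ (oneL2 ρ) R = (P : ℂ) := by
    rw [inner_eq_integral, ← integral_complex_ofReal]
    refine integral_congr_ae ?_
    filter_upwards [coeFn_oneL2 ρ, hRx] with x e1 e2
    rw [e1, e2, map_one, one_mul]
  -- With R = 1/(1 - zU), the vector f = (α, zα√U R) satisfies Bf = αR, hence (1 - zB*B) f = (α(1 -
  -- zP), 0) = (1, 0), and ⟨(1,0), f⟩ = α.
  set α : ℂ := ((1 - z * P : ℝ) : ℂ)⁻¹
  have hα : α - z * α * P = 1 := by
    have : ((1 - z * P : ℝ) : ℂ) ≠ 0 := by exact_mod_cast hP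
    have h9 : α * ((1 - z * P : ℝ) : ℂ) = 1 := inv_mul_cancel₀ this
    rw [← h9]
    push_cast
    ring
  have hBf : B (WithLp.toLp 2 (α, (z * α) • s R)) = α • R := by
    rw [renewalOp_apply]
    change α • oneL2 ρ + s ((z * α) • s R) = _
    rw [← hRes, smul_add, map_smul, hRes, smul_smul, mul_comm (z : ℂ)]
  have key := h z (WithLp.toLp 2 (α, (z * α) • s R)) hz ?_
  · rw [← key, WithLp.prod_inner_apply]
    change _ = (inner ℂ (1 : ℂ) α + inner ℂ (0 : Lp ℂ 2 ρ) ((z * α) • s R)).re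
    rw [inner_zero_left, add_zero]
    simp only [RCLike.inner_apply, map_one, mul_one, α]
    rw [← Complex.ofReal_inv, Complex.ofReal_re]
  · refine ext_inner_left ℂ fun v => ?_
    rw [inner_sub_right, inner_smul_right, ContinuousLinearMap.comp_apply,
      ContinuousLinearMap.adjoint_inner_right, hBf, renewalOp_apply, WithLp.prod_inner_apply,
      WithLp.prod_inner_apply]
    change inner ℂ v.fst α + inner ℂ v.snd ((z * α) • s R) -
      z * inner ℂ (v.fst • oneL2 ρ + s v.snd) (α • R) = inner ℂ v.fst 1 + inner ℂ v.snd 0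
    rw [inner_smul_right, inner_smul_right, inner_add_left, inner_smul_left, hsa, hone,
      inner_zero_right]
    simp only [RCLike.inner_apply]
    linear_combination (starRingEnd ℂ v.fst) * hα

end Renewal

/-! ### Stieltjes and complete Bernstein functions in the right half-plane. -/

theorem norm_add_ofReal_ge {s : ℂ} {t : ℝ} : s.re + t ≤ ‖s + t‖ := by
  have := Complex.re_le_norm (s + t)
  simpa using this

theorem one_div_add_le {δ t : ℝ} (hδ : 0 < δ) (ht : 0 < t) :
    1 / (δ + t) ≤ (1 + 1 / δ) * (1 / (1 + t)) := by
  rw [mul_one_div, div_le_div_iff₀ (by positivity) (by positivity)]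
  have : (1 + 1 / δ) * (δ + t) = 1 + t + (δ + t / δ) := by field_simp; ring
  rw [this]
  have : 0 ≤ δ + t / δ := by positivity
  linarith

theorem norm_one_div_add_le {s : ℂ} {δ t : ℝ} (hδ : 0 < δ) (hs : δ ≤ s.re) (ht : 0 < t) :
    ‖1 / (s + t)‖ ≤ (1 + 1 / δ) * (1 / (1 + t)) := by
  rw [norm_div, norm_one]
  refine le_trans ?_ (one_div_add_le hδ ht)
  refine one_div_le_one_div_of_le (by positivity) ?_
  have := norm_add_ofReal_ge (s := s) (t := t)
  linarith

namespace IsStieltjesMeasure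

variable {σ : Measure ℝ}

theorem integrable_one_div_add (hσ : IsStieltjesMeasure σ) {s : ℂ} (hs : 0 < s.re) :
    Integrable (fun t : ℝ => 1 / (s + t)) σ :=
  hσ.integrable_of_norm_le (Measurable.aestronglyMeasurable (by fun_prop)) fun _ ht =>
    norm_one_div_add_le hs le_rfl ht

theorem differentiableAt_stieltjes (hσ : IsStieltjesMeasure σ) {s : ℂ} (hs : 0 < s.re) :
    DifferentiableAt ℂ (fun s : ℂ => ∫ t, 1 / (s + t) ∂σ) s := by
  set δ := s.re / 2
  have hδ : 0 < δ := by positivity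
  have hopen : IsOpen {z : ℂ | δ < z.re} := isOpen_lt continuous_const Complex.continuous_re
  refine (hasDerivAt_integral_of_dominated_loc_of_deriv_le (s := {z : ℂ | δ < z.re})
    (F := fun s t => 1 / (s + (t : ℂ)))
    (F' := fun s t => -1 / (s + (t : ℂ)) ^ 2)
    (bound := fun t => (1 / δ) * ((1 + 1 / δ) * (1 / (1 + t))))
    (hopen.mem_nhds (show δ < s.re from half_lt_self hs)) ?_ (hσ.integrable_one_div_add hs) ?_ ?_
    ((hσ.integrable.const_mul _).const_mul _) ?_).2.differentiableAt
  · exact Eventually.of_forall fun z => Measurable.aestronglyMeasurable (by fun_prop)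
  · exact Measurable.aestronglyMeasurable (by fun_prop)
  · filter_upwards [hσ.ae_pos] with t ht z hz
    have h1 := norm_one_div_add_le hδ (le_of_lt hz) ht
    have h2 : ‖1 / (z + t)‖ ≤ 1 / δ := by
      rw [norm_div, norm_one]
      refine one_div_le_one_div_of_le hδ ?_
      have := norm_add_ofReal_ge (s := z) (t := t)
      have : δ < z.re := hz
      linarith
    have h3 : -1 / (z + t) ^ 2 = -((1 / (z + t)) * (1 / (z + t))) := by
      rw [div_mul_div_comm, one_mul, pow_two, neg_div]
    rw [h3, norm_neg, norm_mul]
    exact mul_le_mul h2 h1 (norm_nonneg _) (by positivity)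
  · filter_upwards [hσ.ae_pos] with t ht z hz
    have hz0 : z + t ≠ 0 := by
      intro h
      have h1 := congrArg Complex.re h
      have : δ < z.re := hz
      simp only [Complex.add_re, Complex.ofReal_re, Complex.zero_re] at h1
      linarith
    simp only [one_div]
    exact ((hasDerivAt_id z).add_const (t : ℂ)).inv hz0

end IsStieltjesMeasure

/-- The complete Bernstein function with characteristics `a`, `b`, `σ`. -/
def bernstein (a b : ℝ) (σ : Measure ℝ) (s : ℂ) : ℂ := a + b * s + ∫ t, s / (s + t) ∂σ

theorem div_add_eq_mul (s : ℂ) (t : ℝ) : s / (s + t) = s * (1 / (s + t)) := by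
  rw [mul_one_div]

theorem bernstein_eq_mul {a b : ℝ} {σ : Measure ℝ} {s : ℂ} (hs : s ≠ 0) :
    bernstein a b σ s = s * (a / s + b + ∫ t, 1 / (s + t) ∂σ) := by
  simp only [bernstein, div_add_eq_mul]
  rw [integral_const_mul]
  field_simp

theorem re_div_add_pos {s : ℂ} (hs : 0 < s.re) {t : ℝ} (ht : 0 < t) : 0 < (s / (s + t)).re := by
  have h0 : s + t ≠ 0 := ne_zero_of_re_pos (by simp; linarith)
  have h1 : 0 < Complex.normSq (s + t) := Complex.normSq_pos.2 h0
  rw [Complex.div_re, ← add_div]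
  refine div_pos ?_ h1
  simp only [Complex.add_re, Complex.ofReal_re, Complex.add_im, Complex.ofReal_im, add_zero]
  nlinarith [mul_pos hs ht, mul_self_nonneg s.im, mul_pos hs hs]

/-- Each of the summands a, b s, s/(s + t) has non-negative real part, the last a strictly positive
one. If the sum has real part 0, all characteristics vanish and the function is identically 0. Thus
Ψ has no zeros. -/
theorem re_bernstein_pos {a b : ℝ} (ha : 0 ≤ a) (hb : 0 ≤ b) {σ : Measure ℝ}
    (hσ : IsStieltjesMeasure σ) {s₀ : ℂ} (hne : bernstein a b σ s₀ ≠ 0) {s : ℂ} (hs : 0 < s.re) :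
    0 < (bernstein a b σ s).re := by
  have hint : Integrable (fun t : ℝ => s / (s + t)) σ := by
    simp only [div_add_eq_mul]
    exact (hσ.integrable_one_div_add hs).const_mul s
  have h1 : (∫ t, s / (s + t) ∂σ).re = ∫ t : ℝ, (s / (s + t)).re ∂σ :=
    (integral_re hint).symm
  have h2 : (bernstein a b σ s).re = a + b * s.re + ∫ t : ℝ, (s / (s + t)).re ∂σ := by
    rw [bernstein, Complex.add_re, h1]
    simp
  have hpos : ∀ᵐ t ∂σ, 0 < (s / (s + (t : ℝ))).re := by
    filter_upwards [hσ.ae_pos] with t ht using re_div_add_pos hs ht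
  have h3 : 0 ≤ ∫ t : ℝ, (s / (s + t)).re ∂σ :=
    integral_nonneg_of_ae (hpos.mono fun t ht => ht.le)
  have h4 : 0 ≤ b * s.re := by positivity
  refine lt_of_le_of_ne (by rw [h2]; positivity) fun h => hne ?_
  rw [h2] at h
  have ha0 : a = 0 := by linarith
  have hb0 : b = 0 := by
    have : b * s.re = 0 := by linarith
    exact (mul_eq_zero.1 this).resolve_right hs.ne'
  have h5 : ∫ t : ℝ, (s / (s + t)).re ∂σ = 0 := by linarith
  have h6 := (integral_eq_zero_iff_of_nonneg_ae (hpos.mono fun t ht => ht.le) hint.re).1 h5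
  have h7 : σ = 0 := by
    rw [← ae_eq_bot, ← Filter.eventually_false_iff_eq_bot]
    filter_upwards [hpos, h6] with t e1 e2
    exact e1.ne' e2
  simp [bernstein, ha0, hb0, h7]

/-! The real form of a complete Bernstein function. -/

theorem bernstein_ofReal (a b : ℝ) (σ : Measure ℝ) (x : ℝ) :
    bernstein a b σ x = ((a + b * x + ∫ t, x / (x + t) ∂σ : ℝ) : ℂ) := by
  rw [bernstein, Complex.ofReal_add, ← integral_complex_ofReal]
  push_cast
  rfl

/-- Normalized by c = Ψ(1) and written in z = 1 - x, a complete Bernstein function has the form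
required by `exists_renewal_measure`. The identity behind it is 1/(1+t) - x/(x+t) = (1 - x) ·
t/((1+t)(x+t)). -/
theorem exists_renewal_of_bernstein {a b : ℝ} (ha : 0 ≤ a) (hb : 0 ≤ b) {σ : Measure ℝ}
    (hσ : IsStieltjesMeasure σ) {s₀ : ℂ} (hne : bernstein a b σ s₀ ≠ 0) :
    ∃ (c : ℝ) (μ : Measure ℝ), 0 < c ∧ IsFiniteMeasure μ ∧ (∀ᵐ u ∂μ, u ∈ Icc (0 : ℝ) 1) ∧
      ∀ x : ℝ, 0 < x → c / (a + b * x + ∫ t, x / (x + t) ∂σ) = ∫ u, 1 / (1 - (1 - x) * u) ∂μ := by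
  have hpos (x : ℝ) (hx : 0 < x) : 0 < a + b * x + ∫ t, x / (x + t) ∂σ := by
    have := re_bernstein_pos ha hb hσ hne (s := x) (by simpa using hx)
    rwa [bernstein_ofReal, Complex.ofReal_re] at this
  have hintx (x : ℝ) (hx : 0 < x) : Integrable (fun t => x / (x + t)) σ := by
    refine hσ.integrable_of_norm_le (C := x * (1 + 1 / x)) (Measurable.aestronglyMeasurable
      (by fun_prop)) fun t ht => ?_
    rw [Real.norm_of_nonneg (by positivity), mul_assoc, ← mul_one_div]
    exact mul_le_mul_of_nonneg_left (one_div_add_le hx ht) hx.le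
  set c := a + b * 1 + ∫ t, 1 / (1 + t) ∂σ
  have hc : 0 < c := hpos 1 one_pos
  -- This density is chosen so that d(t)/(1 - zU(t)) = t/((1+t)(x+t)) for U(t) = 1/(1+t) and z = 1 -
  -- x; it also makes the weighted measure finite.
  set d : ℝ → ENNReal := fun t => ENNReal.ofReal (t / (1 + t) ^ 2)
  have hd : Measurable d := by fun_prop
  have hfin : IsFiniteMeasure (σ.withDensity d) := by
    refine isFiniteMeasure_withDensity_ofReal ?_
    refine (hσ.integrable_of_norm_le (C := 1) (Measurable.aestronglyMeasurable
      (by fun_prop)) fun t ht => ?_).2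
    rw [Real.norm_of_nonneg (by positivity), one_mul, div_le_div_iff₀ (by positivity) (by positivity)]
    nlinarith
  set ρ := ENNReal.ofReal c⁻¹ • (ENNReal.ofReal b • Measure.dirac (0 : ℝ) + σ.withDensity d)
  have hρ : IsFiniteMeasure ρ := by
    have : IsFiniteMeasure (ENNReal.ofReal b • Measure.dirac (0 : ℝ)) :=
      Measure.smul_finite _ ENNReal.ofReal_ne_top
    exact Measure.smul_finite _ ENNReal.ofReal_ne_top
  -- The value 0 at t = 0 lets the atom b δ₀ reproduce the linear term b s; extending it to negative
  -- t keeps 0 ≤ U < 1 everywhere.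
  set U : ℝ → ℝ := fun t => if t ≤ 0 then 0 else 1 / (1 + t)
  have hU : Measurable U :=
    Measurable.ite measurableSet_Iic measurable_const (by fun_prop)
  have hU0 (t : ℝ) : 0 ≤ U t := by
    simp only [U]
    split_ifs with h
    · exact le_rfl
    · push Not at h
      positivity
  have hU1 (t : ℝ) : U t < 1 := by
    simp only [U]
    split_ifs with h
    · exact one_pos
    · push Not at h
      rw [div_lt_one (by positivity)]
      linarith
  have hkey (z : ℝ) (h : Integrable (fun t => t / ((1 + t) * (1 - z + t))) σ) (hz : z ≤ 1) :
      Integrable (fun t => 1 / (1 - z * U t)) ρ ∧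
        ∫ t, 1 / (1 - z * U t) ∂ρ = c⁻¹ * (b + ∫ t, t / ((1 + t) * (1 - z + t)) ∂σ) := by
    have hm : Measurable fun t => 1 / (1 - z * U t) := by fun_prop
    have hae : (fun t => (d t).toReal • (1 / (1 - z * U t))) =ᵐ[σ]
        fun t => t / ((1 + t) * (1 - z + t)) := by
      filter_upwards [hσ.ae_pos] with t ht
      have h1 : U t = 1 / (1 + t) := if_neg (not_le.2 ht)
      have h2 : 0 < 1 - z + t := by linarith
      have h3 : 1 - z * (1 / (1 + t)) = (1 - z + t) / (1 + t) := by
        field_simp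
        ring
      rw [h1, h3, ENNReal.toReal_ofReal (by positivity), smul_eq_mul]
      field_simp
    have i1 : Integrable (fun t => 1 / (1 - z * U t)) (σ.withDensity d) := by
      rw [integrable_withDensity_iff_integrable_smul' hd (by simp [d])]
      exact h.congr hae.symm
    have i2 : Integrable (fun t => 1 / (1 - z * U t)) (ENNReal.ofReal b • Measure.dirac (0 : ℝ)) :=
      (integrable_dirac (by simp)).smul_measure ENNReal.ofReal_ne_top
    refine ⟨(i2.add_measure i1).smul_measure ENNReal.ofReal_ne_top, ?_⟩
    rw [integral_smul_measure, integral_add_measure i2 i1, integral_smul_measure, integral_dirac,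
      integral_withDensity_eq_integral_toReal_smul hd (by simp [d]), integral_congr_ae hae,
      ENNReal.toReal_ofReal hb, ENNReal.toReal_ofReal (by positivity)]
    simp [U]
  obtain ⟨i0, e0⟩ := hkey 1 (hσ.integrable.congr (by
    filter_upwards [hσ.ae_pos] with t ht
    field_simp
    ring)) le_rfl
  have e1 : ∫ t, t / ((1 + t) * (1 - 1 + t)) ∂σ = ∫ t, 1 / (1 + t) ∂σ := by
    refine integral_congr_ae ?_
    filter_upwards [hσ.ae_pos] with t ht
    field_simp
    ring
  simp only [one_mul] at i0 e0
  -- The contraction condition reads (b + ∫ σ(dt)/(1+t))/c ≤ 1, and the left side equals (c - a)/c.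
  obtain ⟨μ, hμ, hμ1, h⟩ := exists_renewal_measure ρ hU hU1 hU0 i0 (by
    rw [e0, e1, inv_mul_le_iff₀ hc]
    simp only [c]
    linarith)
  refine ⟨c, μ, hc, hμ, hμ1, fun x hx => ?_⟩
  have hae (x : ℝ) (hx : 0 < x) : (fun t => (1 - x) * (t / ((1 + t) * (1 - (1 - x) + t)))) =ᵐ[σ]
      fun t => 1 / (1 + t) - x / (x + t) := by
    filter_upwards [hσ.ae_pos] with t ht
    have : 1 - (1 - x) + t = x + t := by ring
    rw [this]
    field_simp
    ring
  obtain ⟨-, e2⟩ := hkey (1 - x) (by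
    have : (fun t => t / ((1 + t) * (1 - (1 - x) + t))) =
        fun t => t / ((1 + t) * (x + t)) := by
      funext t; ring_nf
    rw [this]
    refine hσ.integrable_of_norm_le (C := 1) (Measurable.aestronglyMeasurable
      (by fun_prop)) fun t ht => ?_
    rw [Real.norm_of_nonneg (by positivity), one_mul, div_le_div_iff₀ (by positivity) (by positivity)]
    nlinarith [mul_pos hx ht]) (by linarith)
  have e3 : (1 - x) * ∫ t, t / ((1 + t) * (1 - (1 - x) + t)) ∂σ =
      (∫ t, 1 / (1 + t) ∂σ) - ∫ t, x / (x + t) ∂σ := by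
    rw [← integral_const_mul, integral_congr_ae (hae x hx),
      integral_sub hσ.integrable (hintx x hx)]
  have e4 : 1 - (1 - x) * ∫ t, 1 / (1 - (1 - x) * U t) ∂ρ =
      c⁻¹ * (a + b * x + ∫ t, x / (x + t) ∂σ) := by
    have e5 : c⁻¹ * c = 1 := inv_mul_cancel₀ hc.ne'
    have e6 : c = a + b * 1 + ∫ t, 1 / (1 + t) ∂σ := rfl
    rw [e2]
    linear_combination -c⁻¹ * e3 - e5 + c⁻¹ * e6
  have h5 := h (1 - x) (by linarith) (by
    rw [e4]
    exact mul_ne_zero (inv_ne_zero hc.ne') (hpos x hx).ne')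
  rw [← h5, e4, mul_inv, inv_inv, div_eq_mul_inv]

/-! ### From measures on [0,1] to Stieltjes functions; analytic continuation. -/

theorem one_sub_add_mul_ne_zero {s : ℂ} (hs : 0 < s.re) {u : ℝ} (hu : u ∈ Icc (0 : ℝ) 1) :
    1 - (1 - s) * u ≠ 0 := by
  intro h
  have h1 := congrArg Complex.re h
  simp at h1
  rcases hu.1.eq_or_lt with h0 | h0
  · rw [← h0] at h1
    simp at h1
  · nlinarith [hu.2, mul_pos hs h0]

/-- The functions `∫ μ(du) / (1 - (1 - s) u)`, with a finite measure on `[0, 1]`, are Stieltjes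
functions. -/
theorem isStieltjes_of_measure_Icc {μ : Measure ℝ} [IsFiniteMeasure μ]
    (hμ : ∀ᵐ u ∂μ, u ∈ Icc (0 : ℝ) 1) : IsStieltjes fun s => ∫ u : ℝ, 1 / (1 - (1 - s) * u) ∂μ := by
  set d : ℝ → ENNReal := fun u => ENNReal.ofReal (1 / u)
  have hd : Measurable d := by fun_prop
  -- For 0 < u < 1 and t = (1 - u)/u one has 1 - (1 - s)u = u(s + t), which also explains the
  -- density 1/u.
  set T : ℝ → ℝ := fun u => (1 - u) / u
  have hT : Measurable T := by fun_prop
  set ν := (μ.restrict (Ioo 0 1)).withDensity d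
  have hνpos : ∀ᵐ t ∂ν.map T, t ∈ Ioi (0 : ℝ) := by
    refine (ae_map_iff hT.aemeasurable (p := fun t => t ∈ Ioi (0 : ℝ)) measurableSet_Ioi).2 ?_
    refine (withDensity_absolutelyContinuous _ _).ae_le ?_
    filter_upwards [ae_restrict_mem measurableSet_Ioo] with u hu
    exact div_pos (sub_pos.2 hu.2) hu.1
  have hres : (ν.map T).restrict (Ioi 0) = ν.map T := Measure.restrict_eq_self_of_ae_mem hνpos
  -- The endpoint u = 1 contributes 1/s and the endpoint u = 0 a constant.
  refine ⟨μ.real {1}, μ.real {0}, ν.map T, by positivity, by positivity, ?_, fun s hs => ?_⟩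
  · rw [hres, lintegral_map (by fun_prop) hT, lintegral_withDensity_eq_lintegral_mul _ hd (by fun_prop)]
    have h1 : ∫⁻ u in Ioo (0 : ℝ) 1, (d * fun u => ENNReal.ofReal (1 / (1 + T u))) u ∂μ =
        ∫⁻ u in Ioo (0 : ℝ) 1, 1 ∂μ := by
      refine setLIntegral_congr_fun measurableSet_Ioo fun u hu => ?_
      have hu0 : 0 < u := hu.1
      have h2 : 1 / (1 + T u) = u := by
        simp only [T]
        field_simp
        ring
      rw [Pi.mul_apply, h2, ← ENNReal.ofReal_mul (by positivity), one_div_mul_cancel hu0.ne',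
        ENNReal.ofReal_one]
    rw [h1]
    simp
  · rw [hres, integral_map hT.aemeasurable (Measurable.aestronglyMeasurable (by fun_prop)),
      integral_withDensity_eq_integral_toReal_smul hd (by simp [d])]
    have hint : Integrable (fun u : ℝ => 1 / (1 - (1 - s) * u)) μ := by
      have hc : ContinuousOn (fun u : ℝ => 1 / (1 - (1 - s) * u)) (Icc 0 1) := by
        refine ContinuousOn.div continuousOn_const (by fun_prop) fun u hu => ?_
        exact one_sub_add_mul_ne_zero hs hu
      obtain ⟨C, hC⟩ := isCompact_Icc.exists_bound_of_continuousOn hc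
      refine Integrable.of_bound (Measurable.aestronglyMeasurable (by fun_prop)) C ?_
      filter_upwards [hμ] with u hu using hC u hu
    have hs0 := ne_zero_of_re_pos hs
    have e1 : ∫ u in Ioo (0 : ℝ) 1, (d u).toReal • (1 / (s + (T u : ℝ))) ∂μ =
        ∫ u in Ioo (0 : ℝ) 1, 1 / (1 - (1 - s) * u) ∂μ := by
      refine setIntegral_congr_fun measurableSet_Ioo fun u hu => ?_
      have hu0 : 0 < u := hu.1
      have hu1 : (u : ℂ) ≠ 0 := by exact_mod_cast hu0.ne'
      have h3 := one_sub_add_mul_ne_zero hs ⟨hu0.le, hu.2.le⟩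
      have h4 : s + (T u : ℝ) = (1 - (1 - s) * u) / u := by
        simp only [T]
        push_cast
        field_simp
        ring
      rw [h4, ENNReal.toReal_ofReal (by positivity), Complex.real_smul, one_div_div]
      push_cast
      field_simp
    have e2 : μ = μ.restrict (Icc 0 1) := (Measure.restrict_eq_self_of_ae_mem hμ).symm
    have e3 : Icc (0 : ℝ) 1 = ({1} ∪ {0}) ∪ Ioo 0 1 := by
      ext u
      simp only [mem_Icc, mem_union, mem_singleton_iff, mem_Ioo]
      constructor
      · rintro ⟨h1, h2⟩
        rcases h1.eq_or_lt with h | h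
        · exact Or.inl (Or.inr h.symm)
        · rcases h2.eq_or_lt with h' | h'
          · exact Or.inl (Or.inl h')
          · exact Or.inr ⟨h, h'⟩
      · rintro ((rfl | rfl) | ⟨h1, h2⟩)
        · norm_num
        · norm_num
        · exact ⟨h1.le, h2.le⟩
    have e4 : ∫ u : ℝ, 1 / (1 - (1 - s) * u) ∂μ = ∫ u in Icc (0 : ℝ) 1, 1 / (1 - (1 - s) * u) ∂μ := by
      rw [← e2]
    rw [e1]
    refine e4.trans ?_
    rw [e3, setIntegral_union _ measurableSet_Ioo hint.integrableOn hint.integrableOn,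
      setIntegral_union _ (measurableSet_singleton _) hint.integrableOn hint.integrableOn,
      integral_singleton, integral_singleton]
    · simp only [Complex.real_smul]
      push_cast
      simp only [mul_one, mul_zero, sub_zero, sub_sub_cancel]
      ring
    · simp
    · simp only [disjoint_union_left, disjoint_singleton_left, mem_Ioo]
      norm_num

theorem IsStieltjes.const_mul {F : ℂ → ℂ} (hF : IsStieltjes F) {c : ℝ} (hc : 0 ≤ c) :
    IsStieltjes fun s => c * F s := by
  obtain ⟨a, b, σ, ha, hb, hσ, h⟩ := hF
  refine ⟨c * a, c * b, ENNReal.ofReal c • σ, by positivity, by positivity, ?_, fun s hs => ?_⟩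
  · rw [Measure.restrict_smul, lintegral_smul_measure]
    exact ENNReal.mul_lt_top ENNReal.ofReal_lt_top hσ
  · change (c : ℂ) * F s = _
    rw [h s hs, Measure.restrict_smul, integral_smul_measure, ENNReal.toReal_ofReal hc,
      Complex.real_smul]
    push_cast
    ring

theorem IsStieltjes.differentiableOn {F : ℂ → ℂ} (hF : IsStieltjes F) :
    DifferentiableOn ℂ F {s : ℂ | 0 < s.re} := by
  obtain ⟨a, b, σ, ha, hb, hσ, h⟩ := hF
  have hσ' := isStieltjesMeasure_restrict hσ
  refine DifferentiableOn.congr (f := fun s : ℂ => a / s + b + ∫ t in Ioi (0 : ℝ), 1 / (s + t) ∂σ)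
    (fun s hs => ?_) h
  refine DifferentiableAt.differentiableWithinAt ?_
  have h1 := hσ'.differentiableAt_stieltjes hs
  have h2 : DifferentiableAt ℂ (fun s : ℂ => (a : ℂ) / s) s :=
    (differentiableAt_const _).div differentiableAt_id (ne_zero_of_re_pos hs)
  exact (h2.add_const _).add h1

theorem isOpen_re_pos : IsOpen {s : ℂ | 0 < s.re} := isOpen_lt continuous_const Complex.continuous_re

/-- Two functions holomorphic in the right half-plane that agree on `(0, ∞)` are equal. -/
theorem eqOn_re_pos_of_ofReal {F G : ℂ → ℂ} (hF : DifferentiableOn ℂ F {s : ℂ | 0 < s.re})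
    (hG : DifferentiableOn ℂ G {s : ℂ | 0 < s.re}) (h : ∀ x : ℝ, 0 < x → F x = G x) :
    EqOn F G {s : ℂ | 0 < s.re} := by
  refine (hF.analyticOnNhd isOpen_re_pos).eqOn_of_preconnected_of_frequently_eq
    (hG.analyticOnNhd isOpen_re_pos) (convex_halfSpace_re_gt 0).isPreconnected
    (z₀ := ((1 : ℝ) : ℂ)) (by simp) ?_
  have h1 : Tendsto (fun x : ℝ => (x : ℂ)) (𝓝[≠] 1) (𝓝[≠] ((1 : ℝ) : ℂ)) := by
    refine tendsto_nhdsWithin_iff.2 ⟨(Complex.continuous_ofReal.tendsto 1).mono_left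
      nhdsWithin_le_nhds, ?_⟩
    filter_upwards [self_mem_nhdsWithin] with x hx
    simpa using hx
  refine h1.frequently (Eventually.frequently ?_)
  filter_upwards [nhdsWithin_le_nhds (Ioi_mem_nhds (zero_lt_one' ℝ))] with x hx using h x hx

/-- The spectral argument only reaches real x > 0. Both sides are holomorphic in the half-plane,
because Ψ has no zeros there, so the identity theorem does the rest. -/
theorem isStieltjes_one_div {Ψ : ℂ → ℂ} (hd : DifferentiableOn ℂ Ψ {s : ℂ | 0 < s.re})
    {a b : ℝ} (ha : 0 ≤ a) (hb : 0 ≤ b) {σ : Measure ℝ} (hσ : IsStieltjesMeasure σ)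
    (hΨ : ∀ s : ℂ, 0 < s.re → Ψ s = bernstein a b σ s) {s₀ : ℂ} (hs₀ : 0 < s₀.re) (hne : Ψ s₀ ≠ 0) :
    IsStieltjes fun s => 1 / Ψ s := by
  rw [hΨ s₀ hs₀] at hne
  obtain ⟨c, μ, hc, hμ, hμ1, h⟩ := exists_renewal_of_bernstein ha hb hσ hne
  have hF := (isStieltjes_of_measure_Icc hμ1).const_mul (inv_nonneg.2 hc.le)
  have h0 (s : ℂ) (hs : 0 < s.re) : Ψ s ≠ 0 := by
    rw [hΨ s hs]
    exact ne_zero_of_re_pos (re_bernstein_pos ha hb hσ hne hs)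
  have heq : EqOn (fun s => 1 / Ψ s)
      (fun s => ((c⁻¹ : ℝ) : ℂ) * ∫ u : ℝ, 1 / (1 - (1 - s) * u) ∂μ) {s : ℂ | 0 < s.re} := by
    refine eqOn_re_pos_of_ofReal ((differentiableOn_const _).div hd h0) hF.differentiableOn
      fun x hx => ?_
    have h1 : ∫ u : ℝ, 1 / (1 - (1 - (x : ℂ)) * u) ∂μ =
        ((∫ u : ℝ, 1 / (1 - (1 - x) * u) ∂μ : ℝ) : ℂ) := by
      rw [← integral_complex_ofReal]
      push_cast
      rfl
    rw [hΨ x (by simpa using hx), h1, ← h x hx, bernstein_ofReal]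
    have hc' : (c : ℂ) ≠ 0 := by exact_mod_cast hc.ne'
    push_cast
    field_simp
  obtain ⟨a', b', σ', ha', hb', hσ', h'⟩ := hF
  exact ⟨a', b', σ', ha', hb', hσ', fun s hs => (heq hs).trans (h' s hs)⟩

/-! ### Sonine pairs of complete Bernstein symbols -/

theorem IsCausal.iterate_deriv {T : 𝓢'(ℝ, ℂ)} (hT : IsCausal T) (m : ℕ) :
    IsCausal ((TemperedDistribution.derivCLM ℂ)^[m] T) := by
  induction m with
  | zero => exact hT
  | succ m ih => rw [Function.iterate_succ_apply']; exact ih.deriv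

theorem laplace_iterate_deriv {T : 𝓢'(ℝ, ℂ)} (hT : IsCausal T) (m : ℕ) {s : ℂ} (hs : 0 < s.re) :
    laplace ((TemperedDistribution.derivCLM ℂ)^[m] T) s hs = s ^ m * laplace T s hs := by
  induction m with
  | zero => simp
  | succ m ih => rw [Function.iterate_succ_apply', laplace_deriv (hT.iterate_deriv m), ih]; ring

theorem isCausal_delta : IsCausal (TemperedDistribution.delta (0 : ℝ)) := fun φ hφ => by
  change φ 0 = 0
  exact image_eq_zero_of_notMem_tsupport fun h => lt_irrefl (0 : ℝ) (mem_Iio.1 (hφ h))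

theorem laplace_delta {s : ℂ} (hs : 0 < s.re) :
    laplace (TemperedDistribution.delta (0 : ℝ)) s hs = 1 := by
  change cutExpSchwartz s hs 0 = 1
  rw [cutExpSchwartz_apply, cutExp_of_ge s (by norm_num)]
  simp

/-- For a Sonine pair of order one, `κ'` is the convolution inverse of `k`. -/
theorem IsInverseLaplacePair.isConvolution_deriv {Φ : ℂ → ℂ} {k κ : 𝓢'(ℝ, ℂ)}
    (h : IsInverseLaplacePair 1 Φ k κ) :
    IsConvolution k (TemperedDistribution.derivCLM ℂ κ) fun φ => φ 0 := by
  obtain ⟨hk, hκ, hne, hLk, hLκ⟩ := h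
  refine (isConvolution_iff hk hκ.deriv).2 fun φ => ?_
  have : TemperedDistribution.delta (0 : ℝ) = conv k _ hκ.deriv := by
    refine eq_of_laplace_eq isCausal_delta (hk.conv hκ.deriv) fun s hs => ?_
    rw [laplace_delta, laplace_conv hk hκ.deriv, laplace_deriv hκ, hLk s hs, hLκ s hs]
    have h1 := hne s hs
    have h2 := ne_zero_of_re_pos hs
    field_simp
  rw [← this]
  rfl

section Bernstein

variable {n : ℕ} {Φ : ℂ → ℂ} {a b : ℝ} {σ : Measure ℝ}

/-- The measure κ₁ with characteristics a, b, σ has transform Ψ/s = s^{n-1} Φ. Convolution with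
t₊^{n-2}/(n-2)! divides by s^{n-1}; for n = 1 nothing has to be divided. -/
theorem exists_distribution_of_bernstein (hn : 1 ≤ n) (ha : 0 ≤ a) (hσ : IsStieltjesMeasure σ)
    (hΨ : ∀ s : ℂ, 0 < s.re → s ^ n * Φ s = bernstein a b σ s) :
    ∃ κ : 𝓢'(ℝ, ℂ), IsCausal κ ∧ HasLaplaceTransform κ Φ := by
  obtain ⟨κ₁, hκ₁, hφ⟩ := hσ.exists_distribution ha b
  have hL (s : ℂ) (hs : 0 < s.re) : laplace κ₁ s hs = s ^ (n - 1) * Φ s := by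
    have h0 := ne_zero_of_re_pos hs
    have h1 := hΨ s hs
    rw [bernstein_eq_mul h0, ← hσ.laplace_eq hφ hs] at h1
    obtain ⟨m, rfl⟩ : ∃ m, n = m + 1 := ⟨n - 1, by omega⟩
    rw [Nat.add_sub_cancel]
    refine mul_left_cancel₀ h0 ?_
    rw [← h1]
    ring
  rcases hn.eq_or_lt with rfl | hn
  · exact ⟨κ₁, hκ₁, fun s hs => by simpa using hL s hs⟩
  · obtain ⟨P, hP, hPn⟩ := exists_truncatedPower_distribution (n - 1)
    refine ⟨conv κ₁ P hP, hκ₁.conv hP, fun s hs => ?_⟩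
    rw [laplace_conv hκ₁ hP, hL, laplace, hPn, truncatedPower_cutExp (by omega) hs]
    have := pow_ne_zero (n - 1) (ne_zero_of_re_pos hs)
    field_simp

/-- All but one of the n derivatives in the Weyl–Sonine derivative can be put on κ, which leaves the
explicit measure κ₁ convolved with v'. -/
theorem iterate_deriv_eq (hn : 1 ≤ n) (hσ : IsStieltjesMeasure σ)
    (hΨ : ∀ s : ℂ, 0 < s.re → s ^ n * Φ s = bernstein a b σ s) {κ κ₁ : 𝓢'(ℝ, ℂ)} (hκ : IsCausal κ)
    (hL : HasLaplaceTransform κ Φ) (hκ₁ : IsCausal κ₁) (hφ : ∀ φ : 𝓢(ℝ, ℂ),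
      κ₁ φ = b * φ 0 + ∫ r in Ioi (0 : ℝ), (stieltjesDensity a σ r : ℂ) * φ r) :
    (TemperedDistribution.derivCLM ℂ)^[n - 1] κ = κ₁ := by
  refine eq_of_laplace_eq (hκ.iterate_deriv _) hκ₁ fun s hs => ?_
  have h0 := ne_zero_of_re_pos hs
  rw [laplace_iterate_deriv hκ, hL s hs]
  have h1 := hΨ s hs
  rw [bernstein_eq_mul h0, ← hσ.laplace_eq hφ hs] at h1
  obtain ⟨m, rfl⟩ : ∃ m, n = m + 1 := ⟨n - 1, by omega⟩
  rw [Nat.add_sub_cancel]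
  refine mul_left_cancel₀ h0 ?_
  rw [← h1]
  ring

end Bernstein

/-! ### Derivatives of the convolution with a Schwartz function -/

/-- The reflection of a Schwartz function. -/
abbrev reflect (v : 𝓢(ℝ, ℂ)) : 𝓢(ℝ, ℂ) :=
  SchwartzMap.compCLMOfContinuousLinearEquiv ℂ (ContinuousLinearEquiv.neg ℝ) v

theorem reflect_apply (v : 𝓢(ℝ, ℂ)) (t : ℝ) : reflect v t = v (-t) := rfl

theorem convSchwartz_eq (T : 𝓢'(ℝ, ℂ)) (v : 𝓢(ℝ, ℂ)) (y : ℝ) :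
    convSchwartz T v y = T (shift (-y) (reflect v)) := by
  rw [convSchwartz, shift, neg_neg]

theorem der_reflect (v : 𝓢(ℝ, ℂ)) : der (reflect v) = -reflect (der v) := by
  ext t
  change deriv (fun t => v (-t)) t = -deriv v (-t)
  rw [deriv_comp_neg]

theorem shift_neg (x : ℝ) (φ : 𝓢(ℝ, ℂ)) : shift x (-φ) = -shift x φ := map_neg _ _

theorem der_shift (x : ℝ) (v : 𝓢(ℝ, ℂ)) : der (shift x v) = shift x (der v) := by
  ext t
  rw [shift_apply, coe_der, coe_der, coe_shift, deriv_comp_add_const]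

theorem hasDerivAt_convSchwartz (T : 𝓢'(ℝ, ℂ)) (v : 𝓢(ℝ, ℂ)) (y : ℝ) :
    HasDerivAt (convSchwartz T v) (convSchwartz T (der v) y) y := by
  have h := (hasDerivAt_apply_shift T (reflect v) (-y)).scomp y (hasDerivAt_neg y)
  have h2 : convSchwartz T v = (fun x => T (shift x (reflect v))) ∘ Neg.neg :=
    funext fun y => convSchwartz_eq T v y
  rw [h2]
  refine h.congr_deriv ?_
  rw [der_reflect, convSchwartz_eq, shift_neg, map_neg]
  simp

theorem convSchwartz_der (T : 𝓢'(ℝ, ℂ)) (v : 𝓢(ℝ, ℂ)) (y : ℝ) :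
    convSchwartz T (der v) y = convSchwartz (TemperedDistribution.derivCLM ℂ T) v y := by
  rw [convSchwartz_eq, convSchwartz_eq, TemperedDistribution.derivCLM_apply_apply]
  congr 1
  change _ = -der (shift (-y) (reflect v))
  rw [der_shift, der_reflect, shift_neg, neg_neg]

/-- One derivative stays on v; the other m are moved to the distribution. -/
theorem iteratedDeriv_convSchwartz (T : 𝓢'(ℝ, ℂ)) (v : 𝓢(ℝ, ℂ)) (m : ℕ) :
    iteratedDeriv (m + 1) (convSchwartz T v) =
      convSchwartz ((TemperedDistribution.derivCLM ℂ)^[m] T) (der v) := by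
  induction m generalizing T with
  | zero =>
    rw [zero_add, iteratedDeriv_one]
    exact funext fun y => (hasDerivAt_convSchwartz T v y).deriv
  | succ m ih =>
    rw [iteratedDeriv_succ', Function.iterate_succ_apply, ← ih]
    congr 1
    funext y
    rw [(hasDerivAt_convSchwartz T v y).deriv, convSchwartz_der]

/-- The convolution of the kernel `b δ₀ + (a + ∫ e^{-rt} σ(dt)) dr` with a derivative. -/
theorem convSchwartz_der_eq {a b : ℝ} {σ : Measure ℝ} (hσ : IsStieltjesMeasure σ) {T : 𝓢'(ℝ, ℂ)}
    (hφ : ∀ φ : 𝓢(ℝ, ℂ),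
      T φ = b * φ 0 + ∫ r in Ioi (0 : ℝ), (stieltjesDensity a σ r : ℂ) * φ r)
    (v : 𝓢(ℝ, ℂ)) (y : ℝ) :
    convSchwartz T (der v) y = a * v y + b * deriv v y +
      ∫ t, (∫ r in Ioi (0 : ℝ), (Real.exp (-(r * t)) : ℂ) * deriv v (y - r)) ∂σ := by
  have h1 (r : ℝ) : shift (-y) (reflect (der v)) r = deriv v (y - r) := by
    rw [shift_apply, reflect_apply, coe_der, neg_add, neg_neg, neg_add_eq_sub]
  rw [convSchwartz_eq, hφ, hσ.integral_stieltjesDensity_mul]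
  simp only [h1, sub_zero]
  -- The constant part a of the density integrates v' back to v.
  have h2 : ∫ r in Ioi (0 : ℝ), deriv v (y - r) = v y := by
    have h3 : Tendsto (fun r => -v (y - r)) atTop (𝓝 (-0)) := by
      have h4 : Tendsto (fun r => y - r) atTop (cocompact ℝ) :=
        (tendsto_atBot_add_const_left _ y tendsto_neg_atTop_atBot).mono_right atBot_le_cocompact
      exact ((zero_at_infty v).comp h4).neg
    have h5 : IntegrableOn (fun r => deriv v (y - r)) (Ioi 0) := by
      have := (der v).integrable (μ := volume)
      exact (this.comp_sub_left y).integrableOn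
    have h6 := integral_Ioi_of_hasDerivAt_of_tendsto' (a := 0) (f := fun r => -v (y - r))
      (f' := fun r => deriv v (y - r)) (m := -0) (fun r _ => ?_) h5 h3
    · rw [h6]
      simp
    · have h7 : HasDerivAt v (deriv v (y - r)) (y - r) := v.differentiableAt.hasDerivAt
      have h8 := (h7.scomp r ((hasDerivAt_id r).const_sub y)).neg
      refine h8.congr_deriv ?_
      simp
  rw [h2]
  ring

/-! ### Multiplication semigroups -/

section MulSemigroup

variable {Ω : Type*} [MeasurableSpace Ω] {μ : Measure Ω}

theorem mulOp_eq_of_ae {q : Ω → ℂ} (hq : Measurable q) {C : ℝ} (hC : ∀ x, ‖q x‖ ≤ C)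
    {f g : Lp ℂ 2 μ} (h : g =ᵐ[μ] fun x => q x * f x) : mulOp μ q hq C hC f = g :=
  Lp.ext ((coeFn_mulOp hq hC f).trans h.symm)

/-- Bounded pointwise convergence of multipliers implies strong convergence. -/
theorem tendsto_mulOp {ι : Type*} {l : Filter ι} [l.IsCountablyGenerated] {q : ι → Ω → ℂ}
    {q₀ : Ω → ℂ} (hq : ∀ i, Measurable (q i)) (hq₀ : Measurable q₀) {C : ℝ}
    (hC : ∀ i x, ‖q i x‖ ≤ C) (hC₀ : ∀ x, ‖q₀ x‖ ≤ C)
    (h : ∀ x, Tendsto (fun i => q i x) l (𝓝 (q₀ x))) (f : Lp ℂ 2 μ) :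
    Tendsto (fun i => mulOp μ (q i) (hq i) C (hC i) f) l (𝓝 (mulOp μ q₀ hq₀ C hC₀ f)) := by
  rw [tendsto_iff_norm_sub_tendsto_zero]
  have h1 (i : ι) : ‖mulOp μ (q i) (hq i) C (hC i) f - mulOp μ q₀ hq₀ C hC₀ f‖ ^ 2 =
      ∫ x, ‖(q i x - q₀ x) * f x‖ ^ 2 ∂μ := by
    rw [norm_sq_eq_integral]
    refine integral_congr_ae ?_
    filter_upwards [Lp.coeFn_sub (mulOp μ (q i) (hq i) C (hC i) f) (mulOp μ q₀ hq₀ C hC₀ f),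
      coeFn_mulOp (hq i) (hC i) f, coeFn_mulOp hq₀ hC₀ f] with x e1 e2 e3
    rw [e1, Pi.sub_apply, e2, e3, sub_mul]
  have h2 : Tendsto (fun i => ∫ x, ‖(q i x - q₀ x) * f x‖ ^ 2 ∂μ) l (𝓝 (∫ _, (0 : ℝ) ∂μ)) := by
    refine tendsto_integral_filter_of_dominated_convergence (fun x => (2 * C) ^ 2 * ‖f x‖ ^ 2)
      ?_ ?_ ((integrable_norm_sq f).const_mul _) ?_
    · exact Eventually.of_forall fun i => ((((hq i).sub hq₀).aestronglyMeasurable).mul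
        (Lp.aestronglyMeasurable f)).norm.pow 2
    · refine Eventually.of_forall fun i => Eventually.of_forall fun x => ?_
      rw [Real.norm_of_nonneg (by positivity), norm_mul, mul_pow]
      have : ‖q i x - q₀ x‖ ≤ 2 * C := by
        refine (norm_sub_le _ _).trans ?_
        linarith [hC i x, hC₀ x]
      gcongr
    · refine Eventually.of_forall fun x => ?_
      have h3 : Tendsto (fun i => ‖(q i x - q₀ x) * f x‖ ^ 2) l
          (𝓝 (‖(q₀ x - q₀ x) * f x‖ ^ 2)) := ((((h x).sub_const _).mul_const _).norm).pow 2
      simpa using h3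
  simp only [integral_zero] at h2
  simp only [← h1] at h2
  have h3 := h2.sqrt
  simpa [Real.sqrt_sq] using h3

/-- Semigroups are indexed by all of ℝ; clipping τ at 0 keeps the multiplier bounded for negative τ.
-/
theorem norm_exp_neg_mul_le {m : ℂ} (hm : 0 ≤ m.re) (τ : ℝ) :
    ‖Complex.exp (-((max τ 0 : ℝ) * m))‖ ≤ 1 := by
  rw [Complex.norm_exp]
  refine Real.exp_le_one_iff.2 ?_
  rw [Complex.neg_re, Complex.re_ofReal_mul]
  exact neg_nonpos.2 (mul_nonneg (le_max_right _ _) hm)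

theorem norm_exp_neg_sub_one_le {z : ℂ} (hz : 0 ≤ z.re) : ‖Complex.exp (-z) - 1‖ ≤ ‖z‖ := by
  have h1 : ∀ x ∈ Icc (0 : ℝ) 1, HasDerivWithinAt (fun x : ℝ => Complex.exp (-(x * z)))
      (-z * Complex.exp (-(x * z))) (Icc 0 1) x := fun x _ => by
    have h2 : HasDerivAt (fun x : ℝ => -((x : ℂ) * z)) (-(1 * z)) x :=
      ((Complex.ofRealCLM.hasDerivAt (x := x)).mul_const z).neg
    refine (h2.cexp.congr_deriv ?_).hasDerivWithinAt
    ring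
  have h3 := norm_image_sub_le_of_norm_deriv_le_segment_01' h1 (C := ‖z‖) fun x hx => by
    rw [norm_mul, norm_neg]
    refine mul_le_of_le_one_right (norm_nonneg _) ?_
    have := norm_exp_neg_mul_le hz x
    rwa [max_eq_left hx.1] at this
  simpa using h3

theorem one_le_norm_one_add {m : ℂ} (hm : 0 ≤ m.re) : 1 ≤ ‖1 + m‖ := by
  have := Complex.re_le_norm (1 + m)
  simp only [Complex.add_re, Complex.one_re] at this
  linarith

theorem one_add_ne_zero {m : ℂ} (hm : 0 ≤ m.re) : 1 + m ≠ 0 :=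
  norm_pos_iff.1 (zero_lt_one.trans_le (one_le_norm_one_add hm))

theorem norm_le_two_mul_norm_one_add {m : ℂ} (hm : 0 ≤ m.re) : ‖m‖ ≤ 2 * ‖1 + m‖ := by
  have h1 := one_le_norm_one_add hm
  have h2 : ‖m‖ ≤ ‖1 + m‖ + ‖(1 : ℂ)‖ := by
    have := norm_sub_le (1 + m) 1
    rwa [add_sub_cancel_left] at this
  rw [norm_one] at h2
  linarith

theorem norm_one_div_one_add_le {m : ℂ} (hm : 0 ≤ m.re) : ‖1 / (1 + m)‖ ≤ 1 := by
  rw [norm_div, norm_one]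
  exact div_le_one_of_le₀ (one_le_norm_one_add hm) (norm_nonneg _)

theorem norm_neg_div_one_add_le {m : ℂ} (hm : 0 ≤ m.re) : ‖-m / (1 + m)‖ ≤ 2 := by
  rw [norm_div, norm_neg]
  exact div_le_of_le_mul₀ (norm_nonneg _) zero_le_two (norm_le_two_mul_norm_one_add hm)

/-- The difference quotient `(e^{-τm} - 1) / τ`, regularized by the resolvent `1 / (1 + m)`. -/
def expQuot (m : ℂ) (τ : ℝ) : ℂ :=
  ((τ⁻¹ : ℝ) : ℂ) * (Complex.exp (-((max τ 0 : ℝ) * m)) - 1) / (1 + m)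

theorem norm_expQuot_le {m : ℂ} (hm : 0 ≤ m.re) (τ : ℝ) : ‖expQuot m τ‖ ≤ 2 := by
  rcases le_or_gt τ 0 with h | h
  · rw [expQuot, max_eq_right h]
    simp
  · rw [expQuot, max_eq_left h.le, norm_div, norm_mul, Complex.norm_real,
      Real.norm_of_nonneg (by positivity)]
    refine div_le_of_le_mul₀ (norm_nonneg _) zero_le_two ?_
    refine le_trans ?_ (norm_le_two_mul_norm_one_add hm)
    have h1 := norm_exp_neg_sub_one_le (z := (τ : ℂ) * m)
      (by rw [Complex.re_ofReal_mul]; positivity)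
    rw [norm_mul, Complex.norm_real, Real.norm_of_nonneg h.le] at h1
    rwa [inv_mul_le_iff₀ h]

theorem tendsto_expQuot (m : ℂ) : Tendsto (expQuot m) (𝓝[>] 0) (𝓝 (-m / (1 + m))) := by
  have h1 : HasDerivAt (fun τ : ℝ => Complex.exp (-((τ : ℂ) * m))) (-m) 0 := by
    have h2 : HasDerivAt (fun x : ℝ => -((x : ℂ) * m)) (-(1 * m)) 0 :=
      ((Complex.ofRealCLM.hasDerivAt (x := 0)).mul_const m).neg
    refine h2.cexp.congr_deriv ?_
    simp
  have h3 := (hasDerivAt_iff_tendsto_slope.1 h1).mono_left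
    (nhdsWithin_mono 0 (fun x hx => (ne_of_gt hx : x ≠ 0)) : 𝓝[>] (0 : ℝ) ≤ 𝓝[≠] 0)
  refine (h3.div_const (1 + m)).congr' ?_
  filter_upwards [self_mem_nhdsWithin] with τ hτ
  rw [expQuot, max_eq_left (le_of_lt hτ), slope_def_module]
  simp

variable (m : Ω → ℂ) (hm : Measurable m) (hre : ∀ x, 0 ≤ (m x).re)

/-- The semigroup of multiplications by `e^{-τm}`. -/
def mulSemigroup (μ : Measure Ω) (τ : ℝ) : Lp ℂ 2 μ →L[ℂ] Lp ℂ 2 μ :=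
  mulOp μ (fun x => Complex.exp (-((max τ 0 : ℝ) * m x))) (by fun_prop) 1
    fun x => norm_exp_neg_mul_le (hre x) τ

theorem coeFn_mulSemigroup (τ : ℝ) (f : Lp ℂ 2 μ) :
    mulSemigroup m hm hre μ τ f =ᵐ[μ] fun x => Complex.exp (-((max τ 0 : ℝ) * m x)) * f x :=
  coeFn_mulOp _ _ f

theorem norm_mulSemigroup_le (τ : ℝ) : ‖mulSemigroup m hm hre μ τ‖ ≤ 1 :=
  norm_mulOp_le _ _ zero_le_one

theorem isC0Semigroup_mulSemigroup : IsC0Semigroup (mulSemigroup m hm hre μ) where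
  map_zero := by
    ext1 f
    refine mulOp_eq_of_ae _ _ (Eventually.of_forall fun x => ?_)
    simp
  map_add τ τ' hτ hτ' := by
    ext1 f
    refine mulOp_eq_of_ae _ _ ?_
    rw [ContinuousLinearMap.comp_apply]
    filter_upwards [coeFn_mulSemigroup m hm hre τ (mulSemigroup m hm hre μ τ' f),
      coeFn_mulSemigroup m hm hre τ' f] with x e1 e2
    rw [e1, e2, ← mul_assoc, ← Complex.exp_add, max_eq_left hτ, max_eq_left hτ',
      max_eq_left (add_nonneg hτ hτ')]
    congr 2
    push_cast
    ring
  tendsto_zero f := by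
    have h1 : mulOp μ (fun _ => (1 : ℂ)) measurable_const 1 (by simp) f = f :=
      mulOp_eq_of_ae _ _ (Eventually.of_forall fun x => (one_mul _).symm)
    have h2 := tendsto_mulOp (μ := μ) (l := 𝓝[>] (0 : ℝ))
      (q := fun τ x => Complex.exp (-((max τ 0 : ℝ) * m x))) (q₀ := fun _ => (1 : ℂ))
      (by fun_prop) measurable_const (C := 1) (fun τ x => norm_exp_neg_mul_le (hre x) τ) (by simp)
      (fun x => ?_) f
    · rwa [h1] at h2
    · have h3 : Continuous fun τ : ℝ => Complex.exp (-((max τ 0 : ℝ) * m x)) := by fun_prop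
      have h4 := h3.tendsto 0
      simp only [max_self, Complex.ofReal_zero, zero_mul, neg_zero, Complex.exp_zero] at h4
      exact h4.mono_left nhdsWithin_le_nhds

/-- The graph of the multiplication by `-m`. -/
def mulGraph (μ : Measure Ω) : Set (Lp ℂ 2 μ × Lp ℂ 2 μ) :=
  {p | p.2 =ᵐ[μ] fun x => -(m x * p.1 x)}

variable {m}

/-- The graph of the unbounded operator is described through its bounded resolvent 1/(1 + m): (f,
-mf) is recovered from f + mf. Closedness becomes evident. -/
theorem mem_mulGraph_iff (p : Lp ℂ 2 μ × Lp ℂ 2 μ) :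
    p ∈ mulGraph m μ ↔
      mulOp μ (fun x => 1 / (1 + m x)) (by fun_prop) 1
        (fun x => norm_one_div_one_add_le (hre x)) (p.1 - p.2) = p.1 := by
  constructor
  · intro h
    refine mulOp_eq_of_ae _ _ ?_
    have h' : p.2 =ᵐ[μ] fun x => -(m x * p.1 x) := h
    filter_upwards [h', Lp.coeFn_sub p.1 p.2] with x e1 e2
    have := one_add_ne_zero (hre x)
    rw [e2, Pi.sub_apply, e1]
    field_simp
    ring
  · intro h
    have h1 := coeFn_mulOp (μ := μ) (q := fun x => 1 / (1 + m x)) (by fun_prop)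
      (fun x => norm_one_div_one_add_le (hre x)) (p.1 - p.2)
    rw [h] at h1
    change p.2 =ᵐ[μ] fun x => -(m x * p.1 x)
    filter_upwards [h1, Lp.coeFn_sub p.1 p.2] with x e1 e2
    have := one_add_ne_zero (hre x)
    rw [e2, Pi.sub_apply] at e1
    field_simp at e1
    linear_combination e1

theorem isClosed_mulGraph {m : Ω → ℂ} (hm : Measurable m) (hre : ∀ x, 0 ≤ (m x).re) :
    IsClosed (mulGraph m μ) := by
  have : mulGraph m μ = {p | mulOp μ (fun x => 1 / (1 + m x)) (by fun_prop) 1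
        (fun x => norm_one_div_one_add_le (hre x)) (p.1 - p.2) = p.1} :=
    Set.ext fun p => mem_mulGraph_iff hm hre p
  rw [this]
  exact isClosed_eq ((ContinuousLinearMap.continuous _).comp (continuous_fst.sub continuous_snd))
    continuous_fst

theorem coeFn_quotient (τ : ℝ) (f : Lp ℂ 2 μ) :
    (((τ⁻¹ : ℝ) : ℂ) • (mulSemigroup m hm hre μ τ f - f) : Lp ℂ 2 μ) =ᵐ[μ]
      fun x => ((τ⁻¹ : ℝ) : ℂ) * (Complex.exp (-((max τ 0 : ℝ) * m x)) - 1) * f x := by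
  filter_upwards [Lp.coeFn_smul ((τ⁻¹ : ℝ) : ℂ) (mulSemigroup m hm hre μ τ f - f),
    Lp.coeFn_sub (mulSemigroup m hm hre μ τ f) f, coeFn_mulSemigroup m hm hre τ f] with x e1 e2 e3
  rw [e1, Pi.smul_apply, e2, Pi.sub_apply, e3, smul_eq_mul]
  ring

/-- The quotient (e^{-τm} - 1)/τ is not bounded uniformly in τ, but after division by 1 + m it is.
If the quotients converge, the resolvent is applied to the limit and then cancelled. Conversely a
graph point has p.1 = R(p.1 - p.2), so its quotients are regularized ones applied to p.1 - p.2. -/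
theorem generatorGraph_mulSemigroup :
    generatorGraph (mulSemigroup m hm hre μ) = mulGraph m μ := by
  have hQ (h : Lp ℂ 2 μ) := tendsto_mulOp (μ := μ) (l := 𝓝[>] (0 : ℝ))
    (q := fun τ x => expQuot (m x) τ) (q₀ := fun x => -m x / (1 + m x))
    (fun τ => by unfold expQuot; fun_prop) (by fun_prop) (C := 2)
    (fun τ x => norm_expQuot_le (hre x) τ) (fun x => norm_neg_div_one_add_le (hre x))
    (fun x => tendsto_expQuot (m x)) h
  set R := mulOp μ (fun x => 1 / (1 + m x)) (by fun_prop) 1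
        (fun x => norm_one_div_one_add_le (hre x)) with hRdef
  have hR (f : Lp ℂ 2 μ) : R f =ᵐ[μ] fun x => 1 / (1 + m x) * f x := coeFn_mulOp _ _ f
  ext p
  constructor
  · intro hp
    have h1 : Tendsto (fun τ : ℝ => R (((τ⁻¹ : ℝ) : ℂ) • (mulSemigroup m hm hre μ τ p.1 - p.1)))
        (𝓝[>] 0) (𝓝 (R p.2)) := (R.continuous.tendsto _).comp hp
    have h2 : R p.2 = mulOp μ (fun x => -m x / (1 + m x)) (by fun_prop) 2
        (fun x => norm_neg_div_one_add_le (hre x)) p.1 := by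
      refine tendsto_nhds_unique h1 ((hQ p.1).congr fun τ => ?_)
      refine mulOp_eq_of_ae _ _ ?_
      filter_upwards [hR (((τ⁻¹ : ℝ) : ℂ) • (mulSemigroup m hm hre μ τ p.1 - p.1)),
        coeFn_quotient hm hre τ p.1] with x e1 e2
      rw [e1, e2, expQuot]
      ring
    change p.2 =ᵐ[μ] fun x => -(m x * p.1 x)
    have h3 := coeFn_mulOp (μ := μ) (q := fun x => -m x / (1 + m x)) (by fun_prop)
      (fun x => norm_neg_div_one_add_le (hre x)) p.1
    rw [← h2] at h3
    filter_upwards [h3, hR p.2] with x e1 e2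
    have := one_add_ne_zero (hre x)
    rw [e2] at e1
    field_simp at e1
    linear_combination e1
  · intro hp
    have h1 := (mem_mulGraph_iff hm hre p).1 hp
    change Tendsto _ _ _
    have h2 : mulOp μ (fun x => -m x / (1 + m x)) (by fun_prop) 2
        (fun x => norm_neg_div_one_add_le (hre x)) (p.1 - p.2) = p.2 := by
      refine mulOp_eq_of_ae _ _ ?_
      have h' : p.2 =ᵐ[μ] fun x => -(m x * p.1 x) := hp
      filter_upwards [h', Lp.coeFn_sub p.1 p.2] with x e1 e2
      have := one_add_ne_zero (hre x)
      rw [e2, Pi.sub_apply, e1]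
      field_simp
      ring
    have h3 := hQ (p.1 - p.2)
    rw [h2] at h3
    refine h3.congr fun τ => ?_
    refine mulOp_eq_of_ae _ _ ?_
    filter_upwards [coeFn_quotient hm hre τ p.1, hR (p.1 - p.2)] with x e1 e2
    rw [h1] at e2
    rw [e1, expQuot]
    nth_rewrite 1 [e2]
    ring

end MulSemigroup

open scoped FourierTransform

/-! ### The Schwartz space as a core of a multiplication operator -/

section Core

variable {q : ℝ → ℂ} {C : ℝ}

theorem exists_norm_mul_schwartz_le (hC : ∀ x, ‖q x‖ ≤ C * (1 + |x|)) (v : 𝓢(ℝ, ℂ)) :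
    ∃ D : ℝ, ∀ x, ‖q x * v x‖ ≤ D * ((1 + |x|) ^ 2)⁻¹ := by
  have hC0 : 0 ≤ C := by
    have := (norm_nonneg _).trans (hC 0)
    simpa using this
  obtain ⟨D, hD0, hD⟩ := exists_decay v 3 0
  refine ⟨C * D, fun x => ?_⟩
  have h1 := hD x
  rw [iteratedDeriv_zero] at h1
  rw [norm_mul, ← div_eq_mul_inv, le_div_iff₀ (by positivity)]
  calc ‖q x‖ * ‖v x‖ * (1 + |x|) ^ 2 ≤ C * (1 + |x|) * ‖v x‖ * (1 + |x|) ^ 2 := by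
        gcongr
        exact hC x
    _ = C * ((1 + |x|) ^ 3 * ‖v x‖) := by ring
    _ ≤ C * D := by gcongr

theorem integrable_inv_one_add_abs_sq : Integrable fun x : ℝ => ((1 + |x|) ^ 2)⁻¹ := by
  have h : Integrable (fun x : ℝ => (1 + ‖x‖) ^ (-(2 : ℝ))) := integrable_one_add_norm (by simp)
  refine h.congr (Eventually.of_forall fun x => ?_)
  dsimp only
  rw [Real.rpow_neg (by positivity), Real.rpow_two, Real.norm_eq_abs]

theorem integrable_mul_schwartz (hq : Measurable q) (hC : ∀ x, ‖q x‖ ≤ C * (1 + |x|))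
    (v : 𝓢(ℝ, ℂ)) : Integrable fun x => q x * v x := by
  obtain ⟨D, hD⟩ := exists_norm_mul_schwartz_le hC v
  exact (integrable_inv_one_add_abs_sq.const_mul D).mono'
    (hq.mul v.continuous.measurable).aestronglyMeasurable (Eventually.of_forall hD)

theorem memLp_mul_schwartz (hq : Measurable q) (hC : ∀ x, ‖q x‖ ≤ C * (1 + |x|))
    (v : 𝓢(ℝ, ℂ)) : MemLp (fun x => q x * v x) 2 := by
  obtain ⟨D, hD⟩ := exists_norm_mul_schwartz_le hC v
  have hm : AEStronglyMeasurable (fun x => q x * v x) volume :=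
    (hq.mul v.continuous.measurable).aestronglyMeasurable
  rw [memLp_two_iff_integrable_sq_norm hm]
  refine (integrable_inv_one_add_abs_sq.const_mul (D ^ 2)).mono' (hm.norm.pow 2)
    (Eventually.of_forall fun x => ?_)
  rw [Real.norm_of_nonneg (by positivity)]
  have h1 : ((1 + |x|) ^ 2)⁻¹ ≤ 1 := by
    refine inv_le_one_of_one_le₀ ?_
    nlinarith [abs_nonneg x]
  have h2 : 0 ≤ ((1 + |x|) ^ 2)⁻¹ := by positivity
  calc ‖q x * v x‖ ^ 2 ≤ (D * ((1 + |x|) ^ 2)⁻¹) ^ 2 := by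
        gcongr
        exact hD x
    _ = D ^ 2 * (((1 + |x|) ^ 2)⁻¹ * ((1 + |x|) ^ 2)⁻¹) := by ring
    _ ≤ D ^ 2 * (((1 + |x|) ^ 2)⁻¹ * 1) := by gcongr
    _ = _ := by ring

theorem locallyIntegrable_mul (hq : Measurable q) (hC : ∀ x, ‖q x‖ ≤ C * (1 + |x|))
    (f : Lp ℂ 2 (volume : Measure ℝ)) : LocallyIntegrable fun x => q x * f x := by
  have hC0 : 0 ≤ C := by
    have := (norm_nonneg _).trans (hC 0)
    simpa using this
  rw [locallyIntegrable_iff]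
  intro K hK
  obtain ⟨R, hR⟩ := hK.isBounded.exists_norm_le
  have h1 : IntegrableOn f K := ((Lp.memLp f).locallyIntegrable (by norm_num)).integrableOn_isCompact hK
  refine (h1.norm.const_mul (C * (1 + R))).mono'
    (hq.aestronglyMeasurable.mul (Lp.aestronglyMeasurable f)).restrict ?_
  filter_upwards [ae_restrict_mem hK.measurableSet] with x hx
  rw [norm_mul]
  gcongr
  refine (hC x).trans ?_
  gcongr
  exact hR x hx

/-- The multiples `q v`, `v ∈ 𝓢(ℝ)`, as a subspace of `L²`. -/
def mulSchwartzSubmodule (q : ℝ → ℂ) : Submodule ℂ (Lp ℂ 2 (volume : Measure ℝ)) where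
  carrier := {h | ∃ v : 𝓢(ℝ, ℂ), h =ᵐ[volume] fun x => q x * v x}
  add_mem' := by
    rintro f g ⟨v, hv⟩ ⟨v', hv'⟩
    refine ⟨v + v', ?_⟩
    filter_upwards [hv, hv', Lp.coeFn_add f g] with x e1 e2 e3
    rw [e3, Pi.add_apply, e1, e2, _root_.add_apply, mul_add]
  zero_mem' := ⟨0, by
    filter_upwards [Lp.coeFn_zero ℂ 2 (volume : Measure ℝ)] with x e1
    rw [e1]
    simp⟩
  smul_mem' := by
    rintro c f ⟨v, hv⟩
    refine ⟨c • v, ?_⟩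
    filter_upwards [hv, Lp.coeFn_smul c f] with x e1 e2
    rw [e2, Pi.smul_apply, e1, _root_.smul_apply, smul_eq_mul, smul_eq_mul, mul_left_comm]

/-- A vector orthogonal to all q g, with g a test function, satisfies q̄ h = 0 almost everywhere,
and q has no zeros. -/
theorem dense_mulSchwartzSubmodule (hq : Measurable q) (hC : ∀ x, ‖q x‖ ≤ C * (1 + |x|))
    (h0 : ∀ x, q x ≠ 0) : Dense (mulSchwartzSubmodule q : Set (Lp ℂ 2 (volume : Measure ℝ))) := by
  rw [Submodule.dense_iff_topologicalClosure_eq_top, Submodule.topologicalClosure_eq_top_iff,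
    Submodule.eq_bot_iff]
  intro h hh
  have hconj : Measurable fun x => (starRingEnd ℂ) (q x) := Complex.continuous_conj.measurable.comp hq
  have h1 : ∀ᵐ x : ℝ, (starRingEnd ℂ) (q x) * h x = 0 := by
    refine ae_eq_zero_of_integral_contDiff_smul_eq_zero
      (locallyIntegrable_mul hconj (by simpa using hC) h) fun g hg hgc => ?_
    have hc : HasCompactSupport (fun t => (g t : ℂ)) := hgc.comp_left Complex.ofReal_zero
    have hs : ContDiff ℝ ∞ (fun t => (g t : ℂ)) := Complex.ofRealCLM.contDiff.comp hg
    set v := hc.toSchwartzMap hs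
    have h2 := (Submodule.mem_orthogonal _ _).1 hh ((memLp_mul_schwartz hq hC v).toLp _)
      ⟨v, MemLp.coeFn_toLp _⟩
    rw [inner_eq_integral] at h2
    rw [← h2]
    refine integral_congr_ae ?_
    filter_upwards [(memLp_mul_schwartz hq hC v).coeFn_toLp] with x e1
    have e2 : v x = (g x : ℂ) := rfl
    rw [e1, e2, map_mul, Complex.conj_ofReal, Complex.real_smul]
    ring
  refine (Lp.eq_zero_iff_ae_eq_zero).2 ?_
  filter_upwards [h1] with x hx
  exact (mul_eq_zero.1 hx).resolve_left (by simpa using h0 x)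

end Core

/-- Schwartz functions form a core. The whole graph is the image of L² under the continuous map h ↦
(Rh, Rh - h), and the dense subspace (1 + m)𝓢 is sent into the Schwartz part of the graph. -/
theorem closure_schwartzGraph {m : ℝ → ℂ} (hm : Measurable m) (hre : ∀ x, 0 ≤ (m x).re) {C : ℝ}
    (hC : ∀ x, ‖m x‖ ≤ C * (1 + |x|)) :
    closure {p : Lp ℂ 2 (volume : Measure ℝ) × Lp ℂ 2 (volume : Measure ℝ) |
      ∃ v : 𝓢(ℝ, ℂ), p.1 =ᵐ[volume] v ∧ p.2 =ᵐ[volume] fun x => -(m x * v x)} =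
      mulGraph m volume := by
  set R := mulOp volume (fun x => 1 / (1 + m x)) (by fun_prop) 1
        (fun x => norm_one_div_one_add_le (hre x)) with hRdef
  refine subset_antisymm (closure_minimal ?_ (isClosed_mulGraph hm hre)) fun p hp => ?_
  · rintro p ⟨v, h1, h2⟩
    change p.2 =ᵐ[volume] fun x => -(m x * p.1 x)
    filter_upwards [h1, h2] with x e1 e2
    rw [e1, e2]
  · have hd := dense_mulSchwartzSubmodule (q := fun x => 1 + m x) (C := 1 + C) (by fun_prop)
      (fun x => by
        refine (norm_add_le _ _).trans ?_
        rw [norm_one]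
        nlinarith [hC x, abs_nonneg x]) fun x => one_add_ne_zero (hre x)
    have hpR := (mem_mulGraph_iff hm hre p).1 hp
    have hcont : Continuous fun h : Lp ℂ 2 (volume : Measure ℝ) => (R h, R h - h) :=
      R.continuous.prodMk (R.continuous.sub continuous_id)
    have hp' : p = (R (p.1 - p.2), R (p.1 - p.2) - (p.1 - p.2)) := by
      rw [hRdef, hpR, sub_sub_cancel]
    rw [hp']
    refine map_mem_closure (f := fun h => (R h, R h - h)) hcont (hd.closure_eq ▸ mem_univ _) ?_
    rintro h ⟨v, hv⟩
    have hR : R h =ᵐ[volume] v := by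
      filter_upwards [coeFn_mulOp (μ := volume) (q := fun x => 1 / (1 + m x)) (by fun_prop)
        (fun x => norm_one_div_one_add_le (hre x)) h, hv] with x e1 e2
      have := one_add_ne_zero (hre x)
      rw [e1, e2]
      field_simp
    refine ⟨v, hR, ?_⟩
    filter_upwards [hR, hv, Lp.coeFn_sub (R h) h] with x e1 e2 e3
    rw [e3, Pi.sub_apply, e1, e2]
    ring

/-! ### The inverse Fourier integral on `L¹ ∩ L²` -/

/-- The inverse Fourier integral. -/
def invFourierIntegral (g : ℝ → ℂ) (y : ℝ) : ℂ :=
  ∫ ξ : ℝ, Complex.exp (2 * Real.pi * Complex.I * ξ * y) * g ξ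

theorem norm_exp_two_pi (ξ y : ℝ) : ‖Complex.exp (2 * Real.pi * Complex.I * ξ * y)‖ = 1 := by
  have : 2 * Real.pi * Complex.I * ξ * y = ((2 * Real.pi * ξ * y : ℝ) : ℂ) * Complex.I := by
    push_cast
    ring
  rw [this, Complex.norm_exp_ofReal_mul_I]

theorem integrable_exp_mul {g : ℝ → ℂ} (hg : Integrable g) (y : ℝ) :
    Integrable fun ξ : ℝ => Complex.exp (2 * Real.pi * Complex.I * ξ * y) * g ξ := by
  refine hg.norm.mono' (AEStronglyMeasurable.mul
    (Continuous.aestronglyMeasurable (by fun_prop)) hg.1) (Eventually.of_forall fun ξ => ?_)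
  rw [norm_mul, norm_exp_two_pi, one_mul]

theorem schwartz_fourierInv_apply (φ : 𝓢(ℝ, ℂ)) (y : ℝ) :
    (𝓕⁻ φ) y = invFourierIntegral φ y := by
  rw [SchwartzMap.fourierInv_coe, Real.fourierInv_eq', invFourierIntegral]
  refine integral_congr_ae (Eventually.of_forall fun ξ => ?_)
  simp only [RCLike.inner_apply, conj_trivial, smul_eq_mul]
  congr 2
  push_cast
  ring

theorem continuous_invFourierIntegral {g : ℝ → ℂ} (hg : Integrable g) :
    Continuous (invFourierIntegral g) := by
  refine continuous_of_dominated (bound := fun ξ => ‖g ξ‖) (fun y => (integrable_exp_mul hg y).1)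
    (fun y => Eventually.of_forall fun ξ => ?_) hg.norm (Eventually.of_forall fun ξ => by fun_prop)
  rw [norm_mul, norm_exp_two_pi, one_mul]

/-- Links the Plancherel transform with the integral. It is needed since the product of the symbol
with a Schwartz function need not be Schwartz, though it is in L¹ ∩ L². Both sides are tested
against smooth compactly supported functions and Fubini is applied. -/
theorem coeFn_fourierInv {g : ℝ → ℂ} (hg : Integrable g) {G : Lp ℂ 2 (volume : Measure ℝ)}
    (hG : G =ᵐ[volume] g) :
    (Lp.fourierTransformₗᵢ ℝ ℂ).symm G =ᵐ[volume] invFourierIntegral g := by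
  refine ae_eq_of_integral_contDiff_smul_eq ((Lp.memLp _).locallyIntegrable (by norm_num))
    (continuous_invFourierIntegral hg).locallyIntegrable fun f hf hfc => ?_
  have hc : HasCompactSupport (fun t => (f t : ℂ)) := hfc.comp_left Complex.ofReal_zero
  have hs : ContDiff ℝ ∞ (fun t => (f t : ℂ)) := Complex.ofRealCLM.contDiff.comp hf
  set v := hc.toSchwartzMap hs
  have h1 := congrArg (fun T : 𝓢'(ℝ, ℂ) => T v) (Lp.fourierInv_toTemperedDistribution_eq G)
  simp only [TemperedDistribution.fourierInv_apply, Lp.toTemperedDistribution_apply] at h1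
  have h2 : ∫ x, f x • (Lp.fourierTransformₗᵢ ℝ ℂ).symm G x = ∫ x, v x • (𝓕⁻ G) x := rfl
  rw [h2, ← h1]
  have hI : Integrable (fun p : ℝ × ℝ =>
      Complex.exp (2 * Real.pi * Complex.I * p.2 * p.1) * v p.1 * g p.2) (volume.prod volume) := by
    have h3 := (v.integrable (μ := volume)).mul_prod hg
    refine h3.norm.mono' ?_ (Eventually.of_forall fun p => ?_)
    · have h4 : AEStronglyMeasurable (fun p : ℝ × ℝ =>
        Complex.exp (2 * Real.pi * Complex.I * p.2 * p.1)) (volume.prod volume) :=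
        Continuous.aestronglyMeasurable (by fun_prop)
      refine (h4.mul h3.1).congr (Eventually.of_forall fun p => ?_)
      simp only [Pi.mul_apply]
      ring
    · rw [mul_assoc, norm_mul, norm_exp_two_pi, one_mul]
  have h5 := integral_integral_swap (f := fun y ξ : ℝ =>
    Complex.exp (2 * Real.pi * Complex.I * ξ * y) * v y * g ξ) hI
  have h6 : ∫ y, f y • invFourierIntegral g y =
      ∫ y : ℝ, ∫ ξ : ℝ, Complex.exp (2 * Real.pi * Complex.I * ξ * y) * v y * g ξ := by
    refine integral_congr_ae (Eventually.of_forall fun y => ?_)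
    have e2 : v y = (f y : ℂ) := rfl
    simp only [invFourierIntegral, Complex.real_smul]
    rw [← integral_const_mul]
    refine integral_congr_ae (Eventually.of_forall fun ξ => ?_)
    simp only [e2]
    ring
  rw [h6, h5]
  refine integral_congr_ae ?_
  filter_upwards [hG] with ξ e1
  rw [e1, schwartz_fourierInv_apply, invFourierIntegral, smul_eq_mul, ← integral_mul_const]
  refine integral_congr_ae (Eventually.of_forall fun y => ?_)
  dsimp only
  congr 3
  ring

/-! ### The Fourier symbol -/

/-- The point `2πiξ` of the imaginary axis. -/
def imagAxis (ξ : ℝ) : ℂ := 2 * Real.pi * Complex.I * ξ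

theorem continuous_imagAxis : Continuous imagAxis := by
  unfold imagAxis
  fun_prop

@[fun_prop]
theorem measurable_imagAxis : Measurable imagAxis := continuous_imagAxis.measurable

theorem imagAxis_re (ξ : ℝ) : (imagAxis ξ).re = 0 := by simp [imagAxis]

theorem norm_imagAxis (ξ : ℝ) : ‖imagAxis ξ‖ = 2 * Real.pi * |ξ| := by
  simp [imagAxis, abs_of_pos Real.pi_pos]

theorem norm_imagAxis_le (ξ : ℝ) (t : ℝ) : ‖imagAxis ξ‖ ≤ ‖imagAxis ξ + t‖ := by
  have h1 : ‖imagAxis ξ‖ = |(imagAxis ξ + t).im| := by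
    rw [norm_imagAxis]
    simp [imagAxis, abs_mul, abs_of_pos Real.pi_pos]
  rw [h1]
  exact Complex.abs_im_le_norm _

theorem le_norm_imagAxis_add (ξ : ℝ) (t : ℝ) : t ≤ ‖imagAxis ξ + t‖ := by
  have := norm_add_ofReal_ge (s := imagAxis ξ) (t := t)
  rwa [imagAxis_re, zero_add] at this

/-- On the imaginary axis |s + t| dominates both |s| and t. The bound is σ-integrable in t and
linear in |s|, which gives both existence and linear growth of the symbol. -/
theorem norm_imagAxis_div_le (ξ : ℝ) {t : ℝ} (ht : 0 < t) :
    ‖imagAxis ξ / (imagAxis ξ + t)‖ ≤ 2 * (1 + ‖imagAxis ξ‖) * (1 / (1 + t)) := by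
  have h1 := norm_imagAxis_le ξ t
  have h2 := le_norm_imagAxis_add ξ t
  have h3 : 0 < ‖imagAxis ξ + t‖ := ht.trans_le h2
  rw [norm_div, mul_one_div, div_le_div_iff₀ h3 (by positivity)]
  have h4 := norm_nonneg (imagAxis ξ)
  nlinarith [mul_le_mul_of_nonneg_left h2 h4]

theorem imagAxis_div_re_nonneg (ξ : ℝ) (t : ℝ) : 0 ≤ (imagAxis ξ / (imagAxis ξ + t)).re := by
  rw [Complex.div_re, imagAxis_re, zero_mul, zero_div, zero_add]
  refine div_nonneg ?_ (Complex.normSq_nonneg _)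
  rw [Complex.add_im, Complex.ofReal_im, add_zero]
  exact mul_self_nonneg _

variable {a b : ℝ} {σ : Measure ℝ}

theorem IsStieltjesMeasure.integrable_imagAxis_div (hσ : IsStieltjesMeasure σ) (ξ : ℝ) :
    Integrable (fun t : ℝ => imagAxis ξ / (imagAxis ξ + t)) σ :=
  hσ.integrable_of_norm_le (Measurable.aestronglyMeasurable (by fun_prop)) fun _ ht =>
    norm_imagAxis_div_le ξ ht

theorem measurable_bernstein_imagAxis [SFinite σ] :
    Measurable fun ξ => bernstein a b σ (imagAxis ξ) := by
  unfold bernstein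
  have h : Measurable fun p : ℝ × ℝ => imagAxis p.1 / (imagAxis p.1 + p.2) := by fun_prop
  have h2 := h.stronglyMeasurable.integral_prod_right' (ν := σ)
  exact ((measurable_const.add (measurable_imagAxis.const_mul _))).add h2.measurable

theorem bernstein_imagAxis_re_nonneg (ha : 0 ≤ a) (hσ : IsStieltjesMeasure σ) (ξ : ℝ) :
    0 ≤ (bernstein a b σ (imagAxis ξ)).re := by
  have h1 : (∫ t, imagAxis ξ / (imagAxis ξ + t) ∂σ).re =
      ∫ t : ℝ, (imagAxis ξ / (imagAxis ξ + t)).re ∂σ :=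
    (integral_re (hσ.integrable_imagAxis_div ξ)).symm
  rw [bernstein, Complex.add_re, h1, Complex.add_re, Complex.re_ofReal_mul, imagAxis_re, mul_zero,
    add_zero, Complex.ofReal_re]
  exact add_nonneg ha (integral_nonneg fun t => imagAxis_div_re_nonneg ξ t)

theorem exists_norm_bernstein_imagAxis_le (a b : ℝ) (hσ : IsStieltjesMeasure σ) :
    ∃ C : ℝ, ∀ ξ, ‖bernstein a b σ (imagAxis ξ)‖ ≤ C * (1 + |ξ|) := by
  set I := ∫ t, 1 / (1 + t) ∂σ
  have hI : 0 ≤ I := integral_nonneg_of_ae (by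
    filter_upwards [hσ.ae_pos] with t ht
    change (0 : ℝ) ≤ 1 / (1 + t)
    positivity)
  refine ⟨|a| + |b| * (2 * Real.pi) + 4 * Real.pi * I, fun ξ => ?_⟩
  have hπ := Real.pi_gt_three
  have h1 : ‖∫ t, imagAxis ξ / (imagAxis ξ + t) ∂σ‖ ≤ 2 * (1 + 2 * Real.pi * |ξ|) * I := by
    rw [← integral_const_mul]
    refine norm_integral_le_of_norm_le (hσ.integrable.const_mul _) ?_
    filter_upwards [hσ.ae_pos] with t ht
    rw [← norm_imagAxis]
    exact norm_imagAxis_div_le ξ ht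
  have h2 : ‖bernstein a b σ (imagAxis ξ)‖ ≤
      |a| + |b| * (2 * Real.pi * |ξ|) + 2 * (1 + 2 * Real.pi * |ξ|) * I := by
    refine (norm_add_le _ _).trans (add_le_add ((norm_add_le _ _).trans_eq ?_) h1)
    rw [norm_mul, norm_imagAxis, Complex.norm_real, Complex.norm_real, Real.norm_eq_abs,
      Real.norm_eq_abs]
  refine h2.trans ?_
  have h3 := abs_nonneg ξ
  have h4 := abs_nonneg a
  have h5 : 0 ≤ |b| * (2 * Real.pi) := by positivity
  have h6 : 2 * (1 + 2 * Real.pi * |ξ|) * I ≤ 4 * Real.pi * I * (1 + |ξ|) := by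
    have : 0 ≤ I * (4 * Real.pi - 2) := mul_nonneg hI (by linarith)
    nlinarith
  nlinarith [mul_nonneg h4 h3]

/-! ### The derivative as a Fourier multiplier -/

theorem exp_imagAxis (ξ y : ℝ) :
    Complex.exp (2 * Real.pi * Complex.I * ξ * y) = Complex.exp (imagAxis ξ * y) := rfl

theorem schwartz_apply_eq (v : 𝓢(ℝ, ℂ)) (y : ℝ) : v y = invFourierIntegral (𝓕 v : 𝓢(ℝ, ℂ)) y := by
  rw [← schwartz_fourierInv_apply, FourierTransform.fourierInv_fourier_eq]

theorem fourier_der_apply (v : 𝓢(ℝ, ℂ)) (ξ : ℝ) : 𝓕 (der v) ξ = imagAxis ξ * 𝓕 v ξ := by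
  have h := congrFun (Real.fourier_deriv (v.integrable (μ := volume)) v.differentiable
    ((der v).integrable (μ := volume))) ξ
  rw [SchwartzMap.fourier_coe, SchwartzMap.fourier_coe]
  exact h

theorem deriv_schwartz_eq (v : 𝓢(ℝ, ℂ)) (y : ℝ) :
    deriv v y = invFourierIntegral (fun ξ => imagAxis ξ * 𝓕 v ξ) y := by
  have h := schwartz_apply_eq (der v) y
  simp only [invFourierIntegral, fourier_der_apply] at h
  exact h

/-- The kernel e^{-rt} on r > 0 has Fourier symbol 1/(s + t) at s = 2πiξ; the derivative supplies
the factor s. -/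
theorem integral_exp_mul_deriv (v : 𝓢(ℝ, ℂ)) (y : ℝ) {t : ℝ} (ht : 0 < t) :
    ∫ r in Ioi (0 : ℝ), (Real.exp (-(r * t)) : ℂ) * deriv v (y - r) =
      invFourierIntegral (fun ξ => imagAxis ξ / (imagAxis ξ + t) * 𝓕 v ξ) y := by
  have hg : Integrable fun ξ => imagAxis ξ * 𝓕 v ξ := by
    refine ((𝓕 (der v)).integrable (μ := volume)).congr (Eventually.of_forall fun ξ => ?_)
    exact fourier_der_apply v ξ
  have he : IntegrableOn (fun r : ℝ => (Real.exp (-(r * t)) : ℂ)) (Ioi 0) := by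
    have := (integrableOn_exp_mul_Ioi (show -t < 0 by linarith) 0).ofReal (𝕜 := ℂ)
    refine this.congr (Eventually.of_forall fun r => ?_)
    simp only [Complex.coe_algebraMap]
    ring_nf
  have hI : Integrable (fun p : ℝ × ℝ => Complex.exp (imagAxis p.2 * (y - p.1 : ℝ)) *
      ((Real.exp (-(p.1 * t)) : ℂ) * (imagAxis p.2 * 𝓕 v p.2)))
      ((volume.restrict (Ioi 0)).prod volume) := by
    have h3 := he.mul_prod hg
    refine h3.norm.mono' ?_ (Eventually.of_forall fun p => ?_)
    · have h4 : Continuous (fun p : ℝ × ℝ => Complex.exp (imagAxis p.2 * (y - p.1 : ℝ))) := by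
        have := continuous_imagAxis
        fun_prop
      exact h4.aestronglyMeasurable.mul h3.1
    · rw [norm_mul, ← exp_imagAxis, norm_exp_two_pi, one_mul]
  have h5 := integral_integral_swap (f := fun r ξ : ℝ => Complex.exp (imagAxis ξ * (y - r : ℝ)) *
      ((Real.exp (-(r * t)) : ℂ) * (imagAxis ξ * 𝓕 v ξ))) hI
  have h6 : ∫ r in Ioi (0 : ℝ), (Real.exp (-(r * t)) : ℂ) * deriv v (y - r) =
      ∫ r in Ioi (0 : ℝ), ∫ ξ : ℝ, Complex.exp (imagAxis ξ * (y - r : ℝ)) *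
      ((Real.exp (-(r * t)) : ℂ) * (imagAxis ξ * 𝓕 v ξ)) := by
    refine integral_congr_ae (Eventually.of_forall fun r => ?_)
    dsimp only
    rw [deriv_schwartz_eq, invFourierIntegral, ← integral_const_mul]
    refine integral_congr_ae (Eventually.of_forall fun ξ => ?_)
    dsimp only
    rw [exp_imagAxis]
    ring
  rw [h6, h5, invFourierIntegral]
  refine integral_congr_ae (Eventually.of_forall fun ξ => ?_)
  have hs : 0 < (imagAxis ξ + t).re := by
    rw [Complex.add_re, imagAxis_re, Complex.ofReal_re]
    linarith
  have h7 := integral_pow_mul_exp hs 0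
  simp only [pow_zero, one_mul, Nat.factorial_zero, Nat.cast_one, zero_add, pow_one] at h7
  dsimp only
  rw [exp_imagAxis, div_mul_eq_mul_div, ← mul_one_div (imagAxis ξ * 𝓕 v ξ), ← h7,
    ← integral_const_mul, ← integral_const_mul]
  refine integral_congr_ae (Eventually.of_forall fun r => ?_)
  dsimp only
  have h8 : Complex.exp (imagAxis ξ * (y - r : ℝ)) * (Real.exp (-(r * t)) : ℂ) =
      Complex.exp (imagAxis ξ * y) * Complex.exp (-((imagAxis ξ + t) * r)) := by
    rw [Complex.ofReal_exp, ← Complex.exp_add, ← Complex.exp_add]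
    congr 1
    push_cast
    ring
  linear_combination (imagAxis ξ * 𝓕 v ξ) * h8

/-- Fubini in (t, ξ), with majorant a product of 1/(1 + t) and an integrable function of ξ: the
superposition over σ may be taken inside the symbol. -/
theorem IsStieltjesMeasure.integral_invFourierIntegral (hσ : IsStieltjesMeasure σ) (v : 𝓢(ℝ, ℂ))
    (y : ℝ) :
    Integrable (fun ξ => (∫ t, imagAxis ξ / (imagAxis ξ + t) ∂σ) * 𝓕 v ξ) ∧
    ∫ t, invFourierIntegral (fun ξ => imagAxis ξ / (imagAxis ξ + t) * 𝓕 v ξ) y ∂σ =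
      invFourierIntegral (fun ξ => (∫ t, imagAxis ξ / (imagAxis ξ + t) ∂σ) * 𝓕 v ξ) y := by
  have := hσ.sigmaFinite
  have hg : Integrable fun ξ => 2 * (1 + ‖imagAxis ξ‖) * ‖𝓕 v ξ‖ := by
    have h1 : Integrable fun ξ => imagAxis ξ * 𝓕 v ξ := by
      refine ((𝓕 (der v)).integrable (μ := volume)).congr (Eventually.of_forall fun ξ => ?_)
      exact fourier_der_apply v ξ
    refine ((((𝓕 v).integrable (μ := volume)).norm.add h1.norm).const_mul 2).congr
      (Eventually.of_forall fun ξ => ?_)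
    simp only [Pi.add_apply, norm_mul]
    ring
  have hI : Integrable (fun p : ℝ × ℝ => Complex.exp (imagAxis p.2 * y) *
      (imagAxis p.2 / (imagAxis p.2 + p.1) * 𝓕 v p.2)) (σ.prod volume) := by
    refine (hσ.integrable.mul_prod hg).mono' ?_ ?_
    · have : Measurable (𝓕 v : 𝓢(ℝ, ℂ)) := (𝓕 v).continuous.measurable
      exact Measurable.aestronglyMeasurable (by fun_prop)
    · have hpos : ∀ᵐ p ∂(σ.prod (volume : Measure ℝ)), (0 : ℝ) < p.1 :=
        Measure.quasiMeasurePreserving_fst.ae hσ.ae_pos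
      filter_upwards [hpos] with p hp
      rw [norm_mul, ← exp_imagAxis, norm_exp_two_pi, one_mul, norm_mul]
      have := norm_imagAxis_div_le p.2 hp
      calc _ ≤ 2 * (1 + ‖imagAxis p.2‖) * (1 / (1 + p.1)) * ‖𝓕 v p.2‖ := by gcongr
        _ = _ := by ring
  constructor
  · refine (hg.mul_const (∫ t, 1 / (1 + t) ∂σ)).mono' ?_ (Eventually.of_forall fun ξ => ?_)
    · have h : Measurable fun p : ℝ × ℝ => imagAxis p.1 / (imagAxis p.1 + p.2) := by fun_prop
      have h2 := h.stronglyMeasurable.integral_prod_right' (ν := σ)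
      exact h2.aestronglyMeasurable.mul (𝓕 v).continuous.aestronglyMeasurable
    · rw [norm_mul, mul_right_comm]
      refine mul_le_mul_of_nonneg_right ?_ (norm_nonneg _)
      rw [← integral_const_mul]
      refine norm_integral_le_of_norm_le (hσ.integrable.const_mul _) ?_
      filter_upwards [hσ.ae_pos] with t ht using norm_imagAxis_div_le ξ ht
  · have h5 := integral_integral_swap (f := fun t ξ : ℝ => Complex.exp (imagAxis ξ * y) *
      (imagAxis ξ / (imagAxis ξ + t) * 𝓕 v ξ)) hI
    simp only [invFourierIntegral, exp_imagAxis]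
    rw [h5]
    refine integral_congr_ae (Eventually.of_forall fun ξ => ?_)
    dsimp only
    rw [integral_const_mul, integral_mul_const]

/-- On Schwartz functions the operator with kernel `b δ₀ + (a + ∫ e^{-rt} σ(dt)) dr`, composed with
the derivative, is the Fourier multiplier with symbol `bernstein a b σ (2πiξ)`. -/
theorem convSchwartz_der_eq_invFourierIntegral (hσ : IsStieltjesMeasure σ) {T : 𝓢'(ℝ, ℂ)}
    (hφ : ∀ φ : 𝓢(ℝ, ℂ),
      T φ = b * φ 0 + ∫ r in Ioi (0 : ℝ), (stieltjesDensity a σ r : ℂ) * φ r)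
    (v : 𝓢(ℝ, ℂ)) (y : ℝ) :
    convSchwartz T (der v) y =
      invFourierIntegral (fun ξ => bernstein a b σ (imagAxis ξ) * 𝓕 v ξ) y := by
  obtain ⟨hI, hσv⟩ := hσ.integral_invFourierIntegral v y
  have h1 : ∫ t, (∫ r in Ioi (0 : ℝ), (Real.exp (-(r * t)) : ℂ) * deriv v (y - r)) ∂σ =
      ∫ t, invFourierIntegral (fun ξ => imagAxis ξ / (imagAxis ξ + t) * 𝓕 v ξ) y ∂σ := by
    refine integral_congr_ae ?_
    filter_upwards [hσ.ae_pos] with t ht using integral_exp_mul_deriv v y ht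
  have hg : Integrable fun ξ => imagAxis ξ * 𝓕 v ξ := by
    refine ((𝓕 (der v)).integrable (μ := volume)).congr (Eventually.of_forall fun ξ => ?_)
    exact fourier_der_apply v ξ
  have i1 := (integrable_exp_mul ((𝓕 v).integrable (μ := volume)) y).const_mul (a : ℂ)
  have i2 := (integrable_exp_mul hg y).const_mul (b : ℂ)
  have i3 := integrable_exp_mul hI y
  rw [convSchwartz_der_eq hσ hφ, h1, hσv, deriv_schwartz_eq, schwartz_apply_eq v y]
  simp only [invFourierIntegral]
  rw [← integral_const_mul, ← integral_const_mul, ← integral_add i1 i2]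
  refine (integral_add (i1.add i2) i3).symm.trans ?_
  refine integral_congr_ae (Eventually.of_forall fun ξ => ?_)
  simp only [bernstein, Pi.add_apply]
  ring

/-! ### Positivity preserving Fourier multipliers -/

/-- Testing with indicators of sets of finite measure shows that all set integrals of h have
non-negative real part and zero imaginary part. -/
theorem ae_nonneg_of_inner_nonneg {h : Lp ℂ 2 (volume : Measure ℝ)}
    (H : ∀ g : Lp ℂ 2 (volume : Measure ℝ), (∀ᵐ x, 0 ≤ g x) → 0 ≤ inner ℂ g h) :
    ∀ᵐ x, 0 ≤ h x := by
  have hint (s : Set ℝ) (hs : volume s < ⊤) : IntegrableOn h s := by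
    have : IsFiniteMeasure (volume.restrict s) := ⟨by simpa using hs⟩
    exact ((Lp.memLp h).restrict s).integrable (by norm_num)
  have hset (s : Set ℝ) (hs : MeasurableSet s) (hμ : volume s < ⊤) : 0 ≤ ∫ x in s, h x := by
    rw [← L2.inner_indicatorConstLp_one (𝕜 := ℂ) hs hμ.ne]
    refine H _ ?_
    filter_upwards [indicatorConstLp_coeFn (p := 2) (hs := hs) (hμs := hμ.ne) (c := (1 : ℂ))]
      with x hx
    rw [hx]
    exact indicator_nonneg (fun _ _ => zero_le_one) x
  have h1 : 0 ≤ᵐ[volume] fun x => (h x).re := by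
    refine ae_nonneg_of_forall_setIntegral_nonneg_of_sigmaFinite
      (fun s _ hμ => (hint s hμ).re) fun s hs hμ => ?_
    have := (Complex.nonneg_iff.1 (hset s hs hμ)).1
    rwa [← show ∫ x in s, (h x).re = (∫ x in s, h x).re from integral_re (hint s hμ)] at this
  have h2 : (fun x => (h x).im) =ᵐ[volume] 0 := by
    refine ae_eq_zero_of_forall_setIntegral_eq_of_sigmaFinite
      (fun s _ hμ => (hint s hμ).im) fun s hs hμ => ?_
    have := (Complex.nonneg_iff.1 (hset s hs hμ)).2
    rw [← show ∫ x in s, (h x).im = (∫ x in s, h x).im from integral_im (hint s hμ)] at this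
    exact this.symm
  filter_upwards [h1, h2] with x e1 e2
  exact Complex.nonneg_iff.2 ⟨e1, e2.symm⟩

theorem inner_nonneg_of_ae_nonneg {f g : Lp ℂ 2 (volume : Measure ℝ)} (hf : ∀ᵐ x, 0 ≤ f x)
    (hg : ∀ᵐ x, 0 ≤ g x) : 0 ≤ inner ℂ f g := by
  rw [inner_eq_integral]
  refine integral_nonneg_of_ae ?_
  filter_upwards [hf, hg] with x e1 e2
  exact mul_nonneg (star_nonneg_iff.2 e1) e2

/-- The sesquilinear form `⟨ĝ, q f̂⟩` of the Fourier multiplier `q`. -/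
def multForm (q : ℝ → ℂ) (f g : Lp ℂ 2 (volume : Measure ℝ)) : ℂ :=
  ∫ ξ, (starRingEnd ℂ) (Lp.fourierTransformₗᵢ ℝ ℂ g ξ) * (q ξ * Lp.fourierTransformₗᵢ ℝ ℂ f ξ)

/-- Bounded Fourier multipliers that preserve positivity. -/
structure IsPosMult (q : ℝ → ℂ) : Prop where
  measurable : Measurable q
  bounded : ∃ C, ∀ ξ, ‖q ξ‖ ≤ C
  nonneg : ∀ f g : Lp ℂ 2 (volume : Measure ℝ), (∀ᵐ x, 0 ≤ f x) → (∀ᵐ x, 0 ≤ g x) →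
    0 ≤ multForm q f g

theorem multForm_eq_inner {q : ℝ → ℂ} (hq : Measurable q) {C : ℝ} (hC : ∀ ξ, ‖q ξ‖ ≤ C)
    (f g : Lp ℂ 2 (volume : Measure ℝ)) :
    multForm q f g = inner ℂ g ((Lp.fourierTransformₗᵢ ℝ ℂ).symm
      (mulOp volume q hq C hC (Lp.fourierTransformₗᵢ ℝ ℂ f))) := by
  rw [← (Lp.fourierTransformₗᵢ ℝ ℂ).inner_map_map, LinearIsometryEquiv.apply_symm_apply,
    inner_eq_integral, multForm]
  refine integral_congr_ae ?_
  filter_upwards [coeFn_mulOp (μ := volume) hq hC (Lp.fourierTransformₗᵢ ℝ ℂ f)] with ξ e1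
  rw [e1]

theorem integrable_multForm {q : ℝ → ℂ} (hq : Measurable q) {C : ℝ} (hC : ∀ ξ, ‖q ξ‖ ≤ C)
    (f g : Lp ℂ 2 (volume : Measure ℝ)) :
    Integrable fun ξ => (starRingEnd ℂ) (Lp.fourierTransformₗᵢ ℝ ℂ g ξ) *
      (q ξ * Lp.fourierTransformₗᵢ ℝ ℂ f ξ) := by
  refine (integrable_conj_mul (Lp.fourierTransformₗᵢ ℝ ℂ g)
    (mulOp volume q hq C hC (Lp.fourierTransformₗᵢ ℝ ℂ f))).congr ?_
  filter_upwards [coeFn_mulOp (μ := volume) hq hC (Lp.fourierTransformₗᵢ ℝ ℂ f)] with ξ e1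
  rw [e1]

namespace IsPosMult

theorem ae_nonneg {q : ℝ → ℂ} (h : IsPosMult q) {C : ℝ} (hC : ∀ ξ, ‖q ξ‖ ≤ C)
    {f : Lp ℂ 2 (volume : Measure ℝ)} (hf : ∀ᵐ x, 0 ≤ f x) :
    ∀ᵐ x, 0 ≤ (Lp.fourierTransformₗᵢ ℝ ℂ).symm
      (mulOp volume q h.measurable C hC (Lp.fourierTransformₗᵢ ℝ ℂ f)) x := by
  refine ae_nonneg_of_inner_nonneg fun g hg => ?_
  rw [← multForm_eq_inner]
  exact h.nonneg f g hf hg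

theorem of_ae_nonneg {q : ℝ → ℂ} (hq : Measurable q) {C : ℝ} (hC : ∀ ξ, ‖q ξ‖ ≤ C)
    (h : ∀ f : Lp ℂ 2 (volume : Measure ℝ), (∀ᵐ x, 0 ≤ f x) →
      ∀ᵐ x, 0 ≤ (Lp.fourierTransformₗᵢ ℝ ℂ).symm
        (mulOp volume q hq C hC (Lp.fourierTransformₗᵢ ℝ ℂ f)) x) : IsPosMult q :=
  ⟨hq, ⟨C, hC⟩, fun f g hf hg => by
    rw [multForm_eq_inner hq hC]
    exact inner_nonneg_of_ae_nonneg hg (h f hf)⟩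

/-- A product of symbols is a composition of operators, so here the pointwise form of positivity is
used. Sums, limits and integrals are instead handled on the scalar form `multForm`. -/
theorem mul {q q' : ℝ → ℂ} (h : IsPosMult q) (h' : IsPosMult q') :
    IsPosMult fun ξ => q ξ * q' ξ := by
  obtain ⟨C, hC⟩ := h.bounded
  obtain ⟨C', hC'⟩ := h'.bounded
  have hCC (ξ : ℝ) : ‖q ξ * q' ξ‖ ≤ C * C' := by
    rw [norm_mul]
    exact mul_le_mul (hC ξ) (hC' ξ) (norm_nonneg _) ((norm_nonneg _).trans (hC ξ))
  refine of_ae_nonneg (h.measurable.mul h'.measurable) hCC fun f hf => ?_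
  have h1 := h.ae_nonneg hC (h'.ae_nonneg hC' hf)
  rw [LinearIsometryEquiv.apply_symm_apply] at h1
  have h2 : mulOp volume (fun ξ => q ξ * q' ξ) (h.measurable.mul h'.measurable) (C * C') hCC
      (Lp.fourierTransformₗᵢ ℝ ℂ f) = mulOp volume q h.measurable C hC
        (mulOp volume q' h'.measurable C' hC' (Lp.fourierTransformₗᵢ ℝ ℂ f)) := by
    refine mulOp_eq_of_ae _ _ ?_
    filter_upwards [coeFn_mulOp (μ := volume) h.measurable hC (mulOp volume q' h'.measurable C' hC'
      (Lp.fourierTransformₗᵢ ℝ ℂ f)), coeFn_mulOp (μ := volume) h'.measurable hC'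
      (Lp.fourierTransformₗᵢ ℝ ℂ f)] with ξ e1 e2
    rw [e1, e2, mul_assoc]
  rw [h2]
  exact h1

theorem add {q q' : ℝ → ℂ} (h : IsPosMult q) (h' : IsPosMult q') :
    IsPosMult fun ξ => q ξ + q' ξ := by
  obtain ⟨C, hC⟩ := h.bounded
  obtain ⟨C', hC'⟩ := h'.bounded
  refine ⟨h.measurable.add h'.measurable, ⟨C + C', fun ξ => (norm_add_le _ _).trans
    (add_le_add (hC ξ) (hC' ξ))⟩, fun f g hf hg => ?_⟩
  have h1 : multForm (fun ξ => q ξ + q' ξ) f g = multForm q f g + multForm q' f g := by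
    rw [multForm, multForm, multForm, ← integral_add (integrable_multForm h.measurable hC f g)
      (integrable_multForm h'.measurable hC' f g)]
    refine integral_congr_ae (Eventually.of_forall fun ξ => ?_)
    dsimp only
    ring
  rw [h1]
  exact add_nonneg (h.nonneg f g hf hg) (h'.nonneg f g hf hg)

theorem const {c : ℝ} (hc : 0 ≤ c) : IsPosMult fun _ => (c : ℂ) := by
  refine ⟨measurable_const, ⟨‖(c : ℂ)‖, fun _ => le_rfl⟩, fun f g hf hg => ?_⟩
  have h1 : multForm (fun _ => (c : ℂ)) f g = c * inner ℂ g f := by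
    rw [← (Lp.fourierTransformₗᵢ ℝ ℂ).inner_map_map, inner_eq_integral, multForm,
      ← integral_const_mul]
    refine integral_congr_ae (Eventually.of_forall fun ξ => ?_)
    dsimp only
    ring
  rw [h1]
  exact mul_nonneg (by exact_mod_cast hc) (inner_nonneg_of_ae_nonneg hg hf)

theorem const_mul {q : ℝ → ℂ} (h : IsPosMult q) {c : ℝ} (hc : 0 ≤ c) :
    IsPosMult fun ξ => (c : ℂ) * q ξ := (const hc).mul h

theorem pow {q : ℝ → ℂ} (h : IsPosMult q) (k : ℕ) : IsPosMult fun ξ => q ξ ^ k := by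
  induction k with
  | zero => simpa using const zero_le_one
  | succ k ih => simpa only [pow_succ] using ih.mul h

theorem of_tendsto {q : ℕ → ℝ → ℂ} {q₀ : ℝ → ℂ} (h : ∀ N, IsPosMult (q N)) {C : ℝ}
    (hC : ∀ N ξ, ‖q N ξ‖ ≤ C) (hlim : ∀ ξ, Tendsto (fun N => q N ξ) atTop (𝓝 (q₀ ξ))) :
    IsPosMult q₀ := by
  have hm : Measurable q₀ := measurable_of_tendsto_metrizable (fun N => (h N).measurable)
    (tendsto_pi_nhds.2 hlim)
  refine ⟨hm, ⟨C, fun ξ => le_of_tendsto (hlim ξ).norm (Eventually.of_forall fun N => hC N ξ)⟩,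
    fun f g hf hg => ?_⟩
  have h1 : Tendsto (fun N => multForm (q N) f g) atTop (𝓝 (multForm q₀ f g)) := by
    refine tendsto_integral_of_dominated_convergence
      (fun ξ => C * ‖(starRingEnd ℂ) (Lp.fourierTransformₗᵢ ℝ ℂ g ξ) *
        Lp.fourierTransformₗᵢ ℝ ℂ f ξ‖)
      (fun N => (integrable_multForm (h N).measurable (hC N) f g).1)
      ((integrable_conj_mul _ _).norm.const_mul C) (fun N => Eventually.of_forall fun ξ => ?_)
      (Eventually.of_forall fun ξ => ((hlim ξ).mul_const _).const_mul _)
    rw [norm_mul, norm_mul, norm_mul, mul_left_comm]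
    exact mul_le_mul_of_nonneg_right (hC N ξ) (by positivity)
  exact ge_of_tendsto h1 (Eventually.of_forall fun N => (h N).nonneg f g hf hg)

/-- The exponential series has non-negative coefficients, and its partial sums are bounded by e^C.
-/
theorem exp {q : ℝ → ℂ} (h : IsPosMult q) : IsPosMult fun ξ => Complex.exp (q ξ) := by
  obtain ⟨C, hC⟩ := h.bounded
  have hC0 : 0 ≤ C := (norm_nonneg _).trans (hC 0)
  refine of_tendsto (q := fun N ξ => ∑ k ∈ Finset.range N, ((1 / k.factorial : ℝ) : ℂ) * q ξ ^ k)
    (C := Real.exp C) (fun N => ?_) (fun N ξ => ?_) fun ξ => ?_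
  · induction N with
    | zero => simpa using const le_rfl
    | succ N ih =>
      simp only [Finset.sum_range_succ]
      exact ih.add ((h.pow N).const_mul (by positivity))
  · refine le_trans ?_ (Real.sum_le_exp_of_nonneg hC0 N)
    refine (norm_sum_le _ _).trans (Finset.sum_le_sum fun k _ => ?_)
    rw [norm_mul, norm_pow, Complex.norm_real, Real.norm_of_nonneg (by positivity), div_mul_eq_mul_div,
      one_mul]
    gcongr
    exact hC ξ
  · have h1 := (NormedSpace.expSeries_div_hasSum_exp (q ξ)).tendsto_sum_nat
    rw [← Complex.exp_eq_exp_ℂ] at h1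
    refine h1.congr fun N => Finset.sum_congr rfl fun k _ => ?_
    push_cast
    ring

/-- For fixed f and g the form is linear in the symbol, so Fubini writes it as an integral of
non-negative numbers. -/
theorem integral {X : Type*} [MeasurableSpace X] {ν : Measure X} [SFinite ν] {p : X → ℝ → ℂ}
    (hp : Measurable (Function.uncurry p)) {B : X → ℝ} (hB : Integrable B ν)
    (hle : ∀ᵐ x ∂ν, ∀ ξ, ‖p x ξ‖ ≤ B x) (h : ∀ᵐ x ∂ν, IsPosMult (p x)) :
    IsPosMult fun ξ => ∫ x, p x ξ ∂ν := by
  have hm : Measurable fun ξ => ∫ x, p x ξ ∂ν :=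
    (hp.stronglyMeasurable.integral_prod_left (μ := ν)).measurable
  refine ⟨hm, ⟨∫ x, B x ∂ν, fun ξ => norm_integral_le_of_norm_le hB ?_⟩, fun f g hf hg => ?_⟩
  · filter_upwards [hle] with x hx using hx ξ
  set G := Lp.fourierTransformₗᵢ ℝ ℂ g
  set F := Lp.fourierTransformₗᵢ ℝ ℂ f
  have hF : Measurable F := (Lp.stronglyMeasurable F).measurable
  have hG : Measurable fun ξ => (starRingEnd ℂ) (G ξ) :=
    Complex.continuous_conj.measurable.comp (Lp.stronglyMeasurable G).measurable
  have hI : Integrable (fun z : X × ℝ => (starRingEnd ℂ) (G z.2) * (p z.1 z.2 * F z.2))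
      (ν.prod volume) := by
    refine (hB.mul_prod (integrable_conj_mul G F).norm).mono' ?_ ?_
    · exact ((hG.comp measurable_snd).mul (hp.mul (hF.comp measurable_snd))).aestronglyMeasurable
    · have hle' : ∀ᵐ z ∂(ν.prod (volume : Measure ℝ)), ∀ ξ, ‖p z.1 ξ‖ ≤ B z.1 :=
        Measure.quasiMeasurePreserving_fst.ae hle
      filter_upwards [hle'] with z hz
      rw [norm_mul, norm_mul, norm_mul, mul_left_comm]
      exact mul_le_mul_of_nonneg_right (hz _) (by positivity)
  have h1 : multForm (fun ξ => ∫ x, p x ξ ∂ν) f g = ∫ x, multForm (p x) f g ∂ν := by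
    have h2 := integral_integral_swap (f := fun x ξ => (starRingEnd ℂ) (G ξ) * (p x ξ * F ξ)) hI
    simp only [multForm]
    rw [h2]
    refine integral_congr_ae (Eventually.of_forall fun ξ => ?_)
    dsimp only
    rw [integral_const_mul, integral_mul_const]
  rw [h1]
  refine integral_nonneg_of_ae ?_
  filter_upwards [h] with x hx using hx.nonneg f g hf hg

end IsPosMult

/-! ### Translations, resolvents and exponentials of Bernstein symbols. -/

theorem norm_exp_neg_mul_imagAxis (r ξ : ℝ) : ‖Complex.exp (-(r * imagAxis ξ))‖ ≤ 1 := by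
  rw [Complex.norm_exp, Complex.neg_re, Complex.re_ofReal_mul, imagAxis_re, mul_zero, neg_zero,
    Real.exp_zero]

theorem measurable_exp_neg_mul_imagAxis (r : ℝ) :
    Measurable fun ξ => Complex.exp (-(r * imagAxis ξ)) := by fun_prop

theorem fourier_shift_apply (φ : 𝓢(ℝ, ℂ)) (r ξ : ℝ) :
    𝓕 (shift (-r) φ) ξ = Complex.exp (-(r * imagAxis ξ)) * 𝓕 φ ξ := by
  rw [SchwartzMap.fourier_coe, SchwartzMap.fourier_coe, Real.fourier_real_eq_integral_exp_smul,
    Real.fourier_real_eq_integral_exp_smul, ← integral_const_mul,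
    ← integral_add_right_eq_self (μ := volume) _ r]
  refine integral_congr_ae (Eventually.of_forall fun x => ?_)
  dsimp only
  rw [shift_apply, add_neg_cancel_right, smul_eq_mul, smul_eq_mul, ← mul_assoc, ← Complex.exp_add]
  congr 2
  simp only [imagAxis]
  push_cast
  ring

/-- The Fourier transform on `L²` turns translations into multiplications. -/
theorem fourier_translate (r : ℝ) (f : Lp ℂ 2 (volume : Measure ℝ)) :
    Lp.fourierTransformₗᵢ ℝ ℂ (Lp.compMeasurePreserving (fun x => x - r)
      (measurePreserving_sub_right volume r) f) =
    mulOp volume (fun ξ => Complex.exp (-(r * imagAxis ξ))) (measurable_exp_neg_mul_imagAxis r) 1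
      (norm_exp_neg_mul_imagAxis r) (Lp.fourierTransformₗᵢ ℝ ℂ f) := by
  refine DenseRange.induction_on (SchwartzMap.denseRange_toLpCLM (F := ℂ) (μ := (volume : Measure ℝ))
    (p := 2) ENNReal.ofNat_ne_top) f (isClosed_eq ?_ ?_) fun φ => ?_
  · exact (Lp.fourierTransformₗᵢ ℝ ℂ).continuous.comp (Lp.isometry_compMeasurePreserving
      (measurePreserving_sub_right volume r)).continuous
  · exact (ContinuousLinearMap.continuous _).comp (Lp.fourierTransformₗᵢ ℝ ℂ).continuous
  · have h1 : Lp.compMeasurePreserving (fun x => x - r) (measurePreserving_sub_right volume r)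
        (φ.toLp 2 volume) = (shift (-r) φ).toLp 2 volume := by
      refine Lp.ext ?_
      have h2 := (measurePreserving_sub_right volume r).quasiMeasurePreserving.ae
        (φ.coeFn_toLp 2 volume)
      filter_upwards [Lp.coeFn_compMeasurePreserving (φ.toLp 2 volume)
        (measurePreserving_sub_right volume r), h2, (shift (-r) φ).coeFn_toLp 2 volume]
        with x e1 e2 e3
      rw [e1, Function.comp_apply, e2, e3, shift_apply, sub_eq_add_neg]
    have h3 (φ : 𝓢(ℝ, ℂ)) : Lp.fourierTransformₗᵢ ℝ ℂ (φ.toLp 2 volume) = (𝓕 φ).toLp 2 volume :=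
      SchwartzMap.toLp_fourier_eq φ
    change Lp.fourierTransformₗᵢ ℝ ℂ (Lp.compMeasurePreserving (fun x => x - r)
      (measurePreserving_sub_right volume r) (φ.toLp 2 volume)) = mulOp volume _ _ _ _
        (Lp.fourierTransformₗᵢ ℝ ℂ (φ.toLp 2 volume))
    rw [h1, h3, h3]
    refine (mulOp_eq_of_ae _ _ ?_).symm
    filter_upwards [(𝓕 (shift (-r) φ)).coeFn_toLp 2 volume, (𝓕 φ).coeFn_toLp 2 volume] with ξ e1 e2
    rw [e1, e2, fourier_shift_apply]

theorem isPosMult_translate (r : ℝ) : IsPosMult fun ξ => Complex.exp (-(r * imagAxis ξ)) := by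
  refine IsPosMult.of_ae_nonneg (measurable_exp_neg_mul_imagAxis r) (norm_exp_neg_mul_imagAxis r)
    fun f hf => ?_
  rw [← fourier_translate, LinearIsometryEquiv.symm_apply_apply]
  have h2 := (measurePreserving_sub_right volume r).quasiMeasurePreserving.ae hf
  filter_upwards [Lp.coeFn_compMeasurePreserving f (measurePreserving_sub_right volume r), h2]
    with x e1 e2
  rw [e1]
  exact e2

/-- With s = 2πiξ, t/(s + t) = ∫ t e^{-tr} e^{-rs} dr is an average of translations over the
exponential distribution. -/
theorem isPosMult_resolvent {t : ℝ} (ht : 0 < t) : IsPosMult fun ξ => t / (imagAxis ξ + t) := by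
  have he : IntegrableOn (fun r : ℝ => t * Real.exp (-t * r)) (Ioi 0) :=
    (integrableOn_exp_mul_Ioi (show -t < 0 by linarith) 0).const_mul t
  have h := IsPosMult.integral (ν := volume.restrict (Ioi (0 : ℝ)))
    (p := fun r ξ => ((t * Real.exp (-t * r) : ℝ) : ℂ) * Complex.exp (-(r * imagAxis ξ)))
    (by unfold Function.uncurry; fun_prop) he
    (Eventually.of_forall fun r ξ => by
      rw [norm_mul, Complex.norm_real, Real.norm_of_nonneg (by positivity)]
      exact mul_le_of_le_one_right (by positivity) (norm_exp_neg_mul_imagAxis r ξ))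
    (Eventually.of_forall fun r => (isPosMult_translate r).const_mul (by positivity))
  refine (congrArg IsPosMult (funext fun ξ => ?_)).mp h
  have hs : 0 < (imagAxis ξ + t).re := by
    rw [Complex.add_re, imagAxis_re, Complex.ofReal_re]
    linarith
  have h7 := integral_pow_mul_exp hs 0
  simp only [pow_zero, one_mul, Nat.factorial_zero, Nat.cast_one, zero_add, pow_one] at h7
  rw [← mul_one_div, ← h7, ← integral_const_mul]
  refine integral_congr_ae (Eventually.of_forall fun r => ?_)
  dsimp only
  rw [Complex.ofReal_mul, Complex.ofReal_exp, mul_assoc, ← Complex.exp_add]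
  congr 2
  push_cast
  ring

theorem norm_resolvent_le (ξ : ℝ) {t : ℝ} (ht : 0 < t) : ‖(t : ℂ) / (imagAxis ξ + t)‖ ≤ 1 := by
  have h2 := le_norm_imagAxis_add ξ t
  rw [norm_div, Complex.norm_real, Real.norm_of_nonneg ht.le]
  exact div_le_one_of_le₀ h2 (norm_nonneg _)

/-- Compound Poisson structure. For finite σ, s/(s + t) = 1 - t/(s + t) can be integrated termwise,
so e^{-τΨ} is the constant e^{-τ(a + σ(ℝ))} times the translation e^{-τbs} times exp(τ ∫ t/(s + t)
σ(dt)). -/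
theorem isPosMult_exp_of_isFiniteMeasure [IsFiniteMeasure σ] (hσ : IsStieltjesMeasure σ) {τ : ℝ}
    (hτ : 0 ≤ τ) : IsPosMult fun ξ => Complex.exp (-(τ * bernstein a b σ (imagAxis ξ))) := by
  have hq : IsPosMult fun ξ => ∫ t, (t : ℂ) / (imagAxis ξ + t) ∂σ := by
    refine IsPosMult.integral (ν := σ) (p := fun (t ξ : ℝ) => (t : ℂ) / (imagAxis ξ + t))
      (B := fun _ => 1) (by unfold Function.uncurry; fun_prop) (integrable_const 1) ?_ ?_
    · filter_upwards [hσ.ae_pos] with t ht ξ using norm_resolvent_le ξ ht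
    · filter_upwards [hσ.ae_pos] with t ht using isPosMult_resolvent ht
  have h1 (ξ : ℝ) : Integrable (fun t : ℝ => (t : ℂ) / (imagAxis ξ + t)) σ := by
    refine Integrable.of_bound (Measurable.aestronglyMeasurable (by fun_prop)) 1 ?_
    filter_upwards [hσ.ae_pos] with t ht using norm_resolvent_le ξ ht
  have h2 (ξ : ℝ) : ∫ t, imagAxis ξ / (imagAxis ξ + t) ∂σ =
      ((σ.real univ : ℝ) : ℂ) - ∫ t, (t : ℂ) / (imagAxis ξ + t) ∂σ := by
    have h3 : ∫ t, imagAxis ξ / (imagAxis ξ + t) ∂σ =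
        ∫ t, ((1 : ℂ) - (t : ℂ) / (imagAxis ξ + t)) ∂σ := by
      refine integral_congr_ae ?_
      filter_upwards [hσ.ae_pos] with t ht
      have h4 : imagAxis ξ + t ≠ 0 := ne_zero_of_re_pos (by
        rw [Complex.add_re, imagAxis_re, Complex.ofReal_re]
        linarith)
      field_simp
      ring
    rw [h3, integral_sub (integrable_const 1) (h1 ξ), integral_const, Complex.real_smul, mul_one]
  have h5 := ((isPosMult_translate (τ * b)).const_mul
    (Real.exp_pos (-(τ * (a + σ.real univ)))).le).mul (hq.const_mul hτ).exp
  refine (congrArg IsPosMult (funext fun ξ => ?_)).mp h5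
  rw [Complex.ofReal_exp, ← Complex.exp_add, ← Complex.exp_add, bernstein, h2]
  congr 1
  push_cast
  ring

theorem IsStieltjesMeasure.restrict (hσ : IsStieltjesMeasure σ) (s : Set ℝ) :
    IsStieltjesMeasure (σ.restrict s) :=
  ⟨ae_restrict_of_ae hσ.ae_pos, hσ.integrable.restrict⟩

theorem IsStieltjesMeasure.measure_Ioc_lt_top (hσ : IsStieltjesMeasure σ) (N : ℝ) :
    σ (Ioc 0 N) < ⊤ := by
  rcases le_or_gt N 0 with h | h
  · rw [Ioc_eq_empty (by linarith)]
    simp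
  · refine (measure_mono fun t ht => ?_).trans_lt
      (hσ.integrable.measure_ge_lt_top (show 0 < 1 / (1 + N) by positivity))
    have h1 : 0 < t := ht.1
    have h2 : t ≤ N := ht.2
    exact one_div_le_one_div_of_le (show 0 < 1 + t by linarith) (by linarith)

/-- Truncating σ to (0, N] leaves a finite measure; the truncated symbols converge pointwise, and
all exponentials are bounded by 1 because the real parts are non-negative. -/
theorem isPosMult_exp_neg_bernstein (ha : 0 ≤ a) (hσ : IsStieltjesMeasure σ) {τ : ℝ} (hτ : 0 ≤ τ) :
    IsPosMult fun ξ => Complex.exp (-(τ * bernstein a b σ (imagAxis ξ))) := by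
  refine IsPosMult.of_tendsto (C := 1) (q := fun (N : ℕ) ξ =>
    Complex.exp (-(τ * bernstein a b (σ.restrict (Ioc 0 (N : ℝ))) (imagAxis ξ))))
    (fun N => ?_) (fun N ξ => ?_) fun ξ => ?_
  · have : IsFiniteMeasure (σ.restrict (Ioc 0 (N : ℝ))) :=
      ⟨by simpa using hσ.measure_Ioc_lt_top N⟩
    exact isPosMult_exp_of_isFiniteMeasure (hσ.restrict _) hτ
  · have := norm_exp_neg_mul_le
      (bernstein_imagAxis_re_nonneg (b := b) ha (hσ.restrict (Ioc 0 (N : ℝ))) ξ) τ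
    rwa [max_eq_left hτ] at this
  · have h1 : Tendsto (fun N : ℕ => ∫ t in Ioc 0 (N : ℝ), imagAxis ξ / (imagAxis ξ + t) ∂σ) atTop
        (𝓝 (∫ t, imagAxis ξ / (imagAxis ξ + t) ∂σ)) := by
      have h2 := tendsto_setIntegral_of_monotone (μ := σ)
        (f := fun t : ℝ => imagAxis ξ / (imagAxis ξ + t)) (s := fun N : ℕ => Ioc 0 (N : ℝ))
        (fun N => measurableSet_Ioc)
        (fun N M h => Ioc_subset_Ioc_right (by exact_mod_cast h))
        (hσ.integrable_imagAxis_div ξ).integrableOn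
      have h3 : ⋃ N : ℕ, Ioc 0 (N : ℝ) = Ioi 0 := by
        ext t
        simp only [mem_iUnion, mem_Ioc, mem_Ioi]
        exact ⟨fun ⟨N, h, _⟩ => h, fun h => ⟨⌈t⌉₊, h, Nat.le_ceil t⟩⟩
      rw [h3, Measure.restrict_eq_self_of_ae_mem (s := Ioi (0 : ℝ)) hσ.ae_pos] at h2
      exact h2
    have h4 : Tendsto (fun N : ℕ => bernstein a b (σ.restrict (Ioc 0 (N : ℝ))) (imagAxis ξ)) atTop
        (𝓝 (bernstein a b σ (imagAxis ξ))) := h1.const_add _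
    exact (Complex.continuous_exp.tendsto _).comp (h4.const_mul _).neg

/-! ### The isometry `f ↦ (f ∘ ψ) / w` -/

namespace IsAdmissible

variable {ψ w : ℝ → ℝ}

theorem strictMono (h : IsAdmissible ψ w) : StrictMono ψ := strictMono_of_deriv_pos h.deriv_pos

theorem continuous_scale (h : IsAdmissible ψ w) : Continuous ψ := h.smooth_scale.continuous

theorem continuous_weight (h : IsAdmissible ψ w) : Continuous w := h.smooth_weight.continuous

theorem continuous_deriv (h : IsAdmissible ψ w) : Continuous (deriv ψ) := h.smooth_scale.continuous_deriv (by simp)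

theorem lintegral_comp (h : IsAdmissible ψ w) (F : ℝ → ENNReal) :
    ∫⁻ t, ENNReal.ofReal (deriv ψ t) * F (ψ t) = ∫⁻ y, F y := by
  have h1 := lintegral_image_eq_lintegral_abs_deriv_mul MeasurableSet.univ (f := ψ)
    (f' := deriv ψ)
    (fun t _ => ((h.smooth_scale.differentiable (by simp)) t).hasDerivAt.hasDerivWithinAt)
    h.strictMono.injective.injOn F
  rw [image_univ, h.surjective.range_eq, Measure.restrict_univ] at h1
  rw [h1]
  refine lintegral_congr fun t => ?_
  rw [abs_of_pos (h.deriv_pos t)]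

theorem measurable_density (h : IsAdmissible ψ w) :
    Measurable fun t => ENNReal.ofReal (w t ^ 2 * deriv ψ t) := by
  have h1 := h.continuous_deriv.measurable
  have h2 := h.continuous_weight.measurable
  fun_prop

theorem ae_weighted_iff (h : IsAdmissible ψ w) {P : ℝ → Prop} :
    (∀ᵐ t ∂weightedMeasure ψ w, P t) ↔ ∀ᵐ t, P t := by
  constructor
  · refine fun hP => (withDensity_absolutelyContinuous' h.measurable_density.aemeasurable
      (Eventually.of_forall fun t => ?_)).ae_le hP
    simp only [ne_eq, ENNReal.ofReal_eq_zero, not_le]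
    have := h.weight_pos t
    have := h.deriv_pos t
    positivity
  · exact fun hP => (withDensity_absolutelyContinuous _ _).ae_le hP

/-- A property holds almost everywhere iff it does so in the variable `y = ψ(t)`. -/
theorem ae_comp_iff (h : IsAdmissible ψ w) {P : ℝ → Prop} :
    (∀ᵐ t ∂weightedMeasure ψ w, P (ψ t)) ↔ ∀ᵐ y, P y := by
  have hm : Measurable fun t => ENNReal.ofReal (deriv ψ t) :=
    h.continuous_deriv.measurable.ennreal_ofReal
  have hemb : MeasurableEmbedding ψ :=
    h.continuous_scale.measurableEmbedding h.strictMono.injective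
  have hmap : (volume.withDensity fun t => ENNReal.ofReal (deriv ψ t)).map ψ = volume := by
    refine Measure.ext_of_lintegral _ fun F hF => ?_
    rw [lintegral_map hF h.continuous_scale.measurable]
    exact (lintegral_withDensity_eq_lintegral_mul _ hm
      (hF.comp h.continuous_scale.measurable)).trans (h.lintegral_comp F)
  have h1 : (∀ᵐ y, P y) ↔ ∀ᵐ t ∂(volume.withDensity fun t => ENNReal.ofReal (deriv ψ t)), P (ψ t) := by
    rw [← hemb.ae_map_iff, hmap]
  rw [h1, h.ae_weighted_iff]
  constructor
  · exact fun hP => (withDensity_absolutelyContinuous _ _).ae_le hP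
  · refine fun hP => (withDensity_absolutelyContinuous' hm.aemeasurable
      (Eventually.of_forall fun t => ?_)).ae_le hP
    simp only [ne_eq, ENNReal.ofReal_eq_zero, not_le]
    exact h.deriv_pos t

theorem stronglyMeasurable_comp (h : IsAdmissible ψ w) {f : ℝ → ℂ} (hf : StronglyMeasurable f) :
    StronglyMeasurable fun t => f (ψ t) / w t := by
  have h1 : Measurable fun t => f (ψ t) := hf.measurable.comp h.continuous_scale.measurable
  have h2 : Measurable fun t => (w t : ℂ) := Complex.measurable_ofReal.comp h.continuous_weight.measurable
  exact (h1.div h2).stronglyMeasurable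

/-- The factor w² of the measure cancels the weight in the denominator, and ψ' is the Jacobian of y
= ψ(t). -/
theorem eLpNorm_comp (h : IsAdmissible ψ w) {f : ℝ → ℂ} (hf : StronglyMeasurable f) :
    eLpNorm (fun t => f (ψ t) / w t) 2 (weightedMeasure ψ w) = eLpNorm f 2 volume := by
  rw [eLpNorm_eq_lintegral_rpow_enorm_toReal two_ne_zero ENNReal.ofNat_ne_top,
    eLpNorm_eq_lintegral_rpow_enorm_toReal two_ne_zero ENNReal.ofNat_ne_top]
  congr 1
  rw [weightedMeasure, lintegral_withDensity_eq_lintegral_mul _ h.measurable_density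
    ((h.stronglyMeasurable_comp hf).measurable.enorm.pow_const _),
    ← h.lintegral_comp fun y => ‖f y‖ₑ ^ (2 : ENNReal).toReal]
  refine lintegral_congr fun t => ?_
  have hw := h.weight_pos t
  have hd := h.deriv_pos t
  simp only [Pi.mul_apply, ENNReal.toReal_ofNat]
  rw [← ofReal_norm, ← ofReal_norm,
    ENNReal.ofReal_rpow_of_nonneg (norm_nonneg _) zero_le_two,
    ENNReal.ofReal_rpow_of_nonneg (norm_nonneg _) zero_le_two,
    ← ENNReal.ofReal_mul (by positivity), ← ENNReal.ofReal_mul (by positivity), norm_div,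
    Complex.norm_real, Real.norm_of_nonneg hw.le, Real.rpow_two, Real.rpow_two]
  congr 1
  field_simp

theorem memLp_comp (h : IsAdmissible ψ w) {f : ℝ → ℂ} (hf : StronglyMeasurable f) (hf2 : MemLp f 2) :
    MemLp (fun t => f (ψ t) / w t) 2 (weightedMeasure ψ w) :=
  ⟨(h.stronglyMeasurable_comp hf).aestronglyMeasurable, by rw [h.eLpNorm_comp hf]; exact hf2.2⟩

/-- The map `f ↦ (f ∘ ψ) / w` from `L²(ℝ)` to `L²(w² ψ' dt)`. -/
def compIsometry (h : IsAdmissible ψ w) : Lp ℂ 2 (volume : Measure ℝ) →ₗᵢ[ℂ] WeightedL2 ψ w where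
  toFun f := (h.memLp_comp (Lp.stronglyMeasurable f) (Lp.memLp f)).toLp _
  map_add' f g := by
    rw [← MemLp.toLp_add]
    refine MemLp.toLp_congr _ _ ?_
    filter_upwards [h.ae_comp_iff.2 (Lp.coeFn_add f g)] with t ht
    rw [ht, Pi.add_apply, Pi.add_apply, add_div]
  map_smul' c f := by
    rw [RingHom.id_apply, ← MemLp.toLp_const_smul]
    refine MemLp.toLp_congr _ _ ?_
    filter_upwards [h.ae_comp_iff.2 (Lp.coeFn_smul c f)] with t ht
    rw [ht, Pi.smul_apply, Pi.smul_apply, smul_eq_mul, smul_eq_mul, mul_div_assoc]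
  norm_map' f := by
    change ‖(h.memLp_comp (Lp.stronglyMeasurable f) (Lp.memLp f)).toLp _‖ = ‖f‖
    rw [Lp.norm_toLp, h.eLpNorm_comp (Lp.stronglyMeasurable f), Lp.norm_def]

theorem coeFn_compIsometry (h : IsAdmissible ψ w) (f : Lp ℂ 2 (volume : Measure ℝ)) :
    h.compIsometry f =ᵐ[weightedMeasure ψ w] fun t => f (ψ t) / w t :=
  (h.memLp_comp (Lp.stronglyMeasurable f) (Lp.memLp f)).coeFn_toLp

theorem surjective_compIsometry (h : IsAdmissible ψ w) : Function.Surjective h.compIsometry := by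
  intro g
  set e := (h.strictMono.orderIsoOfSurjective ψ h.surjective).toHomeomorph
  have he (t : ℝ) : e.symm (ψ t) = t := e.symm_apply_apply t
  set f : ℝ → ℂ := fun y => w (e.symm y) * g (e.symm y)
  have hf : StronglyMeasurable f := by
    have h1 : Measurable fun t => (w t : ℂ) * g t :=
      (Complex.measurable_ofReal.comp h.continuous_weight.measurable).mul
        (Lp.stronglyMeasurable g).measurable
    exact (h1.comp e.symm.continuous.measurable).stronglyMeasurable
  have hfg (t : ℝ) : f (ψ t) / w t = g t := by
    have : (w t : ℂ) ≠ 0 := by exact_mod_cast (h.weight_pos t).ne'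
    simp only [f, he]
    field_simp
  have hf2 : MemLp f 2 := by
    refine ⟨hf.aestronglyMeasurable, ?_⟩
    rw [← h.eLpNorm_comp hf]
    simp only [hfg]
    exact (Lp.memLp g).2
  refine ⟨hf2.toLp f, Lp.ext ?_⟩
  filter_upwards [h.coeFn_compIsometry (hf2.toLp f), h.ae_comp_iff.2 hf2.coeFn_toLp] with t e1 e2
  rw [e1, e2, hfg]

/-- The isometry `f ↦ (f ∘ ψ) / w` of `L²(ℝ)` onto `L²(w² ψ' dt)`. -/
def compEquiv (h : IsAdmissible ψ w) : Lp ℂ 2 (volume : Measure ℝ) ≃ₗᵢ[ℂ] WeightedL2 ψ w :=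
  LinearIsometryEquiv.ofSurjective h.compIsometry h.surjective_compIsometry

theorem coeFn_compEquiv (h : IsAdmissible ψ w) (f : Lp ℂ 2 (volume : Measure ℝ)) :
    h.compEquiv f =ᵐ[weightedMeasure ψ w] fun t => f (ψ t) / w t :=
  h.coeFn_compIsometry f

theorem coeFn_compEquiv_of_ae (h : IsAdmissible ψ w) {f : Lp ℂ 2 (volume : Measure ℝ)} {f' : ℝ → ℂ}
    (hf : f =ᵐ[volume] f') :
    h.compEquiv f =ᵐ[weightedMeasure ψ w] fun t => f' (ψ t) / w t := by
  filter_upwards [h.coeFn_compEquiv f, h.ae_comp_iff.2 hf] with t e1 e2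
  rw [e1, e2]

theorem compEquiv_nonneg_iff (h : IsAdmissible ψ w) (f : Lp ℂ 2 (volume : Measure ℝ)) :
    (∀ᵐ t ∂weightedMeasure ψ w, 0 ≤ h.compEquiv f t) ↔ ∀ᵐ y, 0 ≤ f y := by
  rw [← h.ae_comp_iff]
  refine eventually_congr ?_
  filter_upwards [h.coeFn_compEquiv f] with t e1
  have hw : (0 : ℂ) < w t := by exact_mod_cast h.weight_pos t
  have hw' : (0 : ℂ) < (w t : ℂ)⁻¹ := by
    rw [← Complex.ofReal_inv]
    exact_mod_cast inv_pos.2 (h.weight_pos t)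
  rw [e1, div_eq_mul_inv]
  refine ⟨fun h0 => ?_, fun h0 => mul_nonneg h0 hw'.le⟩
  have := mul_nonneg h0 hw.le
  rwa [inv_mul_cancel_right₀ hw.ne'] at this

theorem rectify_eq (h : IsAdmissible ψ w) {v : 𝓢(ℝ, ℂ)} (u : WeightedSchwartz ψ w) (hu : ∀ t, u.1 t = v (ψ t) / w t) :
    u.rectify = v := by
  ext y
  obtain ⟨t, rfl⟩ := h.surjective y
  rw [WeightedSchwartz.rectify_apply h, hu]
  have : (w t : ℂ) ≠ 0 := by exact_mod_cast (h.weight_pos t).ne'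
  field_simp

end IsAdmissible

/-! ### Unitarily equivalent semigroups -/

section Conj

variable {X Y : Type*} [NormedAddCommGroup X] [NormedSpace ℂ X] [NormedAddCommGroup Y]
  [NormedSpace ℂ Y] (V : X ≃ₗᵢ[ℂ] Y) (S : ℝ → X →L[ℂ] X)

/-- The semigroup `V S V⁻¹`. -/
def conjSemigroup (τ : ℝ) : Y →L[ℂ] Y :=
  (V.toContinuousLinearEquiv : X →L[ℂ] Y).comp
    ((S τ).comp (V.symm.toContinuousLinearEquiv : Y →L[ℂ] X))

theorem conjSemigroup_apply (τ : ℝ) (f : Y) : conjSemigroup V S τ f = V (S τ (V.symm f)) := rfl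

theorem norm_conjSemigroup_le {τ : ℝ} (h : ‖S τ‖ ≤ 1) : ‖conjSemigroup V S τ‖ ≤ 1 := by
  refine ContinuousLinearMap.opNorm_le_bound _ zero_le_one fun f => ?_
  rw [conjSemigroup_apply, V.norm_map, one_mul]
  refine ((S τ).le_of_opNorm_le h _).trans_eq ?_
  rw [one_mul, V.symm.norm_map]

theorem isC0Semigroup_conjSemigroup {S : ℝ → X →L[ℂ] X} (h : IsC0Semigroup S) :
    IsC0Semigroup (conjSemigroup V S) where
  map_zero := by
    ext f
    rw [conjSemigroup_apply, h.map_zero]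
    simp
  map_add τ τ' hτ hτ' := by
    ext f
    rw [conjSemigroup_apply, h.map_add τ τ' hτ hτ', ContinuousLinearMap.comp_apply,
      ContinuousLinearMap.comp_apply, conjSemigroup_apply, conjSemigroup_apply, V.symm_apply_apply]
  tendsto_zero f := by
    have h1 := (V.continuous.tendsto _).comp (h.tendsto_zero (V.symm f))
    rw [V.apply_symm_apply] at h1
    exact h1

theorem mem_generatorGraph_conjSemigroup (p : X × X) :
    (V p.1, V p.2) ∈ generatorGraph (conjSemigroup V S) ↔ p ∈ generatorGraph S := by
  have h1 (τ : ℝ) : ((τ⁻¹ : ℝ) : ℂ) • (conjSemigroup V S τ (V p.1) - V p.1) =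
      V (((τ⁻¹ : ℝ) : ℂ) • (S τ p.1 - p.1)) := by
    rw [conjSemigroup_apply, V.symm_apply_apply, map_smul, map_sub]
  change Tendsto (fun τ : ℝ => ((τ⁻¹ : ℝ) : ℂ) • (conjSemigroup V S τ (V p.1) - V p.1)) _ _ ↔
    Tendsto (fun τ : ℝ => ((τ⁻¹ : ℝ) : ℂ) • (S τ p.1 - p.1)) _ _
  simp only [h1]
  exact (V.isometry.isEmbedding.tendsto_nhds_iff).symm

theorem generatorGraph_conjSemigroup :
    generatorGraph (conjSemigroup V S) =
      (V.toHomeomorph.prodCongr V.toHomeomorph) '' generatorGraph S := by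
  ext p
  constructor
  · intro hp
    refine ⟨(V.symm p.1, V.symm p.2), ?_, Prod.ext (V.apply_symm_apply _) (V.apply_symm_apply _)⟩
    rw [← mem_generatorGraph_conjSemigroup V S]
    simpa using hp
  · rintro ⟨q, hq, rfl⟩
    exact (mem_generatorGraph_conjSemigroup V S q).2 hq

end Conj

/-! ### The semigroup generated by the Weyl-Sonine derivative -/

section Generation

variable {n : ℕ} {a b : ℝ} {σ : Measure ℝ} {κ κ₁ : 𝓢'(ℝ, ℂ)} {ψ w : ℝ → ℝ}

theorem weylSonineDeriv_eq (hn : 1 ≤ n) (hσ : IsStieltjesMeasure σ)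
    (hκ : (TemperedDistribution.derivCLM ℂ)^[n - 1] κ = κ₁) (hφ : ∀ φ : 𝓢(ℝ, ℂ),
      κ₁ φ = b * φ 0 + ∫ r in Ioi (0 : ℝ), (stieltjesDensity a σ r : ℂ) * φ r)
    (u : WeightedSchwartz ψ w) (t : ℝ) :
    weylSonineDeriv n κ u t =
      invFourierIntegral (fun ξ => bernstein a b σ (imagAxis ξ) * 𝓕 u.rectify ξ) (ψ t) / w t := by
  obtain ⟨m, rfl⟩ : ∃ m, n = m + 1 := ⟨n - 1, by omega⟩
  rw [Nat.add_sub_cancel] at hκ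
  rw [weylSonineDeriv, iteratedDeriv_convSchwartz, hκ,
    convSchwartz_der_eq_invFourierIntegral hσ hφ]

/-- On the Fourier side the derivative is multiplication by m(ξ) = Ψ(2πiξ), so the semigroup is the
conjugate of multiplication by e^{-τm}. The core statement identifies its generator, and
`isPosMult_exp_neg_bernstein` gives positivity. -/
theorem generatesPositiveSemigroup (hn : 1 ≤ n) (ha : 0 ≤ a) (hσ : IsStieltjesMeasure σ)
    (hκ : (TemperedDistribution.derivCLM ℂ)^[n - 1] κ = κ₁) (hφ : ∀ φ : 𝓢(ℝ, ℂ),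
      κ₁ φ = b * φ 0 + ∫ r in Ioi (0 : ℝ), (stieltjesDensity a σ r : ℂ) * φ r)
    (h : IsAdmissible ψ w) : GeneratesPositiveSemigroup ψ w n κ := by
  have := hσ.sigmaFinite
  set m : ℝ → ℂ := fun ξ => bernstein a b σ (imagAxis ξ) with hmdef
  have hm : Measurable m := measurable_bernstein_imagAxis
  have hre (ξ : ℝ) : 0 ≤ (m ξ).re := bernstein_imagAxis_re_nonneg ha hσ ξ
  obtain ⟨C, hC⟩ := exists_norm_bernstein_imagAxis_le a b hσ
  set F := Lp.fourierTransformₗᵢ ℝ ℂ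
  -- V goes from the frequency side to the weighted space: inverse Fourier transform, then f ↦ (f ∘
  -- ψ)/w.
  set V := F.symm.trans h.compEquiv with hVdef
  have hVapply (f : Lp ℂ 2 (volume : Measure ℝ)) : V f = h.compEquiv (F.symm f) := rfl
  have hderiv (u : WeightedSchwartz ψ w) : weylSonineDeriv n κ u =
      fun t => invFourierIntegral (fun ξ => m ξ * 𝓕 u.rectify ξ) (ψ t) / w t :=
    funext fun t => weylSonineDeriv_eq hn hσ hκ hφ u t
  have hV1 (v : 𝓢(ℝ, ℂ)) {f : Lp ℂ 2 (volume : Measure ℝ)}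
      (hf : f =ᵐ[volume] (𝓕 v : 𝓢(ℝ, ℂ))) :
      V f =ᵐ[weightedMeasure ψ w] fun t => v (ψ t) / w t := by
    refine h.coeFn_compEquiv_of_ae ?_
    refine (coeFn_fourierInv ((𝓕 v).integrable (μ := volume)) hf).trans ?_
    exact Eventually.of_forall fun y => (schwartz_apply_eq v y).symm
  have hV2 (v : 𝓢(ℝ, ℂ)) {f : Lp ℂ 2 (volume : Measure ℝ)}
      (hf : f =ᵐ[volume] fun ξ => -(m ξ * 𝓕 v ξ)) :
      V f =ᵐ[weightedMeasure ψ w]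
        fun t => -(invFourierIntegral (fun ξ => m ξ * 𝓕 v ξ) (ψ t) / w t) := by
    have h1 := h.coeFn_compEquiv_of_ae
      (coeFn_fourierInv (integrable_mul_schwartz hm hC (𝓕 v)).neg hf)
    refine h1.trans (Eventually.of_forall fun t => ?_)
    dsimp only
    rw [← neg_div]
    congr 1
    simp only [invFourierIntegral, Pi.neg_apply, mul_neg]
    rw [integral_neg]
  -- The Fourier transform is a bijection of 𝓢(ℝ), so V maps the graph of -m over Schwartz functions
  -- exactly onto the graph of the operator; a homeomorphism then commutes with the closure.
  have hgraph : negDerivGraph ψ w n κ = (V.toHomeomorph.prodCongr V.toHomeomorph) ''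
      {p : Lp ℂ 2 (volume : Measure ℝ) × Lp ℂ 2 (volume : Measure ℝ) |
        ∃ v : 𝓢(ℝ, ℂ), p.1 =ᵐ[volume] v ∧ p.2 =ᵐ[volume] fun x => -(m x * v x)} := by
    ext p
    constructor
    · rintro ⟨u, h1, h2⟩
      have hu (t : ℝ) : u.1 t = u.rectify (ψ t) / w t := u.2.choose_spec t
      have hg := (memLp_mul_schwartz hm hC (𝓕 u.rectify)).neg
      refine ⟨((𝓕 u.rectify).toLp 2 volume, hg.toLp _), ⟨𝓕 u.rectify,
        (𝓕 u.rectify).coeFn_toLp 2 volume, hg.coeFn_toLp⟩, Prod.ext (Lp.ext ?_) (Lp.ext ?_)⟩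
      · refine (hV1 u.rectify ((𝓕 u.rectify).coeFn_toLp 2 volume)).trans (EventuallyEq.trans ?_ h1.symm)
        exact Eventually.of_forall fun t => (hu t).symm
      · refine (hV2 u.rectify hg.coeFn_toLp).trans (EventuallyEq.trans ?_ h2.symm)
        exact Eventually.of_forall fun t => by rw [hderiv]
    · rintro ⟨q, ⟨v', h1, h2⟩, rfl⟩
      set v : 𝓢(ℝ, ℂ) := 𝓕⁻ v'
      have hv : 𝓕 v = v' := FourierTransform.fourier_fourierInv_eq v'
      set u : WeightedSchwartz ψ w := ⟨fun t => v (ψ t) / w t, v, fun _ => rfl⟩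
      have hu : u.rectify = v := h.rectify_eq u fun _ => rfl
      rw [← hv] at h1 h2
      refine ⟨u, hV1 v h1, (hV2 v h2).trans (Eventually.of_forall fun t => ?_)⟩
      rw [hderiv, hu]
  refine ⟨fun u => ⟨?_, ?_⟩, conjSemigroup V (mulSemigroup m hm hre volume),
    isC0Semigroup_conjSemigroup V (isC0Semigroup_mulSemigroup m hm hre),
    fun τ _ => norm_conjSemigroup_le V _ (norm_mulSemigroup_le m hm hre τ), ?_, fun τ f hτ hf => ?_⟩
  · have hu : u.1 = fun t => u.rectify (ψ t) / w t := funext fun t => u.2.choose_spec t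
    rw [hu]
    exact h.memLp_comp u.rectify.continuous.stronglyMeasurable (u.rectify.memLp 2 volume)
  · rw [hderiv]
    have hint := integrable_mul_schwartz hm hC (𝓕 u.rectify)
    refine h.memLp_comp (continuous_invFourierIntegral hint).stronglyMeasurable ?_
    exact (memLp_congr_ae (coeFn_fourierInv hint
      (memLp_mul_schwartz hm hC (𝓕 u.rectify)).coeFn_toLp)).1 (Lp.memLp _)
  · rw [generatorGraph_conjSemigroup, generatorGraph_mulSemigroup, hgraph,
      ← closure_schwartzGraph hm hre hC]
    exact Homeomorph.image_closure _ _
  · rw [conjSemigroup_apply, hVapply, h.compEquiv_nonneg_iff]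
    have h1 : ∀ᵐ y, 0 ≤ h.compEquiv.symm f y := by
      rw [← h.compEquiv_nonneg_iff, LinearIsometryEquiv.apply_symm_apply]
      exact hf
    exact (isPosMult_exp_neg_bernstein (b := b) ha hσ (le_max_right τ 0)).ae_nonneg
      (fun ξ => norm_exp_neg_mul_le (hre ξ) τ) h1

end Generation

end WeylSonine

end

/-! ### Assembly of the three parts. -/

theorem proposition3p1 (n : ℕ) (hn : 1 ≤ n) (Φ : ℂ → ℂ)
    (hΦ : AnalyticOnNhd ℂ Φ {s : ℂ | 0 < s.re}) :
    -- Sonine pairs with symbol `Φ` are exactly the pairs of inverse Laplace transforms,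
    (∀ k κ : 𝓢'(ℝ, ℂ), IsSoninePairWithSymbol n Φ k κ ↔ IsInverseLaplacePair n Φ k κ) ∧
    -- and there is a unique such pair iff these inverse transforms exist.
    ((∃! p : 𝓢'(ℝ, ℂ) × 𝓢'(ℝ, ℂ), IsSoninePairWithSymbol n Φ p.1 p.2) ↔
      ∃ k κ : 𝓢'(ℝ, ℂ), IsInverseLaplacePair n Φ k κ) ∧
    -- Singularity at the origin.
    (∀ k κ : 𝓢'(ℝ, ℂ), IsSoninePairWithSymbol n Φ k κ →
      (∀ F : ℂ → ℂ, IsStieltjes F →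
        Tendsto (fun x : ℝ => ‖(x : ℂ) * F x‖) atTop atTop →
        Tendsto (fun x : ℝ => Φ x / F x) atTop (𝓝 1) → ¬ IsRegularAtOrigin κ) ∧
      (∀ (α : ℝ) (c : ℂ), (n : ℝ) - 1 < α → α < n → c ≠ 0 →
        Tendsto (fun x : ℝ => Φ x / ((x ^ (α - n) : ℝ) : ℂ)) atTop (𝓝 c) →
        ¬ IsRegularAtOrigin κ)) ∧
    -- The diffusive case: `sⁿ Φ(s)` is a (nonzero) complete Bernstein function.
    (IsCompleteBernstein (fun s => s ^ n * Φ s) → (∃ s : ℂ, 0 < s.re ∧ Φ s ≠ 0) →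
      (∃! p : 𝓢'(ℝ, ℂ) × 𝓢'(ℝ, ℂ), IsSoninePairWithSymbol n Φ p.1 p.2) ∧
      IsStieltjes (fun s => 1 / (s ^ n * Φ s)) ∧
      (n = 1 → IsStieltjes Φ) ∧
      ∀ k κ : 𝓢'(ℝ, ℂ), IsSoninePairWithSymbol n Φ k κ →
        HasCompletelyMonotoneDensity k ∧
        (IsStieltjes Φ → HasCompletelyMonotoneDensity κ) ∧
        (n = 1 → IsConvolution k (TemperedDistribution.derivCLM ℂ κ) fun φ => φ 0) ∧
        ∀ ψ w : ℝ → ℝ, IsAdmissible ψ w →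
          IntegralPreservesPositivity ψ w k ∧
          (IsStieltjes Φ → IntegralPreservesPositivity ψ w κ) ∧
          GeneratesPositiveSemigroup ψ w n κ) := by
  refine ⟨isSoninePairWithSymbol_iff hn Φ, existsUnique_soninePair_iff hn Φ, fun k κ h => ⟨?_, ?_⟩,
    fun hB hne => ?_⟩
  · intro F _ hF hlim
    exact not_isRegularAtOrigin_of_tendsto h.1.2.1 h.2 one_ne_zero hF hlim
  · intro α c hα _ hc hlim
    exact not_isRegularAtOrigin_of_tendsto h.1.2.1 h.2 hc (tendsto_norm_mul_rpow hα) hlim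
  · obtain ⟨a, b, σ₀, ha, hb, hσ₀, hΨ⟩ := hB
    obtain ⟨s₀, hs₀, hne⟩ := hne
    have hσ := isStieltjesMeasure_restrict hσ₀
    have hΨ' : ∀ s : ℂ, 0 < s.re → s ^ n * Φ s = bernstein a b (σ₀.restrict (Ioi 0)) s := hΨ
    have hne' : s₀ ^ n * Φ s₀ ≠ 0 := mul_ne_zero (pow_ne_zero n (ne_zero_of_re_pos hs₀)) hne
    have hΦ0 (s : ℂ) (hs : 0 < s.re) : Φ s ≠ 0 := by
      rw [hΨ' s₀ hs₀] at hne'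
      have h1 := ne_zero_of_re_pos (re_bernstein_pos ha hb hσ hne' hs)
      rw [← hΨ' s hs] at h1
      exact right_ne_zero_of_mul h1
    have hS : IsStieltjes fun s => 1 / (s ^ n * Φ s) :=
      isStieltjes_one_div ((differentiable_id.pow n).differentiableOn.mul hΦ.differentiableOn)
        ha hb hσ hΨ' hs₀ hne'
    obtain ⟨k₀, hk₀, hLk₀, hCM⟩ := hS.exists_distribution
    obtain ⟨κ₀, hκ₀, hLκ₀⟩ := exists_distribution_of_bernstein hn ha hσ hΨ'
    have hpair : IsInverseLaplacePair n Φ k₀ κ₀ := ⟨hk₀, hκ₀, hΦ0, hLk₀, hLκ₀⟩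
    refine ⟨(existsUnique_soninePair_iff hn Φ).2 ⟨k₀, κ₀, hpair⟩, hS, ?_, fun k κ hkκ => ?_⟩
    · rintro rfl
      -- For n = 1 one has Φ = Ψ/s, so the same characteristics serve for the Stieltjes
      -- representation.
      refine ⟨a, b, σ₀, ha, hb, hσ₀, fun s hs => ?_⟩
      have h0 := ne_zero_of_re_pos hs
      have h1 := hΨ' s hs
      rw [bernstein_eq_mul h0, pow_one] at h1
      exact mul_left_cancel₀ h0 h1
    · have hinv := (isSoninePairWithSymbol_iff hn Φ k κ).1 hkκ
      -- By uniqueness an arbitrary Sonine pair is the constructed one, so the density found for k₀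
      -- is a statement about k.
      obtain ⟨rfl, rfl⟩ := hinv.unique hpair
      have hκCM (hF : IsStieltjes Φ) : HasCompletelyMonotoneDensity κ := by
        obtain ⟨T, hT, hLT, hTCM⟩ := hF.exists_distribution
        rwa [eq_of_laplace_eq hinv.2.1 hT fun s hs => (hLκ₀ s hs).trans (hLT s hs).symm]
      obtain ⟨κ₁, hκ₁, hφ⟩ := hσ.exists_distribution ha b
      refine ⟨hCM, hκCM, ?_, fun ψ w h => ⟨hCM.integralPreservesPositivity h,
        fun hF => (hκCM hF).integralPreservesPositivity h, ?_⟩⟩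
      · rintro rfl
        exact hinv.isConvolution_deriv
      · exact generatesPositiveSemigroup hn ha hσ (iterate_deriv_eq hn hσ hΨ' hκ₀ hLκ₀ hκ₁ hφ) hφ h
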